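/- Conventions. For a pure simplicial complex $C$, $\operatorname{vdist}_C(A,B)$ denotes the minimum distance in the $1$-skeleton between a vertex of $A$ and a vertex of $B$ ($\infty$ if $A$ or $B$ is empty; in a $0$-dimensional complex distinct vertices have distance $1$). An \emph{ordered facet} is a facet $F=(v_1,\dots,v_d)$ with a chosen order of its vertices. For a set $S$ of vertices, its \emph{vector of distances} to $S$ is $(\lambda_1,\dots,\lambda_d)$, where $\lambda_1=\operatorname{vdist}_C(v_1,S)$ and $(\lambda_2,\dots,\lambda_d)$ is the vector of distances of $(v_2,\dots,v_d)$ in $\operatorname{lk}_C(v_1)$ to $S'$; here $S'=S\cap\operatorname{lk}_C(v_1)$ if $v_1\in S$, and otherwise $S'$ is the set of vertices $v$ of $\operatorname{lk}_C(v_1)$ with $\operatorname{vdist}_C(v,S)=\operatorname{vdist}_C(v_1,S)-1$ (with $S'=\emptyset$ if $\operatorname{vdist}_C(v_1,S)=\infty$). The order is \emph{admissible} with respect to $S$ if $\lambda_1=\operatorname{vdist}_C(F,S)$ and, recursively, $(v_2,\dots,v_d)$ is admissible in $\operatorname{lk}_C(v_1)$ with respect to $S'$. Two facets are adjacent in the dual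 graph if they differ in a single vertex. A path $[F_0,\dots,F_N]$ of ordered facets in the dual graph has length $N$; it is \emph{monotone} towards $S$ if the vectors of distances to $S$ strictly decrease lexicographically along it, and \emph{conservative} towards $S$ if $F_0$ is admissible and for every $i\ge 1$ the vertex of $F_{i-1}\setminus F_i$ is the last one of $F_{i-1}$, $F_i$ is admissible, and among all admissible reorderings of $F_i$ the chosen one has the largest possible first position in which it differs from $F_{i-1}$. A complex is \emph{flag} if all its minimal nonfaces are edges; a flag $3$-polytope is a simplicial $3$-polytope whose boundary complex is flag (and facets and paths are those of the boundary complex). **Lemma.** (a) For every $k\in\mathbb N$ there is a flag simplicial $2$-ball with two facets $F$ and $G$ and two monotone conservative paths from $F$ to $G$ (towards the target set $G$) whose lengths differ by at least $k$. For every $k\in\mathbb N$ there is also a flag $3$-polytope with this property. (b) There is a flag simplicial $2$-ball with two facets $F$ and $G$ such that monotone conservative paths from $F$ to $G$ (towards $G$) exist, but, whatever the nonempty target set $S$ of vertices, no monotone conservative path from $F$ to $G$ towards $S$ is a shortest path from $F$ to $G$ in the dual graph. There is also a flag $3$-polytope with this property. -/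

import Mathlib

namespace MonoCons

section Complexes

/-! Simplicial complexes are `PreAbstractSimplicialComplex V`: downward closed families of nonempty
finite subsets of `V`. The vertices of the complex are the `v` such that `{v}` is a face. -/

/-- The set of vertices of a complex. -/
def vertexSet {V : Type*} (C : PreAbstractSimplicialComplex V) : Set V :=
  {v | {v} ∈ C.faces}

/-- Facets are the inclusion-maximal faces. -/
def IsFacet {V : Type*} (C : PreAbstractSimplicialComplex V) (F : Finset V) : Prop :=
  Maximal (fun f => f ∈ C.faces) F

/-- A minimal nonface: a nonempty set of vertices which is not a face, but all of whose proper
(nonempty) subsets are faces. -/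
def IsMinimalNonface {V : Type*} (C : PreAbstractSimplicialComplex V) (f : Finset V) : Prop :=
  f.Nonempty ∧ (∀ v ∈ f, v ∈ vertexSet C) ∧ f ∉ C.faces ∧
    ∀ g : Finset V, g ⊂ f → g.Nonempty → g ∈ C.faces

/-- A complex is flag if all its minimal nonfaces are edges (pairs of vertices). -/
def IsFlag {V : Type*} (C : PreAbstractSimplicialComplex V) : Prop :=
  ∀ f : Finset V, IsMinimalNonface C f → f.card = 2

/-- The link of a vertex. -/
def link {V : Type*} [DecidableEq V] (C : PreAbstractSimplicialComplex V) (v : V) :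
    PreAbstractSimplicialComplex V where
  faces := {f | f.Nonempty ∧ v ∉ f ∧ insert v f ∈ C.faces}
  isRelLowerSet_faces := by
    rintro f ⟨hf, hv, hC⟩
    refine ⟨hf, fun g hg hne => ⟨hne, fun h => hv (hg h), ?_⟩⟩
    exact (C.isRelLowerSet_faces hC).2 (Finset.insert_subset_insert v hg)
      (Finset.insert_nonempty v g)

/-- The `1`-skeleton of a complex, as a graph. -/
def skeletonGraph {V : Type*} [DecidableEq V] (C : PreAbstractSimplicialComplex V) :
    SimpleGraph V where
  Adj u w := u ≠ w ∧ {u, w} ∈ C.faces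
  symm := ⟨fun u w h => ⟨h.1.symm, by rw [Finset.pair_comm]; exact h.2⟩⟩
  loopless := ⟨fun _ h => h.1 rfl⟩

/-- The dual graph: two facets are adjacent if they differ in a single vertex.
(Sets that are not facets are isolated nodes.) -/
def dualGraph {V : Type*} [DecidableEq V] (C : PreAbstractSimplicialComplex V) :
    SimpleGraph (Finset V) where
  Adj F G := IsFacet C F ∧ IsFacet C G ∧ (F \ G).card = 1 ∧ (G \ F).card = 1
  symm := ⟨fun _ _ h => ⟨h.2.1, h.1, h.2.2.2, h.2.2.1⟩⟩
  loopless := ⟨fun F h => by simpa using h.2.2.1⟩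

end Complexes

section Distances

/-- A complex is `0`-dimensional if all its faces are single vertices. -/
def IsZeroDim {V : Type*} (C : PreAbstractSimplicialComplex V) : Prop :=
  ∀ f ∈ C.faces, f.card = 1

open Classical in
/-- Vertex-distance between two vertices: the distance in the `1`-skeleton (infinite between
different components), except that in a `0`-dimensional complex distinct vertices have
distance `1`. -/
noncomputable def pointDist {V : Type*} [DecidableEq V] (C : PreAbstractSimplicialComplex V)
    (u w : V) : ℕ∞ :=
  if IsZeroDim C then (if u = w then 0 else 1) else (skeletonGraph C).edist u w

/-- Vertex-distance between two sets of vertices: the minimum of the distances between their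
elements, which is `⊤` if one of the sets is empty. -/
noncomputable def vdist {V : Type*} [DecidableEq V] (C : PreAbstractSimplicialComplex V)
    (A B : Set V) : ℕ∞ :=
  ⨅ u ∈ A, ⨅ w ∈ B, pointDist C u w

open Classical in
/-- The target set induced by `S` in the link of `v`: the part of `S` in the link if `v ∈ S`, and
the vertices of the link that are by one closer to `S` than `v` if `v ∉ S` (there are none if the
distance from `v` to `S` is infinite). -/
noncomputable def nextTarget {V : Type*} [DecidableEq V] (C : PreAbstractSimplicialComplex V)
    (S : Set V) (v : V) : Set V :=
  if v ∈ S then S ∩ vertexSet (link C v)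
  else {w | w ∈ vertexSet (link C v) ∧ vdist C {v} S ≠ ⊤ ∧ vdist C {w} S + 1 = vdist C {v} S}

/-- The vector of distances from an ordered facet (a list of vertices) of `C` to `S`. -/
noncomputable def distVector {V : Type*} [DecidableEq V] :
    PreAbstractSimplicialComplex V → Set V → List V → List ℕ∞
  | _, _, [] => []
  | C, S, v :: l => vdist C {v} S :: distVector (link C v) (nextTarget C S v) l

/-- Admissibility of an ordered facet of `C` with respect to the target set `S`. -/
def IsAdmissible {V : Type*} [DecidableEq V] :
    PreAbstractSimplicialComplex V → Set V → List V → Prop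
  | _, _, [] => True
  | C, S, v :: l => vdist C {v} S = vdist C {w | w ∈ v :: l} S ∧
      IsAdmissible (link C v) (nextTarget C S v) l

end Distances

section Paths

/-- An ordered facet: a facet listed in some order without repetitions. -/
def IsOrderedFacet {V : Type*} [DecidableEq V] (C : PreAbstractSimplicialComplex V)
    (L : List V) : Prop :=
  L.Nodup ∧ IsFacet C L.toFinset

/-- The index of a step: the first position in which the two orderings differ. Positions are
counted from `0` here, which is irrelevant for comparing indices. -/
def stepIndex {V : Type*} [DecidableEq V] : List V → List V → ℕ
  | a :: l, b :: m => if a = b then stepIndex l m + 1 else 0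
  | _, _ => 0

/-- The step from the ordered facet `L` to the ordered facet `M` is conservative towards `S`:
the vertex of `L` not in `M` is the last one of `L`, and `M` is admissible and has maximal index
among all the admissible reorderings of `M`. -/
def IsConservativeStep {V : Type*} [DecidableEq V] (C : PreAbstractSimplicialComplex V)
    (S : Set V) (L M : List V) : Prop :=
  (∃ v : V, L.getLast? = some v ∧ L.toFinset \ M.toFinset = {v}) ∧
  IsAdmissible C S M ∧
  ∀ M' : List V, M'.Perm M → IsAdmissible C S M' → stepIndex L M' ≤ stepIndex L M

/-- A path `[Γ 0, …, Γ N]` of ordered facets in the dual graph, of length `N`. -/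
structure IsOrderedFacetPath {V : Type*} [DecidableEq V] (C : PreAbstractSimplicialComplex V)
    (N : ℕ) (Γ : Fin (N + 1) → List V) : Prop where
  orderedFacet : ∀ i, IsOrderedFacet C (Γ i)
  adj : ∀ i : Fin N, (dualGraph C).Adj (Γ i.castSucc).toFinset (Γ i.succ).toFinset
  simple : Function.Injective fun i => (Γ i).toFinset

/-- The vectors of distances are lexicographically (strictly) decreasing along the path. -/
def IsMonotoneTowards {V : Type*} [DecidableEq V] (C : PreAbstractSimplicialComplex V)
    (S : Set V) (N : ℕ) (Γ : Fin (N + 1) → List V) : Prop :=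
  ∀ i : Fin N, List.Lex (· < ·) (distVector C S (Γ i.succ)) (distVector C S (Γ i.castSucc))

/-- The first ordered facet is admissible and all steps are conservative. -/
def IsConservativeTowards {V : Type*} [DecidableEq V] (C : PreAbstractSimplicialComplex V)
    (S : Set V) (N : ℕ) (Γ : Fin (N + 1) → List V) : Prop :=
  IsAdmissible C S (Γ 0) ∧ ∀ i : Fin N, IsConservativeStep C S (Γ i.castSucc) (Γ i.succ)

/-- `Γ` is a monotone conservative path of length `N` towards the target set `S` whose first
facet is `F` and whose last facet is `G`. -/
structure IsMonotoneConservativePath {V : Type*} [DecidableEq V]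
    (C : PreAbstractSimplicialComplex V) (S : Set V) (F G : Finset V)
    (N : ℕ) (Γ : Fin (N + 1) → List V) : Prop where
  path : IsOrderedFacetPath C N Γ
  start : (Γ 0).toFinset = F
  finish : (Γ (Fin.last N)).toFinset = G
  monotone : IsMonotoneTowards C S N Γ
  conservative : IsConservativeTowards C S N Γ

/-- There are two facets `F`, `G` and two monotone conservative paths from `F` to `G` (towards the
target set `G`) whose lengths differ by at least `k`. -/
def HasLengthGap {V : Type*} [DecidableEq V] (C : PreAbstractSimplicialComplex V)
    (k : ℕ) : Prop :=
  ∃ F G : Finset V, IsFacet C F ∧ IsFacet C G ∧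
    ∃ (N₁ N₂ : ℕ) (Γ₁ : Fin (N₁ + 1) → List V) (Γ₂ : Fin (N₂ + 1) → List V),
      IsMonotoneConservativePath C (G : Set V) F G N₁ Γ₁ ∧
      IsMonotoneConservativePath C (G : Set V) F G N₂ Γ₂ ∧
      N₁ + k ≤ N₂

/-- There are two facets `F`, `G`, joined by some monotone conservative path (towards `G`), such
that, whatever the target set `S` is, every monotone conservative path from `F` to `G` towards `S`
is strictly longer than a shortest path from `F` to `G` in the dual graph. -/
def HasNoShortestMonotoneConservativePath {V : Type*} [DecidableEq V]
    (C : PreAbstractSimplicialComplex V) : Prop :=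
  ∃ F G : Finset V, IsFacet C F ∧ IsFacet C G ∧
    (∃ (N : ℕ) (Γ : Fin (N + 1) → List V),
      IsMonotoneConservativePath C (G : Set V) F G N Γ) ∧
    ∀ S : Set V, S.Nonempty → S ⊆ vertexSet C →
      ∀ (N : ℕ) (Γ : Fin (N + 1) → List V),
        IsMonotoneConservativePath C S F G N Γ → (dualGraph C).dist F G < N

end Paths

section BallsAndPolytopes

/-- The geometric realization of a finite complex, in barycentric coordinates. -/
def realization {V : Type*} [Fintype V] (C : PreAbstractSimplicialComplex V) : Set (V → ℝ) :=
  {x | x ∈ stdSimplex ℝ V ∧ ∃ f ∈ C.faces, ∀ v, x v ≠ 0 → v ∈ f}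

/-- A simplicial `d`-ball: a complex whose geometric realization is homeomorphic to the closed unit
ball of `ℝ^d`. -/
def IsSimplicialBall {V : Type*} [Fintype V] (d : ℕ)
    (C : PreAbstractSimplicialComplex V) : Prop :=
  Nonempty (realization C ≃ₜ Metric.closedBall (0 : EuclideanSpace ℝ (Fin d)) 1)

/-- `C` is (up to relabelling of the vertices) the boundary complex of a simplicial `d`-polytope:
there are points `p v` in `ℝ^d` whose convex hull `P` is `d`-dimensional and has exactly the points
`p v` as its vertices, such that every proper face of `P` is a simplex, and the faces of `C` are the
vertex sets of the nonempty proper faces of `P`. -/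
def IsSimplicialPolytopeBoundary {V : Type*} [Fintype V] (d : ℕ)
    (C : PreAbstractSimplicialComplex V) : Prop :=
  ∃ p : V → EuclideanSpace ℝ (Fin d),
    Function.Injective p ∧
    (interior (convexHull ℝ (Set.range p))).Nonempty ∧
    (convexHull ℝ (Set.range p)).extremePoints ℝ = Set.range p ∧
    (∀ E : Set (EuclideanSpace ℝ (Fin d)),
      IsExposed ℝ (convexHull ℝ (Set.range p)) E → E ≠ convexHull ℝ (Set.range p) →
        AffineIndependent ℝ (fun v : {v : V // p v ∈ E} => p v)) ∧
    ∀ f : Finset V, f ∈ C.faces ↔ f.Nonempty ∧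
      ∃ E : Set (EuclideanSpace ℝ (Fin d)),
        IsExposed ℝ (convexHull ℝ (Set.range p)) E ∧ E ≠ convexHull ℝ (Set.range p) ∧
          ∀ v : V, v ∈ f ↔ p v ∈ E

end BallsAndPolytopes

end MonoCons

/-! A conservative path rotates about the first vertex of its ordered facet, its head, and changes
the head only when it meets a vertex strictly closer to the target. Both parts exploit how little
control this gives over dual distance.

Length gap: a cycle `0, …, 2n - 1` is coned by `2n` on one side. On the other side two adjacent
apices share it, `2n + 1` over `0, …, n` and `2n + 2` over the rest. The target is `{n, 2n + 1, 2n +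
2}` and the start is `{2n, 0, 1}`. All three starting vertices have distance `1`, so both `0` and
`2n` may be the head. With head `0` the path enters the star of `2n + 1` at once and finishes in `3`
steps. With head `2n` it walks along the cycle from `0` to `n` and needs `n + 1` steps. Hence the
difference is unbounded (`IsGapFamily.hasLengthGap`).

No shortest path: an explicit sphere on `20` vertices has a unique shortest dual path from `{0, 1,
2}` to `{8, 10, 11}`, a strip of length `9`. A conservative path following the strip would have to
replace its head so often that vertex `8` is at least three closer to the target than `0`, or `10`
at least four closer. But `0, 12, 8, 10` is a path in the graph, so these differences are at most
two and three, for every target set (`no_heads_in_strip`). A monotone conservative path does exist: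
it rotates about `0`, `12` and `8` and has length `10`.

Polytopes and balls are treated together. Each sphere is the boundary of a polytope given by integer
coordinates and supporting functionals (`IsPolytopeCertificate`), and the ball is obtained by
deleting one vertex that neither the paths nor the strip use. Combinatorial statements are proved
for every family of triangles between the deletion and the sphere: upper bounds on distances use
triangles of the deletion, lower bounds use `1`-Lipschitz potentials on the sphere.

The geometric input is a covering lemma (`exists_mem_conicHull`): simplicial cones that match across
their walls cover the convex region in question. Applied to cones from the origin it shows that the
listed triangles are all the facets of the polytope. Applied to cones from a vertex it shows that
projection from that vertex maps the deletion onto a convex polygon. -/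

namespace MonoCons

set_option linter.unusedSectionVars false

/-! ### Complexes generated by triangles, and flagness -/

section Generated

variable {V : Type*} [DecidableEq V]

/-- The complex generated by a family of sets. -/
def ofTriangles (T : Finset (Finset V)) : PreAbstractSimplicialComplex V where
  faces := {f | f.Nonempty ∧ ∃ t ∈ T, f ⊆ t}
  isRelLowerSet_faces := by
    rintro f ⟨hf, t, ht, hft⟩
    exact ⟨hf, fun g hg hne => ⟨hne, t, ht, hg.trans hft⟩⟩

theorem mem_faces_ofTriangles {T : Finset (Finset V)} {f : Finset V} :
    f ∈ (ofTriangles T).faces ↔ f.Nonempty ∧ ∃ t ∈ T, f ⊆ t := Iff.rfl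

theorem isFacet_ofTriangles {T : Finset (Finset V)} (hT : ∀ t ∈ T, t.card = 3) {f : Finset V} :
    IsFacet (ofTriangles T) f ↔ f ∈ T := by
  constructor
  · rintro ⟨⟨hne, t, ht, hft⟩, hmax⟩
    have htne : t.Nonempty := Finset.card_pos.1 (by rw [hT t ht]; norm_num)
    have : f = t := hft.antisymm (hmax (y := t) ⟨htne, t, ht, subset_rfl⟩ hft)
    exact this ▸ ht
  · intro hf
    have hne : f.Nonempty := Finset.card_pos.1 (by rw [hT f hf]; norm_num)
    refine ⟨⟨hne, f, hf, subset_rfl⟩, ?_⟩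
    rintro g ⟨_, t, ht, hgt⟩ hfg
    have : f = t := Finset.eq_of_subset_of_card_le (hfg.trans hgt) (by rw [hT f hf, hT t ht])
    exact this ▸ hgt

theorem skeletonGraph_adj_ofTriangles {T : Finset (Finset V)} {u w : V} :
    (skeletonGraph (ofTriangles T)).Adj u w ↔ u ≠ w ∧ ∃ t ∈ T, u ∈ t ∧ w ∈ t := by
  simp [skeletonGraph, mem_faces_ofTriangles, Finset.insert_subset_iff]

theorem mem_vertexSet_link_ofTriangles {T : Finset (Finset V)} {v w : V} :
    w ∈ vertexSet (link (ofTriangles T) v) ↔ v ≠ w ∧ ∃ t ∈ T, v ∈ t ∧ w ∈ t := by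
  simp [vertexSet, link, mem_faces_ofTriangles, Finset.insert_subset_iff]

theorem skeletonGraph_link_adj_ofTriangles {T : Finset (Finset V)} {v u w : V} :
    (skeletonGraph (link (ofTriangles T) v)).Adj u w ↔
      u ≠ w ∧ v ≠ u ∧ v ≠ w ∧ ∃ t ∈ T, v ∈ t ∧ u ∈ t ∧ w ∈ t := by
  simp [skeletonGraph, link, mem_faces_ofTriangles, Finset.insert_subset_iff, and_assoc]

/-- A family of triangles in which all `3`-cliques are triangles and no triangle extends to a
`4`-clique. -/
structure NoEmptyCliques (T : Finset (Finset V)) : Prop where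
  triple : ∀ a b c : V, a ≠ b → a ≠ c → b ≠ c → (∃ t ∈ T, a ∈ t ∧ b ∈ t) →
    (∃ t ∈ T, a ∈ t ∧ c ∈ t) → (∃ t ∈ T, b ∈ t ∧ c ∈ t) → {a, b, c} ∈ T
  quadruple : ∀ t ∈ T, ∀ v ∉ t, ∃ u ∈ t, ∀ s ∈ T, u ∈ s → v ∉ s

/-- A minimal nonface with at least three elements has all pairs as faces, so three of its vertices
form a triangle by `triple`. Either this triangle contains the whole set, making it a face, or a
fourth vertex is joined to all three, against `quadruple`. -/
theorem NoEmptyCliques.isFlag {T : Finset (Finset V)} (h : NoEmptyCliques T) :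
    IsFlag (ofTriangles T) := by
  rintro f ⟨hne, hv, hf, hsub⟩
  by_contra hcard
  have hc0 : 0 < f.card := hne.card_pos
  have hc1 : f.card ≠ 1 := by
    intro h1
    obtain ⟨v, rfl⟩ := Finset.card_eq_one.1 h1
    exact hf (hv v (by simp))
  have hpair : ∀ a ∈ f, ∀ b ∈ f, ∃ t ∈ T, a ∈ t ∧ b ∈ t := by
    intro a ha b hb
    have hss : ({a, b} : Finset V) ⊂ f := by
      refine Finset.ssubset_iff_subset_ne.2 ⟨by simp [Finset.insert_subset_iff, ha, hb], ?_⟩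
      intro he
      have := Finset.card_le_two (a := a) (b := b)
      rw [he] at this
      omega
    obtain ⟨-, t, ht, hab⟩ := hsub _ hss (by simp)
    exact ⟨t, ht, hab (by simp), hab (by simp)⟩
  obtain ⟨a, ha, b, hb, c, hc, hab, hac, hbc⟩ := Finset.two_lt_card.1 (show 2 < f.card by omega)
  have htri := h.triple a b c hab hac hbc (hpair a ha b hb) (hpair a ha c hc) (hpair b hb c hc)
  by_cases hsubs : f ⊆ {a, b, c}
  · exact hf ⟨hne, _, htri, hsubs⟩
  · obtain ⟨v, hvf, hvt⟩ := Finset.not_subset.1 hsubs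
    obtain ⟨u, hu, hno⟩ := h.quadruple _ htri v hvt
    have huf : u ∈ f := by
      simp only [Finset.mem_insert, Finset.mem_singleton] at hu
      rcases hu with rfl | rfl | rfl <;> assumption
    obtain ⟨t, ht, h1, h2⟩ := hpair u huf v hvf
    exact hno t ht h1 h2

/-- Deleting a vertex gives an induced subcomplex, so the flagness of the balls is inherited from
the spheres. -/
theorem NoEmptyCliques.filter {T : Finset (Finset V)} (h : NoEmptyCliques T) (v₀ : V) :
    NoEmptyCliques (T.filter fun t => v₀ ∉ t) where
  triple := by
    rintro a b c hab hac hbc ⟨t, ht, h1, h2⟩ ⟨s, hs, h3, h4⟩ ⟨r, hr, h5, h6⟩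
    simp only [Finset.mem_filter] at ht hs hr ⊢
    refine ⟨h.triple a b c hab hac hbc ⟨t, ht.1, h1, h2⟩ ⟨s, hs.1, h3, h4⟩ ⟨r, hr.1, h5, h6⟩, ?_⟩
    simp only [Finset.mem_insert, Finset.mem_singleton]
    rintro (rfl | rfl | rfl)
    exacts [ht.2 h1, ht.2 h2, hs.2 h4]
  quadruple := by
    intro t ht v hv
    obtain ⟨u, hu, hno⟩ := h.quadruple t (Finset.mem_filter.1 ht).1 v hv
    exact ⟨u, hu, fun s hs => hno s (Finset.mem_filter.1 hs).1⟩

end Generated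

/-! ### Vertex distances: upper bounds by edges, lower bounds by potentials -/

section Distance

variable {V : Type*} [DecidableEq V] {C : PreAbstractSimplicialComplex V} {S : Set V} {u v w : V}

theorem not_isZeroDim_of_adj (h : (skeletonGraph C).Adj u w) : ¬ IsZeroDim C := by
  intro hz
  have := hz _ h.2
  rw [Finset.card_pair h.1] at this
  omega

theorem vdist_singleton (C : PreAbstractSimplicialComplex V) (u : V) (S : Set V) :
    vdist C {u} S = ⨅ w ∈ S, pointDist C u w := by
  simp [vdist]

theorem vdist_eq_iInf_singleton (C : PreAbstractSimplicialComplex V) (A S : Set V) :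
    vdist C A S = ⨅ u ∈ A, vdist C {u} S := by
  simp [vdist]

theorem vdist_singleton_eq_iff {l : List V} :
    vdist C {v} S = vdist C {w | w ∈ v :: l} S ↔ ∀ w ∈ l, vdist C {v} S ≤ vdist C {w} S := by
  rw [vdist_eq_iInf_singleton C {w | w ∈ v :: l}]
  constructor
  · intro h w hw
    rw [h]
    exact iInf₂_le w (by simp [hw])
  · intro h
    refine le_antisymm (le_iInf₂ fun w hw => ?_) (iInf₂_le v (by simp))
    rcases List.mem_cons.1 hw with rfl | hw
    exacts [le_rfl, h w hw]

theorem pointDist_eq_zero_iff : pointDist C u w = 0 ↔ u = w := by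
  unfold pointDist
  split_ifs <;> simp_all

theorem vdist_singleton_eq_zero_iff : vdist C {u} S = 0 ↔ u ∈ S := by
  rw [vdist_singleton]
  constructor
  · intro h
    by_contra hu
    have : (1 : ℕ∞) ≤ ⨅ w ∈ S, pointDist C u w := by
      refine le_iInf₂ fun w hw => ?_
      rw [Order.one_le_iff_ne_zero, Ne, pointDist_eq_zero_iff]
      rintro rfl
      exact hu hw
    rw [h] at this
    simp at this
  · intro hu
    refine le_antisymm ((iInf₂_le u hu).trans_eq ?_) bot_le
    exact pointDist_eq_zero_iff.2 rfl

theorem one_le_vdist_singleton_iff : 1 ≤ vdist C {u} S ↔ u ∉ S := by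
  rw [Order.one_le_iff_ne_zero, Ne, vdist_singleton_eq_zero_iff]

theorem vdist_le_add_one_of_adj (h : (skeletonGraph C).Adj u w) :
    vdist C {u} S ≤ vdist C {w} S + 1 := by
  have hz := not_isZeroDim_of_adj h
  rw [vdist_singleton, vdist_singleton, ENat.iInf_add]
  refine le_iInf fun s => ?_
  by_cases hs : s ∈ S
  · simp only [hs, iInf_pos]
    refine (iInf₂_le s hs).trans ?_
    simp only [pointDist, if_neg hz]
    calc (skeletonGraph C).edist u s
        ≤ (skeletonGraph C).edist u w + (skeletonGraph C).edist w s :=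
          SimpleGraph.edist_triangle
      _ = (skeletonGraph C).edist w s + 1 := by
          rw [SimpleGraph.edist_eq_one_iff_adj.2 h, add_comm]
  · simp [hs]

theorem le_edist_of_lipschitz {G : SimpleGraph V} {f : V → ℕ}
    (hf : ∀ u w, G.Adj u w → f u ≤ f w + 1) (u : V) (hw : f w = 0) :
    (f u : ℕ∞) ≤ G.edist u w := by
  rw [SimpleGraph.edist]
  refine le_iInf fun p => ?_
  have : f u ≤ p.length := by
    induction p with
    | nil => simp [hw]
    | cons h p ih => 
      have h1 := hf _ _ h
      have h2 := ih hw
      rw [SimpleGraph.Walk.length_cons]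
      exact h1.trans (Nat.succ_le_succ h2)
  exact_mod_cast this

/-- A potential vanishing on the target and dropping by at most one along each edge bounds distances
from below. Removing edges preserves the Lipschitz condition, so a single potential serves the
sphere and its deletion. -/
theorem le_vdist_of_lipschitz (hC : ¬ IsZeroDim C) {f : V → ℕ}
    (hf : ∀ u w, (skeletonGraph C).Adj u w → f u ≤ f w + 1) (hS : ∀ w ∈ S, f w = 0) (u : V) :
    (f u : ℕ∞) ≤ vdist C {u} S := by
  rw [vdist_singleton]
  refine le_iInf₂ fun w hw => ?_
  rw [pointDist, if_neg hC]
  exact le_edist_of_lipschitz hf u (hS w hw)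

theorem nextTarget_of_mem (hv : v ∈ S) : nextTarget C S v = S ∩ vertexSet (link C v) := by
  rw [nextTarget, if_pos hv]

theorem mem_nextTarget_of_notMem {n : ℕ} (hv : vdist C {v} S = (n + 1 : ℕ)) :
    w ∈ nextTarget C S v ↔ w ∈ vertexSet (link C v) ∧ vdist C {w} S = n := by
  have hvS : v ∉ S := by
    rw [← vdist_singleton_eq_zero_iff (C := C), hv]
    exact_mod_cast Nat.succ_ne_zero n
  rw [nextTarget, if_neg hvS, Set.mem_ofPred_eq, hv]
  refine and_congr_right fun _ => ⟨fun h => ?_, fun h => ⟨by simp, by rw [h]; simp⟩⟩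
  have h2 := h.2
  generalize vdist C {w} S = x at h2 ⊢
  induction x using ENat.recTopCoe with
  | top =>
    rw [top_add] at h2
    exact absurd h2 (by exact_mod_cast ENat.top_ne_natCast (n + 1))
  | coe m =>
    have h3 : m + 1 = n + 1 := by exact_mod_cast h2
    exact_mod_cast Nat.succ_injective h3

end Distance

/-! ### The three kinds of monotone conservative steps -/

section Steps

variable {V : Type*} [DecidableEq V] {C : PreAbstractSimplicialComplex V} {S : Set V}

/-- The distance in the link of `v` to the induced target set. -/
noncomputable def linkDist (C : PreAbstractSimplicialComplex V) (S : Set V) (v a : V) : ℕ∞ :=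
  vdist (link C v) {a} (nextTarget C S v)

/-- The recursion imposes nothing on the last vertex, so only the choice of the head and the order
of the other two matter. -/
theorem isAdmissible_triple {v a b : V} :
    IsAdmissible C S [v, a, b] ↔ vdist C {v} S ≤ vdist C {a} S ∧ vdist C {v} S ≤ vdist C {b} S ∧
      linkDist C S v a ≤ linkDist C S v b := by
  simp only [IsAdmissible, vdist_singleton_eq_iff, linkDist]
  simp [and_assoc]

theorem exists_eq_triple_of_perm {L : List V} {a b c : V} (h : L.Perm [a, b, c]) :
    ∃ x y z, L = [x, y, z] := by
  have := h.length_eq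
  exact List.length_eq_three.1 (by simpa using this)

theorem sdiff_triple {v a b w : V} (hvb : v ≠ b) (hab : a ≠ b) (hwb : w ≠ b) {M : List V}
    (hM : M.Perm [v, a, w]) : ([v, a, b] : List V).toFinset \ M.toFinset = {b} := by
  have : M.toFinset = {v, a, w} := by rw [List.toFinset_eq_of_perm _ _ hM]; simp
  rw [this]
  ext x
  simp only [List.toFinset_cons, List.toFinset_nil, Finset.mem_sdiff, Finset.mem_insert,
    Finset.mem_singleton]
  grind

/-- A step of a monotone conservative path. -/
structure IsMonoConsStep (C : PreAbstractSimplicialComplex V) (S : Set V) (L M : List V) :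
    Prop where
  conservative : IsConservativeStep C S L M
  lex : List.Lex (· < ·) (distVector C S M) (distVector C S L)

/-- Rotation about the first vertex. -/
theorem isMonoConsStep_rotate {v a b w : V} (hvb : v ≠ b) (hab : a ≠ b) (hwb : w ≠ b)
    (hwa : w ≠ a) (hvw : vdist C {v} S ≤ vdist C {w} S)
    (hva : vdist C {v} S ≤ vdist C {a} S) (hlt : linkDist C S v w < linkDist C S v a) :
    IsMonoConsStep C S [v, a, b] [v, w, a] where
  conservative := by
    refine ⟨⟨b, rfl, sdiff_triple hvb hab hwb ?_⟩, isAdmissible_triple.2 ⟨hvw, hva, hlt.le⟩, ?_⟩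
    · exact List.Perm.cons _ (List.Perm.swap _ _ _)
    · intro M' hM' hadm
      -- A larger index would require the order `[v, a, w]`, which is inadmissible since `w` is
      -- strictly closer than `a` in the link of `v`.
      obtain ⟨x, y, z, rfl⟩ := exists_eq_triple_of_perm hM'
      by_cases hx : v = x
      · by_cases hy : a = y
        · subst hx hy
          have hz : z = w := by
            have := (List.perm_cons _).1 hM'
            have := (this.trans (List.Perm.swap a w [])).cons_inv
            simpa using this
          subst hz
          exact absurd (isAdmissible_triple.1 hadm).2.2 (not_le.2 hlt)
        · simp [stepIndex, hx, hy, hwa.symm]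
      · simp [stepIndex, hx]
  lex := by
    simp only [distVector]
    exact List.Lex.cons (List.Lex.rel hlt)

/-- Passing to a new first vertex. -/
theorem isMonoConsStep_center {v a b w x y : V} (hvb : v ≠ b) (hab : a ≠ b) (hwb : w ≠ b)
    (hxy : [x, y].Perm [v, a])
    (hlt : vdist C {w} S < vdist C {v} S)
    (hva : vdist C {v} S ≤ vdist C {a} S) (hle : linkDist C S w x ≤ linkDist C S w y) :
    IsMonoConsStep C S [v, a, b] [w, x, y] where
  conservative := by
    have hwx : ∀ x ∈ [v, a], vdist C {w} S < vdist C {x} S := by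
      simpa using ⟨hlt, hlt.trans_le hva⟩
    refine ⟨⟨b, rfl, sdiff_triple hvb hab hwb ?_⟩, isAdmissible_triple.2
      ⟨(hwx x (hxy.subset (by simp))).le, (hwx y (hxy.subset (by simp))).le, hle⟩, ?_⟩
    · exact (hxy.cons w).trans (List.perm_append_comm (l₁ := [w]) (l₂ := [v, a]))
    · intro M' hM' hadm
      obtain ⟨x', y', z', rfl⟩ := exists_eq_triple_of_perm hM'
      -- An admissible order cannot start with `v`, because `w` is strictly closer; hence every
      -- admissible reordering has index `0`.
      have hvx : v ≠ x' := by
        rintro rfl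
        have hw : w ∈ [v, y', z'] := hM'.symm.subset (by simp)
        obtain ⟨h1, h2, -⟩ := isAdmissible_triple.1 hadm
        simp only [List.mem_cons, List.not_mem_nil, or_false] at hw
        rcases hw with rfl | rfl | rfl
        exacts [lt_irrefl _ hlt, hlt.not_ge h1, hlt.not_ge h2]
      simp [stepIndex, hvx]
  lex := by
    simp only [distVector]
    exact List.Lex.rel hlt

/-- Exchanging the last vertex. -/
theorem isMonoConsStep_last {v a b w : V} (hvb : v ≠ b) (hab : a ≠ b) (hwb : w ≠ b)
    (hvw : vdist C {v} S ≤ vdist C {w} S)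
    (hva : vdist C {v} S ≤ vdist C {a} S) (hle : linkDist C S v a ≤ linkDist C S v w)
    (hlt : linkDist (link C v) (nextTarget C S v) a w < linkDist (link C v) (nextTarget C S v) a b) :
    IsMonoConsStep C S [v, a, b] [v, a, w] where
  conservative := by
    refine ⟨⟨b, rfl, sdiff_triple hvb hab hwb (List.Perm.refl _)⟩,
      isAdmissible_triple.2 ⟨hva, hvw, hle⟩, ?_⟩
    intro M' hM' hadm
    obtain ⟨x, y, z, rfl⟩ := exists_eq_triple_of_perm hM'
    by_cases hx : v = x
    · by_cases hy : a = y
      · subst hx hy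
        have hz : z = w := by
          have := (List.perm_cons _).1 ((List.perm_cons _).1 hM')
          simpa using this
        subst hz
        exact le_rfl
      · simp [stepIndex, hx, hy]
    · simp [stepIndex, hx]
  lex := by
    simp only [distVector]
    exact List.Lex.cons (List.Lex.cons (List.Lex.rel hlt))

theorem linkDist_eq_zero_iff {v a : V} : linkDist C S v a = 0 ↔ a ∈ nextTarget C S v :=
  vdist_singleton_eq_zero_iff

theorem one_le_linkDist_iff {v a : V} : 1 ≤ linkDist C S v a ↔ a ∉ nextTarget C S v :=
  one_le_vdist_singleton_iff

variable {T : Finset (Finset V)}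

theorem isOrderedFacet_triple (hT : ∀ t ∈ T, t.card = 3) {a b c : V} (h : {a, b, c} ∈ T) :
    IsOrderedFacet (ofTriangles T) [a, b, c] := by
  have hc := hT _ h
  obtain ⟨hab, hac, hbc⟩ : a ≠ b ∧ a ≠ c ∧ b ≠ c := by
    refine ⟨?_, ?_, ?_⟩ <;> rintro rfl
    · have := Finset.card_le_two (a := a) (b := c); simp at hc this; omega
    · have := Finset.card_le_two (a := b) (b := a); simp at hc this; omega
    · have := Finset.card_le_two (a := a) (b := b); simp at hc this; omega
  refine ⟨by simp [hab, hac, hbc], (isFacet_ofTriangles hT).2 ?_⟩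
  simpa using h

theorem dualGraph_adj_ofTriangles (hT : ∀ t ∈ T, t.card = 3) {s t : Finset V} :
    (dualGraph (ofTriangles T)).Adj s t ↔ s ∈ T ∧ t ∈ T ∧ (s \ t).card = 1 := by
  simp only [dualGraph, isFacet_ofTriangles hT]
  refine ⟨fun h => ⟨h.1, h.2.1, h.2.2.1⟩, fun h => ⟨h.1, h.2.1, h.2.2, ?_⟩⟩
  have h1 := Finset.card_sdiff_add_card_inter s t
  have h2 := Finset.card_sdiff_add_card_inter t s
  rw [Finset.inter_comm] at h2
  rw [hT s h.1] at h1
  rw [hT t h.2.1] at h2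
  omega

/-- A sequence of monotone conservative steps through distinct facets is a monotone conservative
path. -/
theorem isMonotoneConservativePath_of_steps (hT : ∀ t ∈ T, t.card = 3) {N : ℕ}
    {Γ : Fin (N + 1) → List V} {F G : Finset V}
    (hF : (Γ 0).toFinset = F) (hG : (Γ (Fin.last N)).toFinset = G)
    (hord : ∀ i, IsOrderedFacet (ofTriangles T) (Γ i))
    (hadm : IsAdmissible (ofTriangles T) S (Γ 0))
    (hstep : ∀ i : Fin N, IsMonoConsStep (ofTriangles T) S (Γ i.castSucc) (Γ i.succ))
    (hinj : Function.Injective fun i => (Γ i).toFinset) :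
    IsMonotoneConservativePath (ofTriangles T) S F G N Γ where
  path := by
    refine ⟨hord, fun i => ?_, hinj⟩
    rw [dualGraph_adj_ofTriangles hT]
    refine ⟨(isFacet_ofTriangles hT).1 (hord _).2, (isFacet_ofTriangles hT).1 (hord _).2, ?_⟩
    obtain ⟨v, -, hv⟩ := (hstep i).conservative.1
    rw [hv, Finset.card_singleton]
  start := hF
  finish := hG
  monotone := fun i => (hstep i).lex
  conservative := ⟨hadm, fun i => (hstep i).conservative⟩

end Steps

/-! ### Simplicial cones covering an open convex set -/

section Fan

variable {V E : Type*} [Fintype V] [DecidableEq V] [NormedAddCommGroup E] [NormedSpace ℝ E]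
  [FiniteDimensional ℝ E]

/-- The convex cone generated by the points `p v`, `v ∈ t`. -/
def conicHull (p : V → E) (t : Finset V) : Set E :=
  {z | ∃ c : V → ℝ, (∀ v ∈ t, 0 ≤ c v) ∧ z = ∑ v ∈ t, c v • p v}

theorem exists_coordinates (hE : Module.finrank ℝ E = 3) {p : V → E} {t : Finset V}
    (ht : t.card = 3) (hli : LinearIndependent ℝ fun v : t => p v) :
    ∃ φ : V → E →L[ℝ] ℝ, (∀ z, ∑ v ∈ t, φ v z • p v = z) ∧
      ∀ (c : V → ℝ), ∀ u ∈ t, φ u (∑ v ∈ t, c v • p v) = c u := by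
  classical
  have hcard : Fintype.card t = Module.finrank ℝ E := by rw [hE, Fintype.card_coe, ht]
  have : Nonempty t := by
    rw [← Fintype.card_pos_iff, hcard, hE]; norm_num
  let b := basisOfLinearIndependentOfCardEqFinrank hli hcard
  have hb : ∀ v : t, b v = p v := fun v => by simp [b]
  refine ⟨fun v => if h : v ∈ t then LinearMap.toContinuousLinearMap (b.coord ⟨v, h⟩) else 0,
    fun z => ?_, fun c u hu => ?_⟩
  · conv_rhs => rw [← b.sum_repr z]
    rw [← Finset.sum_coe_sort t]
    refine Finset.sum_congr rfl fun v _ => ?_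
    simp [hb]
  · have : ∑ v ∈ t, c v • p v = ∑ v : t, c v • b v := by
      rw [← Finset.sum_coe_sort t]
      simp [hb]
    rw [this]
    simp [hu, Finsupp.single_apply]

theorem mem_conicHull_iff {p : V → E} {t : Finset V} {φ : V → E →L[ℝ] ℝ}
    (h1 : ∀ z, ∑ v ∈ t, φ v z • p v = z)
    (h2 : ∀ (c : V → ℝ), ∀ u ∈ t, φ u (∑ v ∈ t, c v • p v) = c u) {z : E} :
    z ∈ conicHull p t ↔ ∀ v ∈ t, 0 ≤ φ v z := by
  constructor
  · rintro ⟨c, hc, rfl⟩ v hv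
    rw [h2 c v hv]
    exact hc v hv
  · intro h
    exact ⟨fun v => φ v z, h, (h1 z).symm⟩

theorem isClosed_conicHull (hE : Module.finrank ℝ E = 3) {p : V → E} {t : Finset V}
    (ht : t.card = 3) (hli : LinearIndependent ℝ fun v : t => p v) :
    IsClosed (conicHull p t) := by
  obtain ⟨φ, h1, h2⟩ := exists_coordinates hE ht hli
  have : conicHull p t = ⋂ v ∈ t, {z | 0 ≤ φ v z} := by
    ext z
    simp [mem_conicHull_iff h1 h2]
  rw [this]
  exact isClosed_biInter fun v _ => isClosed_le continuous_const (φ v).continuous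

theorem dense_compl_span_pair (hE : Module.finrank ℝ E = 3) (x y : E) :
    Dense ((Submodule.span ℝ {x, y} : Submodule ℝ E) : Set E)ᶜ := by
  rw [← interior_eq_empty_iff_dense_compl, ← Set.not_nonempty_iff_eq_empty]
  intro h
  have htop := Submodule.eq_top_of_nonempty_interior' _ h
  classical
  have h2 : Module.finrank ℝ (Submodule.span ℝ {x, y} : Submodule ℝ E) ≤ 2 := by
    have h3 := finrank_span_finset_le_card (R := ℝ) ({x, y} : Finset E)
    rw [Set.finrank, Finset.coe_pair] at h3
    exact h3.trans Finset.card_le_two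
  rw [htop, finrank_top, hE] at h2
  omega

/-- In a three-dimensional space, a family of simplicial cones covers an open convex set if it
contains an interior point of one of them and every codimension one face of a cone that meets
the set also bounds a cone on its other side. -/
theorem exists_mem_conicHull (hE : Module.finrank ℝ E = 3) {T : Finset (Finset V)} {p : V → E}
    {W : Set E} (hWo : IsOpen W) (hWc : Convex ℝ W) (hcard : ∀ t ∈ T, t.card = 3)
    (hli : ∀ t ∈ T, LinearIndependent ℝ fun v : t => p v)
    (hW : ∃ t ∈ T, ∑ v ∈ t, p v ∈ W)
    (hedge : ∀ t ∈ T, ∀ v ∈ t, (∀ z ∈ W, z ∉ conicHull p (t.erase v)) ∨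
      ∃ d ∉ t, insert d (t.erase v) ∈ T ∧
        ∃ a : V → ℝ, a v < 0 ∧ p d = ∑ u ∈ t, a u • p u)
    {z : E} (hz : z ∈ W) : ∃ t ∈ T, z ∈ conicHull p t := by
  classical
  let U : Set E := ⋃ t ∈ T, conicHull p t
  have hU : IsClosed U :=
    T.finite_toSet.isClosed_biUnion fun t ht => isClosed_conicHull hE (hcard t ht) (hli t ht)
  have hmemU : ∀ {q}, q ∈ U ↔ ∃ t ∈ T, q ∈ conicHull p t := by
    intro q; simp [U]
  -- A generic starting point inside one cone: off the spans of `z` with each `p v`, so that the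
  -- segment from `w` to `z` meets no line through the origin and some `p v` before its endpoint.
  obtain ⟨w, hwW, hwU, hwz⟩ : ∃ w ∈ W, w ∈ U ∧ ∀ v, w ∉ Submodule.span ℝ {z, p v} := by
    obtain ⟨t, ht, hsum⟩ := hW
    obtain ⟨φ, h1, h2⟩ := exists_coordinates hE (hcard t ht) (hli t ht)
    have hO : IsOpen (W ∩ ⋂ v ∈ t, {q | 0 < φ v q}) :=
      hWo.inter (isOpen_biInter_finset fun v _ => isOpen_lt continuous_const (φ v).continuous)
    have hd : Dense (⋂ v : V, ((Submodule.span ℝ {z, p v} : Submodule ℝ E) : Set E)ᶜ) :=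
      dense_iInter_of_isOpen (fun v => (Submodule.closed_of_finiteDimensional _).isOpen_compl)
        fun v => dense_compl_span_pair hE z (p v)
    obtain ⟨w, hw1, hw2⟩ := hd.inter_open_nonempty _ hO ⟨∑ v ∈ t, p v, hsum, by
      simp only [Set.mem_iInter, Set.mem_ofPred_eq]
      intro v hv
      have := h2 (fun _ => 1) v hv
      simp only [one_smul] at this
      rw [this]; exact one_pos⟩
    refine ⟨w, hw1.1, hmemU.2 ⟨t, ht, (mem_conicHull_iff h1 h2).2 fun v hv => ?_⟩, ?_⟩
    · have := hw1.2
      simp only [Set.mem_iInter, Set.mem_ofPred_eq] at this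
      exact (this v hv).le
    · simpa using hw2
  let γ : ℝ → E := fun s => AffineMap.lineMap w z s
  have hγ : Continuous γ := AffineMap.lineMap_continuous
  -- Off the rays, a covered point is interior to a cone or to a wall, since at most one of its
  -- three coordinates vanishes.
  have hlocal : ∀ e ∈ W, e ∈ U → (∀ v, ∀ r : ℝ, e ≠ r • p v) → ∀ᶠ q in nhds e, q ∈ U := by
    intro e heW heU hray
    obtain ⟨t, ht, het⟩ := hmemU.1 heU
    obtain ⟨φ, h1, h2⟩ := exists_coordinates hE (hcard t ht) (hli t ht)
    have hpos := (mem_conicHull_iff h1 h2).1 het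
    have hev : ∀ (ψ : V → E → ℝ), (∀ v, Continuous (ψ v)) → ∀ t' : Finset V,
        (∀ v ∈ t', 0 < ψ v e) → ∀ᶠ q in nhds e, ∀ v ∈ t', 0 < ψ v q := fun ψ hψ t' h =>
      (Finset.eventually_all t').2 fun v hv =>
        (hψ v).continuousAt.eventually (lt_mem_nhds (h v hv))
    by_cases hall : ∀ v ∈ t, 0 < φ v e
    · filter_upwards [hev (fun v => φ v) (fun v => (φ v).continuous) t hall] with q hq
      exact hmemU.2 ⟨t, ht, (mem_conicHull_iff h1 h2).2 fun v hv => (hq v hv).le⟩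
    · push Not at hall
      obtain ⟨v, hv, hv0⟩ := hall
      have hv0 : φ v e = 0 := le_antisymm hv0 (hpos v hv)
      have hother : ∀ u ∈ t.erase v, 0 < φ u e := by
        intro u hu
        refine lt_of_le_of_ne (hpos u (Finset.mem_of_mem_erase hu)) fun hu0 => ?_
        obtain ⟨r, hr⟩ : ∃ r, (t.erase v).erase u = {r} := by
          rw [← Finset.card_eq_one, Finset.card_erase_of_mem hu, Finset.card_erase_of_mem hv,
            hcard t ht]
        apply hray r (φ r e)
        conv_lhs => rw [← h1 e]
        rw [← Finset.add_sum_erase t _ hv, ← Finset.add_sum_erase _ _ hu, hr, hv0, ← hu0]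
        simp
      rcases hedge t ht v hv with hout | ⟨d, hd, ht', a, hav, had⟩
      · refine absurd ⟨fun u => φ u e, fun u hu => (hother u hu).le, ?_⟩ (hout e heW)
        conv_lhs => rw [← h1 e]
        rw [← Finset.add_sum_erase t _ hv, hv0, zero_smul, zero_add]
      -- Beyond the wall, where `φ v q < 0`, the vertex `p v` is eliminated through `p d = ∑ a u • p
      -- u`. The coefficient of `p d` becomes `φ v q / a v`, positive as both signs are negative.
      -- The others become `φ u q - φ v q * (a u / a v)`, which stay positive near `e` because `φ v
      -- e = 0`.
      · filter_upwards [hev (fun u => φ u) (fun u => (φ u).continuous) (t.erase v) hother,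
          hev (fun u q => φ u q - φ v q * (a u / a v)) (fun u => by fun_prop) (t.erase v)
          (fun u hu => by simpa [hv0] using hother u hu)] with q hq1 hq2
        rcases le_or_gt 0 (φ v q) with hq | hq
        · refine hmemU.2 ⟨t, ht, (mem_conicHull_iff h1 h2).2 fun u hu => ?_⟩
          by_cases huv : u = v
          · exact huv ▸ hq
          · exact (hq1 u (Finset.mem_erase.2 ⟨huv, hu⟩)).le
        · have hdv : d ∉ t.erase v := fun h => hd (Finset.mem_of_mem_erase h)
          refine hmemU.2 ⟨_, ht', fun u => if u = d then φ v q / a v else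
            φ u q - φ v q * (a u / a v), ?_, ?_⟩
          · intro u hu
            by_cases hud : u = d
            · simpa [hud] using (div_pos_of_neg_of_neg hq hav).le
            · simp only [hud, if_false]
              exact (hq2 u (by simpa [hud] using hu)).le
          · rw [Finset.sum_insert hdv]
            beta_reduce
            rw [if_pos rfl, had, Finset.smul_sum]
            have : ∀ u ∈ t.erase v, (if u = d then φ v q / a v else
                φ u q - φ v q * (a u / a v)) • p u = φ u q • p u - (φ v q / a v) • a u • p u := by
              intro u hu
              rw [if_neg (show u ≠ d from fun h => hdv (h ▸ hu)), sub_smul, smul_smul]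
              congr 2
              ring
            rw [Finset.sum_congr rfl this, Finset.sum_sub_distrib,
              ← Finset.add_sum_erase t (fun u => (φ v q / a v) • a u • p u) hv, smul_smul,
              div_mul_cancel₀ _ hav.ne]
            conv_lhs => rw [← h1 q, ← Finset.add_sum_erase t _ hv]
            abel
  -- Continuous induction along the segment: the covered parameters form a closed set, contain `0`,
  -- and can always be extended to the right before `1`.
  have hmain : Set.Icc (0 : ℝ) 1 ⊆ γ ⁻¹' U := by
    refine IsClosed.Icc_subset_of_forall_exists_gt ((hU.preimage hγ).inter isClosed_Icc) ?_ ?_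
    · simpa [γ] using hwU
    · rintro s ⟨hsU, hs0, hs1⟩ y hy
      have hsW : γ s ∈ W := hWc.segment_subset hwW hz (by
        rw [segment_eq_image_lineMap]
        exact ⟨s, ⟨hs0, hs1.le⟩, rfl⟩)
      have hray : ∀ v, ∀ r : ℝ, γ s ≠ r • p v := by
        intro v r h
        apply hwz v
        have h3 : (1 - s) • w = r • p v - s • z := by
          rw [← h]; simp [γ, AffineMap.lineMap_apply_module]
        have h4 : w = (1 - s)⁻¹ • (r • p v - s • z) := by
          rw [← h3, smul_smul, inv_mul_cancel₀ (by linarith), one_smul]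
        rw [h4]
        refine Submodule.smul_mem _ _ (Submodule.sub_mem _ ?_ ?_) <;>
          exact Submodule.smul_mem _ _ (Submodule.subset_span (by simp))
      have hev : ∀ᶠ s' in nhds s, γ s' ∈ U :=
        hγ.continuousAt.eventually (hlocal _ hsW hsU hray)
      obtain ⟨s', h1, h2⟩ := ((hev.filter_mono nhdsWithin_le_nhds).and (Ioc_mem_nhdsGT hy)).exists
      exact ⟨s', h1, h2⟩
  have := hmain (Set.right_mem_Icc.2 zero_le_one)
  exact hmemU.1 (by simpa [γ] using this)

end Fan

/-! ### From supporting functionals to the boundary complex of a polytope -/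

section Certificate

variable {V E : Type*} [Fintype V] [DecidableEq V] [NormedAddCommGroup E] [NormedSpace ℝ E]

/-- The points `p v` are the vertices of a polytope containing the origin in its interior, whose
facets have the vertex sets `t ∈ T`; this is witnessed by supporting hyperplanes. -/
structure IsPolytopeCertificate (T : Finset (Finset V)) (p : V → E) : Prop where
  nonempty : T.Nonempty
  card_eq : ∀ t ∈ T, t.card = 3
  supporting : ∀ t ∈ T, ∃ (ℓ : E →L[ℝ] ℝ) (κ : ℝ), 0 < κ ∧
    ∀ v, (v ∈ t → ℓ (p v) = κ) ∧ (v ∉ t → ℓ (p v) < κ)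
  edge : ∀ t ∈ T, ∀ v ∈ t, ∃ s ∈ T, v ∉ s ∧ t.erase v ⊆ s
  covers : ∀ v, ∃ t ∈ T, v ∈ t

namespace IsPolytopeCertificate

variable {T : Finset (Finset V)} {p : V → E}

theorem exists_functionals (h : IsPolytopeCertificate T p) :
    ∃ (ℓ : Finset V → E →L[ℝ] ℝ) (κ : Finset V → ℝ), (∀ t ∈ T, 0 < κ t) ∧
      (∀ t ∈ T, ∀ v ∈ t, ℓ t (p v) = κ t) ∧ (∀ t ∈ T, ∀ v ∉ t, ℓ t (p v) < κ t) := by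
  have := h.supporting
  choose! ℓ κ hκ hv using this
  exact ⟨ℓ, κ, hκ, fun t ht v => (hv t ht v).1, fun t ht v => (hv t ht v).2⟩

theorem exists_insert (h : IsPolytopeCertificate T p) {t : Finset V} (ht : t ∈ T) {v : V}
    (hv : v ∈ t) : ∃ d ∉ t, insert d (t.erase v) ∈ T := by
  obtain ⟨s, hs, hvs, hts⟩ := h.edge t ht v hv
  have hc : (t.erase v).card = 2 := by rw [Finset.card_erase_of_mem hv, h.card_eq t ht]
  have h1 : (s \ t.erase v).card = 1 := by
    rw [Finset.card_sdiff_of_subset hts, h.card_eq s hs, hc]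
  obtain ⟨d, hd⟩ := Finset.card_eq_one.1 h1
  have hds : d ∈ s \ t.erase v := by simp [hd]
  rw [Finset.mem_sdiff] at hds
  have hs' : insert d (t.erase v) = s := by
    rw [Finset.insert_eq, ← hd, Finset.sdiff_union_of_subset hts]
  refine ⟨d, fun hdt => hds.2 (Finset.mem_erase.2 ⟨?_, hdt⟩), hs' ▸ hs⟩
  rintro rfl
  exact hvs hds.1

/-- A face is the intersection of the facets containing it: a vertex of `t` outside `f` is avoided
by crossing the edge of `t` opposite to it. -/
theorem mem_of_forall (h : IsPolytopeCertificate T p) {t f : Finset V} (ht : t ∈ T) (hf : f ⊆ t)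
    {u : V} (hu : ∀ s ∈ T, f ⊆ s → u ∈ s) : u ∈ f := by
  by_contra huf
  obtain ⟨s, hs, hus, hts⟩ := h.edge t ht u (hu t ht hf)
  exact hus (hu s hs fun x hx => hts (Finset.mem_erase.2 ⟨fun hxu => huf (hxu ▸ hx), hf hx⟩))

end IsPolytopeCertificate

/-- In a linear relation the functional of `h0` forces the coefficients to sum to zero. The
functional of `h1`, which takes another value only at `v`, then kills the coefficient of `v`. -/
theorem linearIndependent_of_functionals {p : V → E} {t : Finset V}
    (h0 : ∃ (ℓ : E →L[ℝ] ℝ) (κ : ℝ), κ ≠ 0 ∧ ∀ u ∈ t, ℓ (p u) = κ)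
    (h1 : ∀ v ∈ t, ∃ (ℓ : E →L[ℝ] ℝ) (κ : ℝ), (∀ u ∈ t.erase v, ℓ (p u) = κ) ∧ ℓ (p v) ≠ κ) :
    LinearIndependent ℝ fun v : t => p v := by
  rw [Fintype.linearIndependent_iff]
  intro g hg
  let c : V → ℝ := fun v => if hv : v ∈ t then g ⟨v, hv⟩ else 0
  have hsum : ∑ v ∈ t, c v • p v = 0 := by
    rw [← Finset.sum_coe_sort t, ← hg]
    exact Finset.sum_congr rfl fun v _ => by simp [c]
  have hc0 : ∑ v ∈ t, c v = 0 := by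
    obtain ⟨ℓ, κ, hκ, hℓ⟩ := h0
    have := congrArg ℓ hsum
    rw [map_sum, map_zero, Finset.sum_congr rfl fun v hv => by rw [map_smul, hℓ v hv, smul_eq_mul],
      ← Finset.sum_mul] at this
    exact (mul_eq_zero.1 this).resolve_right hκ
  rintro ⟨v, hv⟩
  obtain ⟨ℓ, κ, hℓ, hne⟩ := h1 v hv
  have := congrArg ℓ hsum
  rw [map_sum, map_zero, ← Finset.add_sum_erase t _ hv,
    Finset.sum_congr rfl fun u hu => by rw [map_smul, hℓ u hu, smul_eq_mul], ← Finset.sum_mul,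
    map_smul, smul_eq_mul] at this
  rw [← Finset.add_sum_erase t _ hv] at hc0
  have h2 : c v * (ℓ (p v) - κ) = 0 := by linear_combination this - κ * hc0
  have h3 := (mul_eq_zero.1 h2).resolve_right (sub_ne_zero.2 hne)
  simpa [c, hv] using h3

/-- If two facets share the edge `t.erase v`, the new vertex of the second one lies on the other
side of the cone over that edge. -/
theorem coefficient_neg_of_adjacent {p : V → E} {t : Finset V} {v d : V} (hv : v ∈ t)
    {ℓ ℓ' : E →L[ℝ] ℝ} {κ κ' : ℝ} (hκ : 0 < κ) (h1 : ∀ u ∈ t, ℓ (p u) = κ)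
    (h2 : ℓ (p d) < κ) (hκ' : 0 < κ') (h3 : ∀ u ∈ t.erase v, ℓ' (p u) = κ') (h4 : ℓ' (p d) = κ')
    (h5 : ℓ' (p v) < κ') {a : V → ℝ} (ha : p d = ∑ u ∈ t, a u • p u) : a v < 0 := by
  have e1 : ℓ (p d) = (∑ u ∈ t, a u) * κ := by
    rw [ha, map_sum, Finset.sum_mul]
    exact Finset.sum_congr rfl fun u hu => by rw [map_smul, h1 u hu, smul_eq_mul]
  have e2 : ℓ' (p d) = a v * ℓ' (p v) + (∑ u ∈ t.erase v, a u) * κ' := by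
    rw [ha, map_sum, ← Finset.add_sum_erase t _ hv, map_smul, smul_eq_mul, Finset.sum_mul]
    congr 1
    exact Finset.sum_congr rfl fun u hu => by rw [map_smul, h3 u hu, smul_eq_mul]
  rw [h4] at e2
  rw [← Finset.add_sum_erase t _ hv] at e1
  set A := ∑ u ∈ t.erase v, a u
  -- By `ℓ`, the coefficients sum to less than `1`. If `a v` were nonnegative, then `ℓ' (p d)` would
  -- be at most that sum times `κ'`, hence less than `κ'`.
  have hA : a v + A < 1 := by
    by_contra hA
    nlinarith
  by_contra hav
  push Not at hav
  nlinarith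

variable [FiniteDimensional ℝ E] {T : Finset (Finset V)} {p : V → E}

namespace IsPolytopeCertificate

theorem linearIndependent (h : IsPolytopeCertificate T p) {t : Finset V} (ht : t ∈ T) :
    LinearIndependent ℝ fun v : t => p v := by
  obtain ⟨ℓ, κ, hκ, hin, hout⟩ := h.exists_functionals
  refine linearIndependent_of_functionals ⟨ℓ t, κ t, (hκ t ht).ne', hin t ht⟩ fun v hv => ?_
  obtain ⟨s, hs, hvs, hts⟩ := h.edge t ht v hv
  exact ⟨ℓ s, κ s, fun u hu => hin s hs u (hts hu), (hout s hs v hvs).ne⟩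

/-- The face fan is complete: every edge lies in a second triangle, and the supporting functionals
put the two cones on opposite sides of their wall. -/
theorem exists_mem_conicHull (h : IsPolytopeCertificate T p) (hE : Module.finrank ℝ E = 3)
    (z : E) : ∃ t ∈ T, z ∈ conicHull p t := by
  obtain ⟨ℓ, κ, hκ, hin, hout⟩ := h.exists_functionals
  refine MonoCons.exists_mem_conicHull hE isOpen_univ convex_univ h.card_eq
    (fun t ht => h.linearIndependent ht) ?_ ?_ (Set.mem_univ z)
  · obtain ⟨t, ht⟩ := h.nonempty
    exact ⟨t, ht, Set.mem_univ _⟩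
  · intro t ht v hv
    right
    obtain ⟨d, hd, hs⟩ := h.exists_insert ht hv
    obtain ⟨φ, h1, -⟩ := exists_coordinates hE (h.card_eq t ht) (h.linearIndependent ht)
    have hvs : v ∉ insert d (t.erase v) := by
      simp only [Finset.mem_insert, Finset.mem_erase, not_or]
      exact ⟨fun hvd => hd (hvd ▸ hv), fun hh => hh.1 rfl⟩
    exact ⟨d, hd, hs, fun u => φ u (p d), coefficient_neg_of_adjacent hv (hκ t ht) (hin t ht)
      (hout t ht d hd) (hκ _ hs) (fun u hu => hin _ hs u (Finset.mem_insert_of_mem hu))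
      (hin _ hs d (Finset.mem_insert_self _ _)) (hout _ hs v hvs) (h1 _).symm, (h1 _).symm⟩

/-- Completeness of the fan writes `-p v` as a conic combination of vertices; adding `p v` and
normalizing gives the origin. -/
theorem zero_mem (h : IsPolytopeCertificate T p) (hE : Module.finrank ℝ E = 3) :
    (0 : E) ∈ convexHull ℝ (Set.range p) := by
  obtain ⟨t, ht⟩ := h.nonempty
  obtain ⟨v, -⟩ : t.Nonempty := Finset.card_pos.1 (by rw [h.card_eq t ht]; norm_num)
  obtain ⟨s, hs, c, hc, hsum⟩ := h.exists_mem_conicHull hE (-p v)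
  have hmem : ∀ u, p u ∈ convexHull ℝ (Set.range p) := fun u => subset_convexHull ℝ _ ⟨u, rfl⟩
  have hS : 0 ≤ ∑ u ∈ s, c u := Finset.sum_nonneg hc
  have hconv := convex_convexHull ℝ (Set.range p)
  rcases hS.eq_or_lt with h0 | hpos
  · have : p v = 0 := by
      rw [← neg_eq_zero, hsum]
      refine Finset.sum_eq_zero fun u hu => ?_
      rw [(Finset.sum_eq_zero_iff_of_nonneg hc).1 h0.symm u hu, zero_smul]
    exact this ▸ hmem v
  · have hy := hconv.centerMass_mem hc hpos fun u _ => hmem u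
    have hz : (0 : E) = ((∑ u ∈ s, c u) / (1 + ∑ u ∈ s, c u)) • s.centerMass c p +
        (1 / (1 + ∑ u ∈ s, c u)) • p v := by
      rw [Finset.centerMass, smul_smul, ← hsum, div_mul_eq_mul_div, mul_inv_cancel₀ hpos.ne']
      simp
    rw [hz]
    exact hconv hy (hmem v) (by positivity) (by positivity) (by field_simp; ring)

/-- For `z` near `0` each `ℓ t z` is below `κ t`, so the conic coefficients of `z` sum to less than
`1` and `z` is a contraction of a point of the hull towards the origin. -/
theorem convexHull_mem_nhds_zero (h : IsPolytopeCertificate T p) (hE : Module.finrank ℝ E = 3) :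
    convexHull ℝ (Set.range p) ∈ nhds (0 : E) := by
  obtain ⟨ℓ, κ, hκ, hin, hout⟩ := h.exists_functionals
  have hconv := convex_convexHull ℝ (Set.range p)
  have hev : ∀ᶠ z in nhds (0 : E), ∀ t ∈ T, ℓ t z < κ t :=
    (Finset.eventually_all T).2 fun t ht =>
      (ℓ t).continuous.continuousAt.eventually (gt_mem_nhds (by simpa using hκ t ht))
  filter_upwards [hev] with z hz
  obtain ⟨t, ht, c, hc, hsum⟩ := h.exists_mem_conicHull hE z
  have hval : ℓ t z = (∑ u ∈ t, c u) * κ t := by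
    rw [hsum, map_sum, Finset.sum_mul]
    exact Finset.sum_congr rfl fun u hu => by rw [map_smul, hin t ht u hu, smul_eq_mul]
  have hlt : ∑ u ∈ t, c u < 1 := by
    have := hz t ht
    rw [hval] at this
    by_contra hge
    nlinarith [hκ t ht]
  rcases (Finset.sum_nonneg hc).eq_or_lt with h0 | hpos
  · rw [hsum, Finset.sum_eq_zero fun u hu => by
      rw [(Finset.sum_eq_zero_iff_of_nonneg hc).1 h0.symm u hu, zero_smul]]
    exact h.zero_mem hE
  · have hy := hconv.centerMass_mem hc hpos fun u _ =>
      subset_convexHull ℝ (Set.range p) ⟨u, rfl⟩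
    have := hconv.smul_mem_of_zero_mem (h.zero_mem hE) hy ⟨hpos.le, hlt.le⟩
    rwa [Finset.centerMass, smul_smul, mul_inv_cancel₀ hpos.ne', one_smul, ← hsum] at this

/-- The vertices in a proper exposed face all belong to one facet. -/
theorem exists_facet_of_isExposed (h : IsPolytopeCertificate T p) (hE : Module.finrank ℝ E = 3)
    {B : Set E} (hB : IsExposed ℝ (convexHull ℝ (Set.range p)) B)
    (hne : B ≠ convexHull ℝ (Set.range p)) : ∃ t ∈ T, ∀ v, p v ∈ B → v ∈ t := by
  classical
  obtain ⟨ℓ, κ, hκ, hin, hout⟩ := h.exists_functionals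
  by_cases hB0 : ∃ v, p v ∈ B
  swap
  · push Not at hB0
    obtain ⟨t, ht⟩ := h.nonempty
    exact ⟨t, ht, fun v hv => absurd hv (hB0 v)⟩
  obtain ⟨v₀, hv₀⟩ := hB0
  obtain ⟨φ, hφ⟩ := hB ⟨_, hv₀⟩
  have hmem : ∀ u, p u ∈ convexHull ℝ (Set.range p) := fun u => subset_convexHull ℝ _ ⟨u, rfl⟩
  have hmax : ∀ y ∈ convexHull ℝ (Set.range p), φ y ≤ φ (p v₀) := by
    rw [hφ] at hv₀; exact hv₀.2
  have hval : ∀ v, p v ∈ B → φ (p v) = φ (p v₀) := by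
    intro v hv
    rw [hφ] at hv
    exact le_antisymm (hmax _ (hmem v)) (hv.2 _ (hmem v₀))
  -- If the maximum were `0`, then `φ` would have a local maximum at the interior point `0`, hence
  -- vanish, and the face would be the whole polytope.
  have hm : 0 < φ (p v₀) := by
    refine lt_of_le_of_ne (by simpa using hmax 0 (h.zero_mem hE)) fun h0 => hne ?_
    have hφ0 : φ = 0 := by
      have hloc : IsLocalMax φ 0 := by
        filter_upwards [h.convexHull_mem_nhds_zero hE] with y hy
        simpa [← h0] using hmax y hy
      exact hloc.hasFDerivAt_eq_zero φ.hasFDerivAt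
    rw [hφ, hφ0]
    simp
  let f := Finset.univ.filter fun v => p v ∈ B
  have hf : ∀ {v}, v ∈ f ↔ p v ∈ B := by simp [f]
  -- The sum of the vertices in the face lies in the cone over some `t`. Comparing values of `φ`
  -- gives `∑ c ≥ f.card`, while a vertex of the face outside `t` would make `ℓ t` give `∑ c <
  -- f.card`.
  obtain ⟨t, ht, c, hc, hsum⟩ := h.exists_mem_conicHull hE (∑ v ∈ f, p v)
  refine ⟨t, ht, fun v hv => ?_⟩
  by_contra hvt
  have e1 : (f.card : ℝ) * φ (p v₀) ≤ (∑ u ∈ t, c u) * φ (p v₀) := by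
    have := congrArg φ hsum
    rw [map_sum, map_sum, Finset.sum_congr rfl fun v hv => hval v (hf.1 hv), Finset.sum_const,
      nsmul_eq_mul] at this
    rw [this, Finset.sum_mul]
    refine Finset.sum_le_sum fun u hu => ?_
    rw [map_smul, smul_eq_mul]
    exact mul_le_mul_of_nonneg_left (hmax _ (hmem u)) (hc u hu)
  have e2 : (∑ u ∈ t, c u) * κ t < f.card * κ t := by
    have := congrArg (ℓ t) hsum
    rw [map_sum, map_sum, Finset.sum_congr rfl fun u (hu : u ∈ t) => by
      rw [map_smul, hin t ht u hu, smul_eq_mul], ← Finset.sum_mul] at this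
    rw [← this, ← nsmul_eq_mul, ← Finset.sum_const]
    refine Finset.sum_lt_sum (fun u _ => ?_) ⟨v, hf.2 hv, hout t ht v hvt⟩
    by_cases hu : u ∈ t
    exacts [(hin t ht u hu).le, (hout t ht u hu).le]
  have e3 := le_of_mul_le_mul_right e1 hm
  have e4 := lt_of_mul_lt_mul_right e2 (hκ t ht).le
  exact e4.not_ge e3

/-- Every nonempty set of vertices of a facet is the vertex set of a proper exposed face. -/
theorem exists_isExposed (h : IsPolytopeCertificate T p) {t f : Finset V} (ht : t ∈ T)
    (hf : f ⊆ t) (hfne : f.Nonempty) : ∃ B : Set E, IsExposed ℝ (convexHull ℝ (Set.range p)) B ∧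
      B ≠ convexHull ℝ (Set.range p) ∧ ∀ v, v ∈ f ↔ p v ∈ B := by
  classical
  obtain ⟨ℓ, κ, hκ, hin, hout⟩ := h.exists_functionals
  have hmem : ∀ u, p u ∈ convexHull ℝ (Set.range p) := fun u => subset_convexHull ℝ _ ⟨u, rfl⟩
  -- The sum of the functionals of all facets through `f` is maximal exactly on the vertices common
  -- to these facets, that is, on `f`.
  let φ : E →L[ℝ] ℝ := ∑ s ∈ T.filter (f ⊆ ·), ℓ s
  let M : ℝ := ∑ s ∈ T.filter (f ⊆ ·), κ s
  have hφ : ∀ x, φ x = ∑ s ∈ T.filter (f ⊆ ·), ℓ s x := fun x => by simp [φ]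
  have hle : ∀ s ∈ T, ∀ v, ℓ s (p v) ≤ κ s := fun s hs v => by
    by_cases hv : v ∈ s
    exacts [(hin s hs v hv).le, (hout s hs v hv).le]
  have heq : ∀ v ∈ f, φ (p v) = M := fun v hv => by
    rw [hφ]
    refine Finset.sum_congr rfl fun s hs => ?_
    rw [Finset.mem_filter] at hs
    exact hin s hs.1 v (hs.2 hv)
  have hlt : ∀ v ∉ f, φ (p v) < M := fun v hv => by
    rw [hφ]
    obtain ⟨s, hs, hfs, hvs⟩ : ∃ s ∈ T, f ⊆ s ∧ v ∉ s := by
      by_contra hcon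
      push Not at hcon
      exact hv (h.mem_of_forall ht hf hcon)
    exact Finset.sum_lt_sum (fun s hs => hle s (Finset.mem_filter.1 hs).1 v)
      ⟨s, Finset.mem_filter.2 ⟨hs, hfs⟩, hout s hs v hvs⟩
  have hmax : ∀ y ∈ convexHull ℝ (Set.range p), φ y ≤ M := by
    have : convexHull ℝ (Set.range p) ⊆ {y | φ y ≤ M} := by
      refine convexHull_min ?_ (convex_halfSpace_le φ.toLinearMap.isLinear M)
      rintro _ ⟨v, rfl⟩
      by_cases hv : v ∈ f
      exacts [(heq v hv).le, (hlt v hv).le]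
    exact this
  obtain ⟨v₁, hv₁⟩ := hfne
  refine ⟨{x ∈ convexHull ℝ (Set.range p) | ∀ y ∈ convexHull ℝ (Set.range p), φ y ≤ φ x},
    fun _ => ⟨φ, rfl⟩, fun hBK => ?_, fun v => ⟨fun hv => ⟨hmem v, ?_⟩, fun hv => ?_⟩⟩
  · obtain ⟨d, hd, -⟩ := h.exists_insert ht (hf hv₁)
    have := hBK.symm ▸ hmem d
    exact (hlt d fun hdf => hd (hf hdf)).not_ge (heq v₁ hv₁ ▸ this.2 _ (hmem v₁))
  · rw [heq v hv]
    exact hmax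
  · by_contra hvf
    exact (hlt v hvf).not_ge (heq v₁ hv₁ ▸ hv.2 _ (hmem v₁))

end IsPolytopeCertificate

/-- A family of triangles with a certificate generates the boundary complex of a simplicial
polytope. -/
theorem IsPolytopeCertificate.isSimplicialPolytopeBoundary
    {p : V → EuclideanSpace ℝ (Fin 3)} (h : IsPolytopeCertificate T p) :
    IsSimplicialPolytopeBoundary 3 (ofTriangles T) := by
  classical
  have hE : Module.finrank ℝ (EuclideanSpace ℝ (Fin 3)) = 3 := by simp
  have hinj : Function.Injective p := by
    obtain ⟨ℓ, κ, hκ, hin, hout⟩ := h.exists_functionals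
    intro u v huv
    obtain ⟨t, ht, hut⟩ := h.covers v
    have : u ∈ ({v} : Finset V) := by
      refine h.mem_of_forall ht (by simpa using hut) fun s hs hvs => ?_
      by_contra hus
      have h1 := hout s hs u hus
      rw [huv, hin s hs v (hvs (by simp))] at h1
      exact lt_irrefl _ h1
    simpa using this
  refine ⟨p, hinj, ⟨0, mem_interior_iff_mem_nhds.2 (h.convexHull_mem_nhds_zero hE)⟩, ?_, ?_, ?_⟩
  · refine extremePoints_convexHull_subset.antisymm ?_
    rintro _ ⟨v, rfl⟩
    obtain ⟨t, ht, hvt⟩ := h.covers v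
    obtain ⟨B, hB, -, hvB⟩ := h.exists_isExposed ht (f := {v}) (by simpa using hvt) (by simp)
    -- The exposed face attached to `{v}` is compact, so it has an extreme point. This is extreme in
    -- the polytope, hence one of the points `p u`, and `p v` is the only such point in the face.
    have hcomp := hB.isCompact ((Set.finite_range p).isCompact_convexHull ℝ)
    obtain ⟨x, hx⟩ := hcomp.extremePoints_nonempty ⟨p v, (hvB v).1 (by simp)⟩
    have hx' := hB.isExtreme.extremePoints_subset_extremePoints hx
    obtain ⟨u, rfl⟩ := extremePoints_convexHull_subset hx'
    have := (hvB u).2 hx.1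
    rw [Finset.mem_singleton] at this
    exact this ▸ hx'
  · intro B hB hne
    obtain ⟨t, ht, hBt⟩ := h.exists_facet_of_isExposed hE hB hne
    have hli := h.linearIndependent ht
    have hli' : LinearIndependent ℝ fun v : {v : V // p v ∈ B} => p v :=
      hli.comp (fun v : {v : V // p v ∈ B} => (⟨v, hBt v v.2⟩ : t)) fun a b hab => by
        simpa [Subtype.ext_iff] using hab
    rw [affineIndependent_iff]
    intro s w _ hs
    exact linearIndependent_iff'.1 hli' s w hs
  · intro f
    constructor
    · rintro ⟨hne, t, ht, hft⟩
      exact ⟨hne, h.exists_isExposed ht hft hne⟩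
    · rintro ⟨hne, B, hB, hBK, hf⟩
      obtain ⟨t, ht, hBt⟩ := h.exists_facet_of_isExposed hE hB hBK
      exact ⟨hne, t, ht, fun v hv => hBt v ((hf v).1 hv)⟩

end Certificate

/-! ### Deleting a vertex of the polytope yields a disc -/

section Disc

variable {V E : Type*} [Fintype V] [DecidableEq V] [NormedAddCommGroup E] [NormedSpace ℝ E]
  [FiniteDimensional ℝ E]

theorem isCompact_realization_ofTriangles (T : Finset (Finset V)) :
    IsCompact (realization (ofTriangles T)) := by
  have : realization (ofTriangles T) =
      ⋃ t ∈ T, (stdSimplex ℝ V ∩ ⋂ v ∈ (t : Set V)ᶜ, {x | x v = 0}) := by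
    ext x
    simp only [realization, mem_faces_ofTriangles, Set.mem_ofPred_eq, Set.mem_iUnion,
      Set.mem_inter_iff, Set.mem_iInter, Set.mem_compl_iff, Finset.mem_coe, exists_prop]
    constructor
    · rintro ⟨hx, f, ⟨-, t, ht, hft⟩, hf⟩
      exact ⟨t, ht, hx, fun v hv => by_contra fun hxv => hv (hft (hf v hxv))⟩
    · rintro ⟨t, ht, hx, hxt⟩
      have hxt' : ∀ v, x v ≠ 0 → v ∈ t := fun v hv => by_contra fun hvt => hv (hxt v hvt)
      refine ⟨hx, t, ⟨?_, t, ht, subset_rfl⟩, hxt'⟩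
      obtain ⟨v, -, hv⟩ := Finset.exists_ne_zero_of_sum_ne_zero (hx.2.trans_ne one_ne_zero)
      exact ⟨v, hxt' v hv⟩
  rw [this]
  refine T.finite_toSet.isCompact_biUnion fun t _ => (isCompact_stdSimplex ℝ V).inter_right ?_
  exact isClosed_biInter fun v _ => isClosed_eq (continuous_apply v) continuous_const

theorem mem_realization_ofTriangles {T : Finset (Finset V)} {x : V → ℝ} :
    x ∈ realization (ofTriangles T) ↔ x ∈ stdSimplex ℝ V ∧ ∃ t ∈ T, ∀ v ∉ t, x v = 0 := by
  simp only [realization, mem_faces_ofTriangles, Set.mem_ofPred_eq]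
  refine and_congr_right fun hx => ⟨?_, ?_⟩
  · rintro ⟨f, ⟨-, t, ht, hft⟩, hf⟩
    exact ⟨t, ht, fun v hv => by_contra fun hxv => hv (hft (hf v hxv))⟩
  · rintro ⟨t, ht, hxt⟩
    have hxt' : ∀ v, x v ≠ 0 → v ∈ t := fun v hv => by_contra fun hvt => hv (hxt v hvt)
    obtain ⟨v, -, hv⟩ := Finset.exists_ne_zero_of_sum_ne_zero (hx.2.trans_ne one_ne_zero)
    exact ⟨t, ⟨⟨v, hxt' v hv⟩, t, ht, subset_rfl⟩, hxt'⟩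

/-- A complex whose realization embeds into the plane with convex image having an interior point is
a disc. -/
theorem isSimplicialBall_of_embedding {T : Finset (Finset V)}
    {f : realization (ofTriangles T) → EuclideanSpace ℝ (Fin 2)} (hf : Continuous f)
    (hinj : Function.Injective f) (hconv : Convex ℝ (Set.range f))
    (hint : (interior (Set.range f)).Nonempty) : IsSimplicialBall 2 (ofTriangles T) := by
  have : CompactSpace (realization (ofTriangles T)) :=
    isCompact_iff_compactSpace.1 (isCompact_realization_ofTriangles T)
  have hcomp : IsCompact (Set.range f) := isCompact_range hf
  obtain ⟨h, -, hcl, -⟩ :=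
    exists_homeomorph_image_interior_closure_frontier_eq_unitBall hconv hint hcomp.isBounded
  rw [hcomp.isClosed.closure_eq] at hcl
  exact ⟨(hf.isClosedEmbedding hinj).isEmbedding.toHomeomorph.trans
    ((h.image _).trans (Homeomorph.setCongr hcl))⟩

variable {T : Finset (Finset V)} {p : V → E}

namespace IsPolytopeCertificate

/-- The cone of the polytope at a vertex `v₀` is covered by the cones over the facets which do not
contain `v₀`. -/
theorem exists_mem_conicHull_deletion (h : IsPolytopeCertificate T p)
    (hE : Module.finrank ℝ E = 3) (v₀ : V) {ℓ : Finset V → E →L[ℝ] ℝ} {κ : Finset V → ℝ}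
    (hin : ∀ t ∈ T, ∀ v ∈ t, ℓ t (p v) = κ t)
    (hout : ∀ t ∈ T, ∀ v ∉ t, ℓ t (p v) < κ t) :
    (∃ w, ∀ s ∈ T, v₀ ∈ s → ℓ s w < 0) ∧
    (∀ t ∈ T, v₀ ∉ t → LinearIndependent ℝ fun v : t => p v - p v₀) ∧
    ∀ z, (∀ s ∈ T, v₀ ∈ s → ℓ s z ≤ 0) →
      ∃ t ∈ T, v₀ ∉ t ∧ z ∈ conicHull (fun v => p v - p v₀) t := by
  classical
  set P : V → E := fun v => p v - p v₀ with hP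
  have hli : ∀ t ∈ T, v₀ ∉ t → LinearIndependent ℝ fun v : t => P v := by
    intro t ht hv₀
    refine linearIndependent_of_functionals ⟨ℓ t, κ t - ℓ t (p v₀),
      (sub_pos.2 (hout t ht v₀ hv₀)).ne', fun u hu => by simp [P, hin t ht u hu]⟩ fun v hv => ?_
    obtain ⟨s, hs, hvs, hts⟩ := h.edge t ht v hv
    refine ⟨ℓ s, κ s - ℓ s (p v₀), fun u hu => by simp [P, hin s hs u (hts hu)], ?_⟩
    simpa [P] using (hout s hs v hvs).ne
  have hle : ∀ s ∈ T, v₀ ∈ s → ∀ v, ℓ s (P v) ≤ 0 := by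
    intro s hs hv₀ v
    simp only [P, map_sub, hin s hs v₀ hv₀, sub_nonpos]
    by_cases hv : v ∈ s
    exacts [(hin s hs v hv).le, (hout s hs v hv).le]
  -- The open tangent cone of the polytope at `v₀`, translated to the origin.
  let W : Set E := ⋂ s ∈ T.filter (v₀ ∈ ·), {z | ℓ s z < 0}
  have hW : ∀ {z}, z ∈ W ↔ ∀ s ∈ T, v₀ ∈ s → ℓ s z < 0 := by
    intro z; simp [W]
  obtain ⟨t₀, ht₀, hvt₀⟩ := h.covers v₀
  obtain ⟨t₁, ht₁, hvt₁, -⟩ := h.edge t₀ ht₀ v₀ hvt₀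
  have hw₁ : ∑ v ∈ t₁, P v ∈ W := by
    refine hW.2 fun s hs hv₀ => ?_
    rw [map_sum]
    obtain ⟨v, hv, hvs⟩ : ∃ v ∈ t₁, v ∉ s := by
      by_contra hcon
      push Not at hcon
      exact hvt₁ (Finset.eq_of_subset_of_card_le hcon
        (by rw [h.card_eq s hs, h.card_eq t₁ ht₁]) ▸ hv₀)
    refine Finset.sum_neg' (fun v _ => hle s hs hv₀ v) ⟨v, hv, ?_⟩
    simpa [P, hin s hs v₀ hv₀] using hout s hs v hvs
  have hWcover : ∀ z ∈ W, ∃ t ∈ T.filter (v₀ ∉ ·), z ∈ conicHull P t := by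
    intro z hz
    refine MonoCons.exists_mem_conicHull hE
      (isOpen_biInter_finset fun s _ => isOpen_lt (ℓ s).continuous continuous_const)
      (convex_iInter₂ fun s _ => convex_halfSpace_lt (ℓ s).toLinearMap.isLinear 0)
      (fun t ht => h.card_eq t (Finset.mem_filter.1 ht).1)
      (fun t ht => hli t (Finset.mem_filter.1 ht).1 (Finset.mem_filter.1 ht).2)
      ⟨t₁, Finset.mem_filter.2 ⟨ht₁, hvt₁⟩, hw₁⟩ ?_ hz
    intro t ht v hv
    rw [Finset.mem_filter] at ht
    obtain ⟨d, hd, hs⟩ := h.exists_insert ht.1 hv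
    -- A wall whose other triangle contains `v₀` lies in the hyperplane where the functional of that
    -- triangle vanishes, so it misses `W`; all other walls separate two of the remaining cones.
    by_cases hdv : d = v₀
    · left
      rintro z hz ⟨c, hc, rfl⟩
      have := hW.1 hz _ hs (by simp [hdv])
      rw [map_sum] at this
      refine this.ne (Finset.sum_eq_zero fun u hu => ?_)
      rw [map_smul, map_sub, hin _ hs u (by simp [Finset.mem_of_mem_erase hu,
        Finset.ne_of_mem_erase hu]), hin _ hs v₀ (by simp [hdv]), sub_self, smul_zero]
    · right
      have hvs : v ∉ insert d (t.erase v) := by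
        simp only [Finset.mem_insert, Finset.mem_erase, not_or]
        exact ⟨fun hvd => hd (hvd ▸ hv), fun hh => hh.1 rfl⟩
      have hvs₀ : v₀ ∉ insert d (t.erase v) := by
        simp only [Finset.mem_insert, Finset.mem_erase, not_or]
        exact ⟨fun hh => hdv hh.symm, fun hh => ht.2 hh.2⟩
      obtain ⟨φ, h1, -⟩ := exists_coordinates hE (h.card_eq t ht.1) (hli t ht.1 ht.2)
      refine ⟨d, hd, Finset.mem_filter.2 ⟨hs, hvs₀⟩, fun u => φ u (P d), ?_, (h1 _).symm⟩
      refine coefficient_neg_of_adjacent (p := P) hv (ℓ := ℓ t) (ℓ' := ℓ (insert d (t.erase v)))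
        (sub_pos.2 (hout t ht.1 v₀ ht.2)) (fun u hu => ?_) ?_ (sub_pos.2 (hout _ hs v₀ hvs₀))
        (fun u hu => ?_) ?_ ?_ (h1 _).symm
      · simp [P, hin t ht.1 u hu]
      · simpa [P] using hout t ht.1 d hd
      · simp [P, hin _ hs u (Finset.mem_insert_of_mem hu)]
      · simp [P, hin _ hs d (Finset.mem_insert_self _ _)]
      · simpa [P] using hout _ hs v hvs
  refine ⟨⟨_, hW.1 hw₁⟩, hli, fun z hz => ?_⟩
  have hclosed : IsClosed (⋃ t ∈ T.filter (v₀ ∉ ·), conicHull P t) :=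
    (T.filter (v₀ ∉ ·)).finite_toSet.isClosed_biUnion fun t ht => by
      have ht := Finset.mem_filter.1 ht
      exact isClosed_conicHull hE (h.card_eq t ht.1) (hli t ht.1 ht.2)
  -- A boundary point is a limit of points pushed into `W`, and a finite union of closed cones is
  -- closed.
  have hlim : Filter.Tendsto (fun ε : ℝ => z + ε • ∑ v ∈ t₁, P v) (nhdsWithin 0 (Set.Ioi 0))
      (nhds z) := by
    have : Continuous fun ε : ℝ => z + ε • ∑ v ∈ t₁, P v := by fun_prop
    simpa using (this.tendsto 0).mono_left nhdsWithin_le_nhds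
  have hmem := hclosed.mem_of_tendsto hlim (by
    filter_upwards [self_mem_nhdsWithin] with ε hε
    have hzW : z + ε • ∑ v ∈ t₁, P v ∈ W := by
      refine hW.2 fun s hs hv₀ => ?_
      have h1 := hz s hs hv₀
      have h2 := hW.1 hw₁ s hs hv₀
      rw [map_add, map_smul, smul_eq_mul]
      have := mul_neg_of_pos_of_neg (Set.mem_Ioi.1 hε) h2
      linarith
    simpa using hWcover _ hzW)
  simpa [and_assoc] using hmem

end IsPolytopeCertificate

/-- Deleting a vertex from the boundary complex of a polytope yields a disc: project radially from
the deleted vertex. -/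
theorem IsPolytopeCertificate.isSimplicialBall_deletion (h : IsPolytopeCertificate T p)
    (hE : Module.finrank ℝ E = 3) (v₀ : V) :
    IsSimplicialBall 2 (ofTriangles (T.filter (v₀ ∉ ·))) := by
  classical
  obtain ⟨ℓ, κ, hκ, hin, hout⟩ := h.exists_functionals
  obtain ⟨⟨w, hw⟩, hli, hcover⟩ := h.exists_mem_conicHull_deletion hE v₀ hin hout
  set P : V → E := fun v => p v - p v₀ with hP
  have hle : ∀ s ∈ T, v₀ ∈ s → ∀ v, ℓ s (P v) ≤ 0 := by
    intro s hs hv₀ v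
    simp only [P, map_sub, hin s hs v₀ hv₀, sub_nonpos]
    by_cases hv : v ∈ s
    exacts [(hin s hs v hv).le, (hout s hs v hv).le]
  -- Positive on every `P v` with `v ≠ v₀`, because some facet contains `v₀` but not `v`. Hence the
  -- plane `φ = 1` cuts the tangent cone in a polygon, the vertex figure.
  let φ : E →L[ℝ] ℝ := - ∑ s ∈ T.filter (v₀ ∈ ·), ℓ s
  have hφ : ∀ z, φ z = ∑ s ∈ T.filter (v₀ ∈ ·), -ℓ s z := fun z => by simp [φ]
  have hφP : ∀ v, v ≠ v₀ → 0 < φ (P v) := by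
    intro v hv
    rw [hφ]
    obtain ⟨t₀, ht₀, hvt₀⟩ := h.covers v₀
    obtain ⟨s, hs, hfs, hvs⟩ : ∃ s ∈ T, {v₀} ⊆ s ∧ v ∉ s := by
      by_contra hcon
      push Not at hcon
      exact hv (by simpa using h.mem_of_forall ht₀ (f := {v₀}) (by simpa using hvt₀) hcon)
    rw [Finset.singleton_subset_iff] at hfs
    refine Finset.sum_pos' (fun s hs => ?_) ⟨s, Finset.mem_filter.2 ⟨hs, hfs⟩, ?_⟩
    · rw [Finset.mem_filter] at hs
      linarith [hle s hs.1 hs.2 v]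
    · simpa [P, hin s hs v₀ hfs] using hout s hs v hvs
  have hφw : 0 < φ w := by
    rw [hφ]
    obtain ⟨t₀, ht₀, hvt₀⟩ := h.covers v₀
    refine Finset.sum_pos (fun s hs => ?_) ⟨t₀, Finset.mem_filter.2 ⟨ht₀, hvt₀⟩⟩
    rw [Finset.mem_filter] at hs
    linarith [hw s hs.1 hs.2]
  obtain ⟨z₀, hz₀, hz₀W⟩ : ∃ z₀, φ z₀ = 1 ∧ ∀ s ∈ T, v₀ ∈ s → ℓ s z₀ < 0 := by
    refine ⟨(φ w)⁻¹ • w, by rw [map_smul, smul_eq_mul, inv_mul_cancel₀ hφw.ne'], ?_⟩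
    intro s hs hv₀
    rw [map_smul, smul_eq_mul]
    exact mul_neg_of_pos_of_neg (inv_pos.2 hφw) (hw s hs hv₀)
  have hker : Module.finrank ℝ (LinearMap.ker φ.toLinearMap) =
      Module.finrank ℝ (EuclideanSpace ℝ (Fin 2)) := by
    have h1 := φ.toLinearMap.finrank_range_add_finrank_ker
    have h2 : LinearMap.range φ.toLinearMap = ⊤ :=
      LinearMap.range_eq_top.2 fun r => ⟨r • z₀, by simp [hz₀]⟩
    rw [h2, finrank_top, hE, Module.finrank_self] at h1
    rw [finrank_euclideanSpace_fin]
    omega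
  let e := ContinuousLinearEquiv.ofFinrankEq hker
  let π : E →L[ℝ] EuclideanSpace ℝ (Fin 2) := e.toContinuousLinearMap.comp
    ((ContinuousLinearMap.id ℝ E - φ.smulRight z₀).codRestrict (LinearMap.ker φ.toLinearMap)
      fun z => by simp [hz₀])
  let lift : EuclideanSpace ℝ (Fin 2) → E := fun y => z₀ + (e.symm y : E)
  have hφlift : ∀ y, φ (lift y) = 1 := by
    intro y
    have : φ (e.symm y : E) = 0 := (e.symm y).2
    simp [lift, hz₀, this]
  have hπlift : ∀ y, π (lift y) = y := by
    intro y
    have : φ (e.symm y : E) = 0 := (e.symm y).2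
    simp only [π, lift, ContinuousLinearMap.comp_apply]
    apply e.symm.injective
    ext
    simp [this, hz₀]
  have hliftπ : ∀ z, φ z = 1 → lift (π z) = z := by
    intro z hz
    simp [π, lift, hz]
  let Z : (V → ℝ) → E := fun x => ∑ v, x v • P v
  have hZ : Continuous Z := by fun_prop
  have hreal : ∀ x ∈ realization (ofTriangles (T.filter (v₀ ∉ ·))), (∀ v, 0 ≤ x v) ∧
      ∑ v, x v = 1 ∧ ∃ t ∈ T, v₀ ∉ t ∧ ∀ v ∉ t, x v = 0 := by
    intro x hx
    obtain ⟨⟨h1, h2⟩, t, ht, h3⟩ := mem_realization_ofTriangles.1 hx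
    rw [Finset.mem_filter] at ht
    exact ⟨h1, h2, t, ht.1, ht.2, h3⟩
  have hφZ : ∀ x ∈ realization (ofTriangles (T.filter (v₀ ∉ ·))), 0 < φ (Z x) := by
    intro x hx
    obtain ⟨h1, h2, t, -, hv₀, h3⟩ := hreal x hx
    have hterm : ∀ v, 0 ≤ x v * φ (P v) := fun v => by
      by_cases hv : v = v₀
      · simp [hv, h3 v₀ hv₀]
      · exact mul_nonneg (h1 v) (hφP v hv).le
    obtain ⟨v, -, hv⟩ := Finset.exists_ne_zero_of_sum_ne_zero (h2.trans_ne one_ne_zero)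
    simp only [Z, map_sum, map_smul, smul_eq_mul]
    refine Finset.sum_pos' (fun v _ => hterm v) ⟨v, Finset.mem_univ v, ?_⟩
    refine mul_pos (lt_of_le_of_ne (h1 v) hv.symm) (hφP v ?_)
    rintro rfl
    exact hv (h3 v hv₀)
  -- Radial projection from the deleted vertex to the plane `φ = 1`, read in the chart `π` whose
  -- inverse is `lift`.
  let f : realization (ofTriangles (T.filter (v₀ ∉ ·))) → EuclideanSpace ℝ (Fin 2) :=
    fun x => (φ (Z x))⁻¹ • π (Z x)
  have hlift_f : ∀ x, lift (f x) = (φ (Z x))⁻¹ • Z x := by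
    intro x
    have : f x = π ((φ (Z x))⁻¹ • Z x) := by simp [f]
    rw [this, hliftπ]
    rw [map_smul, smul_eq_mul, inv_mul_cancel₀ (hφZ x x.2).ne']
  have hf : Continuous f := by
    have hZx : Continuous fun x : realization (ofTriangles (T.filter (v₀ ∉ ·))) => Z x :=
      hZ.comp continuous_subtype_val
    exact ((φ.continuous.comp hZx).inv₀ fun x => (hφZ x x.2).ne').smul (π.continuous.comp hZx)
  have hℓZ : ∀ t ∈ T, v₀ ∉ t → ∀ x ∈ realization (ofTriangles (T.filter (v₀ ∉ ·))),
      ℓ t (Z x) ≤ κ t - ℓ t (p v₀) ∧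
      (ℓ t (Z x) = κ t - ℓ t (p v₀) ↔ ∀ v ∉ t, x v = 0) := by
    intro t ht hv₀ x hx
    obtain ⟨h1, h2, -⟩ := hreal x hx
    have hval : κ t - ℓ t (p v₀) - ℓ t (Z x) = ∑ v, x v * (κ t - ℓ t (p v)) := by
      have e1 : ∀ v, x v * (κ t - ℓ t (p v)) =
          x v * (κ t - ℓ t (p v₀)) - x v * ℓ t (P v) := fun v => by simp [P]; ring
      simp only [e1, Finset.sum_sub_distrib, ← Finset.sum_mul, h2, Z, map_sum, map_smul,
        smul_eq_mul, one_mul]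
    have hnn : ∀ v, 0 ≤ x v * (κ t - ℓ t (p v)) := fun v => by
      refine mul_nonneg (h1 v) (sub_nonneg.2 ?_)
      by_cases hv : v ∈ t
      exacts [(hin t ht v hv).le, (hout t ht v hv).le]
    have hsum := Finset.sum_nonneg fun v (_ : v ∈ Finset.univ) => hnn v
    refine ⟨by linarith, fun heq => ?_, fun hsupp => ?_⟩
    · intro v hv
      rw [heq, sub_self] at hval
      have := (Finset.sum_eq_zero_iff_of_nonneg fun v _ => hnn v).1 hval.symm v (Finset.mem_univ v)
      exact (mul_eq_zero.1 this).resolve_right (sub_pos.2 (hout t ht v hv)).ne'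
    · have : ∑ v, x v * (κ t - ℓ t (p v)) = 0 := Finset.sum_eq_zero fun v _ => by
        by_cases hv : v ∈ t
        · rw [hin t ht v hv, sub_self, mul_zero]
        · rw [hsupp v hv, zero_mul]
      linarith
  have hinj : Function.Injective f := by
    -- Two points on the same ray are compared through the facet `t` carrying `x`: `ℓ t` is maximal
    -- at `Z x`, so `Z y` cannot lie farther out. By symmetry the points agree, both are carried by
    -- `t`, and independence of the `P v` recovers the coordinates.
    have key : ∀ x y : realization (ofTriangles (T.filter (v₀ ∉ ·))), f x = f y →
        ∃ t ∈ T, v₀ ∉ t ∧ (∀ v ∉ t, x.1 v = 0) ∧ φ (Z y) ≤ φ (Z x) ∧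
          (φ (Z x) = φ (Z y) → ∀ v ∉ t, y.1 v = 0) := by
      intro x y hxy
      obtain ⟨-, -, t, ht, hv₀, hxt⟩ := hreal x x.2
      have e1 : (φ (Z x))⁻¹ • Z x = (φ (Z y))⁻¹ • Z y := by rw [← hlift_f, ← hlift_f, hxy]
      have e2 := congrArg (ℓ t) e1
      have hx := hφZ x x.2
      have hy := hφZ y y.2
      have hpos := sub_pos.2 (hout t ht v₀ hv₀)
      rw [map_smul, map_smul, ((hℓZ t ht hv₀ x x.2).2).2 hxt, smul_eq_mul, smul_eq_mul,
        inv_mul_eq_div, inv_mul_eq_div, div_eq_div_iff hx.ne' hy.ne'] at e2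
      refine ⟨t, ht, hv₀, hxt, ?_, fun heq => ?_⟩
      · have := (hℓZ t ht hv₀ y y.2).1
        by_contra hlt
        push Not at hlt
        nlinarith
      · rw [heq] at e2
        exact (hℓZ t ht hv₀ y y.2).2.1 (mul_right_cancel₀ hy.ne' e2.symm)
    intro x y hxy
    obtain ⟨t, ht, hv₀, hxt, h1, h2⟩ := key x y hxy
    obtain ⟨-, -, -, -, h3, -⟩ := key y x hxy.symm
    have heq := h3.antisymm h1
    have hyt := h2 heq
    have e1 : Z x = Z y := by
      have : (φ (Z x))⁻¹ • Z x = (φ (Z y))⁻¹ • Z y := by rw [← hlift_f, ← hlift_f, hxy]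
      rw [heq] at this
      exact smul_right_injective E (inv_ne_zero (hφZ y y.2).ne') this
    have e2 : ∀ x : V → ℝ, (∀ v ∉ t, x v = 0) → Z x = ∑ v : t, x v • P v := by
      intro x hx
      rw [Finset.sum_coe_sort t fun v => x v • P v]
      exact (Finset.sum_subset (Finset.subset_univ t) fun v _ hv => by
        rw [hx v hv, zero_smul]).symm
    rw [e2 x hxt, e2 y hyt, ← sub_eq_zero, ← Finset.sum_sub_distrib] at e1
    simp only [← sub_smul] at e1
    have e3 := Fintype.linearIndependent_iff.1 (hli t ht hv₀) _ e1
    ext v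
    by_cases hv : v ∈ t
    · exact sub_eq_zero.1 (e3 ⟨v, hv⟩)
    · rw [hxt v hv, hyt v hv]
  have hrange : Set.range f = ⋂ s ∈ T.filter (v₀ ∈ ·), {y | ℓ s (lift y) ≤ 0} := by
    ext y
    simp only [Set.mem_range, Set.mem_iInter, Finset.mem_filter, and_imp, Set.mem_ofPred_eq]
    constructor
    · rintro ⟨x, rfl⟩ s hs hv₀
      obtain ⟨h1, -⟩ := hreal x x.2
      rw [hlift_f, map_smul, smul_eq_mul]
      refine mul_nonpos_of_nonneg_of_nonpos (inv_nonneg.2 (hφZ x x.2).le) ?_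
      simp only [Z, map_sum, map_smul, smul_eq_mul]
      exact Finset.sum_nonpos fun v _ =>
        mul_nonpos_of_nonneg_of_nonpos (h1 v) (hle s hs hv₀ v)
    · intro hy
      obtain ⟨t, ht, hv₀, c, hc, hsum⟩ := hcover (lift y) hy
      have hpos : 0 < ∑ v ∈ t, c v := by
        refine lt_of_le_of_ne (Finset.sum_nonneg hc) fun h0 => ?_
        have : lift y = 0 := by
          rw [hsum]
          refine Finset.sum_eq_zero fun u hu => ?_
          rw [(Finset.sum_eq_zero_iff_of_nonneg hc).1 h0.symm u hu, zero_smul]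
        have h1 := hφlift y
        rw [this, map_zero] at h1
        exact zero_ne_one h1
      set σ := ∑ v ∈ t, c v
      let x : V → ℝ := fun v => if v ∈ t then σ⁻¹ * c v else 0
      have hx : x ∈ realization (ofTriangles (T.filter (v₀ ∉ ·))) := by
        refine mem_realization_ofTriangles.2 ⟨⟨fun v => ?_, ?_⟩, t,
          Finset.mem_filter.2 ⟨ht, hv₀⟩, fun v hv => by simp [x, hv]⟩
        · by_cases hv : v ∈ t
          · simpa [x, hv] using mul_nonneg (inv_nonneg.2 hpos.le) (hc v hv)
          · simp [x, hv]
        · simp only [x, Finset.sum_ite_mem, Finset.univ_inter, ← Finset.mul_sum]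
          exact inv_mul_cancel₀ hpos.ne'
      have hZx : Z x = σ⁻¹ • lift y := by
        rw [hsum, Finset.smul_sum]
        simp only [Z, x, ite_smul, zero_smul, Finset.sum_ite_mem, Finset.univ_inter, mul_smul]
      refine ⟨⟨x, hx⟩, ?_⟩
      simp only [f, hZx, map_smul, hφlift, hπlift, smul_eq_mul, mul_one, inv_inv, smul_smul]
      rw [mul_inv_cancel₀ hpos.ne', one_smul]
  refine isSimplicialBall_of_embedding hf hinj ?_ ?_
  · rw [hrange]
    refine convex_iInter₂ fun s _ => ?_
    intro y hy y' hy' a b ha hb hab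
    have e1 : lift (a • y + b • y') = a • lift y + b • lift y' := by
      simp only [lift, map_add, map_smul, Submodule.coe_add, Submodule.coe_smul, smul_add]
      have : z₀ = a • z₀ + b • z₀ := by rw [← add_smul, hab, one_smul]
      conv_lhs => rw [this]
      abel
    simp only [Set.mem_ofPred_eq, e1, map_add, map_smul, smul_eq_mul] at hy hy' ⊢
    nlinarith
  · refine ⟨0, mem_interior_iff_mem_nhds.2 ?_⟩
    rw [hrange]
    have hlc : Continuous lift := by fun_prop
    refine (Filter.biInter_finset_mem _).2 fun s hs => ?_
    rw [Finset.mem_filter] at hs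
    have : ∀ᶠ y in nhds (0 : EuclideanSpace ℝ (Fin 2)), ℓ s (lift y) < 0 :=
      ((ℓ s).continuous.comp hlc).continuousAt.eventually
        (gt_mem_nhds (by simpa [lift] using hz₀W s hs.1 hs.2))
    exact this.mono fun y hy => hy.le

end Disc

/-! ### The sphere with a shortcut: flagness and coordinates -/

section Shortcut

/-- The triangles of a flag sphere with `20` vertices, each with its distance to the triangle
`8, 10, 11` in the dual graph. -/
def shortcutList : List (Fin 20 × Fin 20 × Fin 20 × ℕ) :=
  [(0,1,2,9), (0,2,3,8), (0,3,4,7), (0,4,5,6), (0,5,12,6), (0,12,18,7), (0,18,17,8), (0,17,1,9),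
   (1,16,2,9), (1,17,16,8), (2,16,3,8), (3,16,4,7), (4,6,5,5), (4,7,6,4), (4,16,13,6),
   (4,13,7,5), (5,6,19,5), (5,19,12,5), (6,7,8,3), (6,8,9,2), (6,9,15,3), (6,15,19,4),
   (7,12,8,3), (7,13,12,4), (8,10,9,1), (8,11,10,0), (8,12,14,2), (8,14,11,1), (9,10,15,2),
   (10,11,15,1), (11,14,15,2), (12,15,14,3), (12,16,18,6), (12,13,16,5), (12,19,15,4),
   (16,17,18,7)]

/-- The vertex set of an entry of the list of triangles. -/
def entrySet (x : Fin 20 × Fin 20 × Fin 20 × ℕ) : Finset (Fin 20) := {x.1, x.2.1, x.2.2.1}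

/-- The triangles of the sphere. -/
def shortcutTriangles : Finset (Finset (Fin 20)) := (shortcutList.map entrySet).toFinset

theorem mem_shortcutTriangles {t : Finset (Fin 20)} :
    t ∈ shortcutTriangles ↔ ∃ x ∈ shortcutList, entrySet x = t := by
  simp [shortcutTriangles]

theorem forall_shortcutTriangles {P : Finset (Fin 20) → Prop}
    (h : ∀ x ∈ shortcutList, P (entrySet x)) : ∀ t ∈ shortcutTriangles, P t := by
  intro t ht
  obtain ⟨x, hx, rfl⟩ := mem_shortcutTriangles.1 ht
  exact h x hx

/-- Coordinates of the vertices of a polytope with the given triangles as facets. -/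
def shortcutCoords : Fin 20 → Fin 3 → ℤ :=
  ![![6,4,3], ![5,-1,3], ![6,-1,1], ![6,-1,-2], ![4,0,-6], ![3,6,1], ![1,1,-7], ![-2,-4,-1],
    ![-5,-2,-2], ![-3,1,-5], ![-4,2,-3], ![-5,2,0], ![-4,1,7], ![1,-5,1], ![-5,1,3], ![-4,5,-1],
    ![4,-5,3], ![3,-1,5], ![1,0,7], ![0,6,0]]

/-- The normal vector of an oriented triangle. -/
def normal (a b c : Fin 3 → ℤ) : Fin 3 → ℤ :=
  ![(b 1 - a 1) * (c 2 - a 2) - (b 2 - a 2) * (c 1 - a 1),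
    (b 2 - a 2) * (c 0 - a 0) - (b 0 - a 0) * (c 2 - a 2),
    (b 0 - a 0) * (c 1 - a 1) - (b 1 - a 1) * (c 0 - a 0)]

/-- The scalar product of integer vectors. -/
def dot (a b : Fin 3 → ℤ) : ℤ := a 0 * b 0 + a 1 * b 1 + a 2 * b 2

theorem exists_supporting_of_int {V : Type*} {q : V → Fin 3 → ℤ} {t : Finset V}
    (h : ∃ (n : Fin 3 → ℤ) (κ : ℤ), 0 < κ ∧
      ∀ v, (v ∈ t → dot n (q v) = κ) ∧ (v ∉ t → dot n (q v) < κ)) :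
    ∃ (ℓ : EuclideanSpace ℝ (Fin 3) →L[ℝ] ℝ) (κ : ℝ), 0 < κ ∧ ∀ v,
      (v ∈ t → ℓ (WithLp.toLp 2 fun i => (q v i : ℝ)) = κ) ∧
      (v ∉ t → ℓ (WithLp.toLp 2 fun i => (q v i : ℝ)) < κ) := by
  obtain ⟨n, κ, h1, h2⟩ := h
  let ℓ : EuclideanSpace ℝ (Fin 3) →L[ℝ] ℝ := (n 0 : ℝ) • EuclideanSpace.proj 0 +
    (n 1 : ℝ) • EuclideanSpace.proj 1 + (n 2 : ℝ) • EuclideanSpace.proj 2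
  have hℓ : ∀ v, ℓ (WithLp.toLp 2 fun i => (q v i : ℝ)) = (dot n (q v) : ℝ) := fun v => by
    simp [ℓ, dot]
  refine ⟨ℓ, κ, by exact_mod_cast h1, fun v => ?_⟩
  simp only [hℓ]
  exact_mod_cast h2 v

theorem shortcut_supporting : ∀ x ∈ shortcutList,
    let n := normal (shortcutCoords x.1) (shortcutCoords x.2.1) (shortcutCoords x.2.2.1)
    let κ := dot n (shortcutCoords x.1)
    0 < κ ∧ ∀ v, (v ∈ entrySet x → dot n (shortcutCoords v) = κ) ∧
      (v ∉ entrySet x → dot n (shortcutCoords v) < κ) := by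
  decide +kernel

theorem shortcut_card : ∀ t ∈ shortcutTriangles, t.card = 3 :=
  forall_shortcutTriangles (by decide +kernel)

theorem shortcut_edge : ∀ x ∈ shortcutList, ∀ v ∈ entrySet x, ∃ y ∈ shortcutList,
    v ∉ entrySet y ∧ (entrySet x).erase v ⊆ entrySet y := by
  decide +kernel

theorem shortcut_covers : ∀ v, ∃ x ∈ shortcutList, v ∈ entrySet x := by
  decide +kernel

theorem isPolytopeCertificate_shortcut : IsPolytopeCertificate shortcutTriangles
    fun v => WithLp.toLp 2 fun i => (shortcutCoords v i : ℝ) where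
  nonempty := ⟨{0, 1, 2}, by decide +kernel⟩
  card_eq := shortcut_card
  supporting := forall_shortcutTriangles fun x hx =>
    exists_supporting_of_int ⟨_, _, shortcut_supporting x hx⟩
  edge := by
    refine forall_shortcutTriangles fun x hx v hv => ?_
    obtain ⟨y, hy, h⟩ := shortcut_edge x hx v hv
    exact ⟨_, mem_shortcutTriangles.2 ⟨y, hy, rfl⟩, h⟩
  covers := fun v => by
    obtain ⟨x, hx, h⟩ := shortcut_covers v
    exact ⟨_, mem_shortcutTriangles.2 ⟨x, hx, rfl⟩, h⟩

theorem exists_shortcutTriangles {P : Finset (Fin 20) → Prop} :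
    (∃ t ∈ shortcutTriangles, P t) ↔ ∃ x ∈ shortcutList, P (entrySet x) := by
  simp [shortcutTriangles]

/-- Adjacency of vertices of the sphere, as a bit mask. -/
def shortcutMask : Fin 20 → ℕ := fun v =>
  (shortcutList.filter fun x => v ∈ entrySet x).foldl
    (fun m x => m ||| 2 ^ x.1.val ||| 2 ^ x.2.1.val ||| 2 ^ x.2.2.1.val) 0

theorem noEmptyCliques_shortcut : NoEmptyCliques shortcutTriangles where
  triple := by
    have hmask : ∀ x ∈ shortcutList, ∀ a ∈ entrySet x, ∀ b ∈ entrySet x,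
        (shortcutMask a).testBit b = true := by decide +kernel
    -- Tabulated adjacencies turn the search for empty triangles into bit tests.
    have hall : ∀ a b : Fin 20, a ≠ b → (shortcutMask a).testBit b = true → ∀ c, a ≠ c → b ≠ c →
        (shortcutMask a).testBit c = true → (shortcutMask b).testBit c = true →
        ∃ x ∈ shortcutList, entrySet x = {a, b, c} := by decide +kernel
    intro a b c hab hac hbc h1 h2 h3
    rw [exists_shortcutTriangles] at h1 h2 h3
    obtain ⟨x, hx, hx1, hx2⟩ := h1
    obtain ⟨y, hy, hy1, hy2⟩ := h2
    obtain ⟨z, hz, hz1, hz2⟩ := h3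
    exact mem_shortcutTriangles.2 (hall a b hab (hmask x hx a hx1 b hx2) c hac hbc
      (hmask y hy a hy1 c hy2) (hmask z hz b hz1 c hz2))
  quadruple := by
    have hall : ∀ x ∈ shortcutList, ∀ v ∉ entrySet x, ∃ u ∈ entrySet x,
        ∀ y ∈ shortcutList, u ∈ entrySet y → v ∉ entrySet y := by decide +kernel
    refine forall_shortcutTriangles fun x hx v hv => ?_
    obtain ⟨u, hu, h⟩ := hall x hx v hv
    exact ⟨u, hu, forall_shortcutTriangles h⟩

end Shortcut

/-! ### A monotone conservative path of length ten -/

section ShortcutPath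

variable {T : Finset (Finset (Fin 20))}

/-- Distances to `{8, 10, 11}`. -/
def targetDist : Fin 20 → ℕ := ![2, 3, 3, 3, 2, 2, 1, 1, 0, 1, 0, 0, 1, 2, 1, 1, 2, 3, 2, 2]

/-- Distances in the links of the vertices `0`, `12` and `8` to the induced target sets. -/
def linkTargetDist (v : Fin 20) : Fin 20 → ℕ :=
  if v = 0 then ![0, 3, 4, 3, 2, 1, 0, 0, 0, 0, 0, 0, 0, 0, 0, 0, 0, 2, 1, 0]
  else if v = 12 then ![5, 0, 0, 0, 0, 4, 0, 1, 0, 0, 0, 0, 0, 2, 1, 2, 3, 0, 4, 3]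
  else ![0, 0, 0, 0, 0, 0, 2, 3, 0, 1, 0, 0, 2, 0, 1, 0, 0, 0, 0, 0]

theorem targetDist_lipschitz : ∀ x ∈ shortcutList, ∀ u ∈ entrySet x, ∀ w ∈ entrySet x,
    targetDist u ≤ targetDist w + 1 := by decide +kernel

theorem linkTargetDist_lipschitz : ∀ v ∈ ({0, 12, 8} : Finset (Fin 20)), ∀ x ∈ shortcutList,
    v ∈ entrySet x → ∀ u ∈ entrySet x, ∀ w ∈ entrySet x, v ≠ u → v ≠ w →
    linkTargetDist v u ≤ linkTargetDist v w + 1 := by decide +kernel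

/-- The potential must vanish on the induced target. Its members are closer to the target than `v`,
and since `targetDist` is only a lower bound, the check covers every neighbour that could qualify.
-/
theorem linkTargetDist_eq_zero : ∀ v ∈ ({0, 12} : Finset (Fin 20)), ∀ x ∈ shortcutList,
    v ∈ entrySet x → ∀ u ∈ entrySet x, v ≠ u → targetDist u + 1 ≤ targetDist v →
    linkTargetDist v u = 0 := by decide +kernel

theorem mem_of_deletion_subset (hsup : shortcutTriangles.filter (19 ∉ ·) ⊆ T) {a b c : Fin 20}
    (h : ∃ x ∈ shortcutList, 19 ∉ entrySet x ∧ entrySet x = {a, b, c}) : {a, b, c} ∈ T := by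
  obtain ⟨x, hx, h1, h2⟩ := h
  exact hsup (Finset.mem_filter.2 ⟨mem_shortcutTriangles.2 ⟨x, hx, h2⟩, h2 ▸ h1⟩)

local notation "tgt" => (((({8, 10, 11} : Finset (Fin 20))) : Set (Fin 20)))

theorem vdist_eight : vdist (ofTriangles T) {(8 : Fin 20)} tgt = 0 :=
  vdist_singleton_eq_zero_iff.2 (by simp)

theorem mem_nextTarget_eight {u : Fin 20} : u ∈ nextTarget (ofTriangles T) tgt 8 ↔
    u ∈ tgt ∧ 8 ≠ u ∧ ∃ t ∈ T, 8 ∈ t ∧ u ∈ t := by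
  rw [nextTarget_of_mem (by simp), Set.mem_inter_iff, mem_vertexSet_link_ofTriangles]

section Sandwich

variable (hsub : T ⊆ shortcutTriangles) (hsup : shortcutTriangles.filter (19 ∉ ·) ⊆ T)

include hsub hsup

theorem le_vdist_shortcut (u : Fin 20) :
    (targetDist u : ℕ∞) ≤ vdist (ofTriangles T) {u} tgt := by
  refine le_vdist_of_lipschitz (not_isZeroDim_of_adj (u := 0) (w := 1) ?_) (fun u w h => ?_)
    (fun w hw => ?_) u
  · exact skeletonGraph_adj_ofTriangles.2 ⟨by decide, {0, 1, 2},
      mem_of_deletion_subset hsup (by decide +kernel), by decide, by decide⟩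
  · obtain ⟨-, t, ht, hu, hw⟩ := skeletonGraph_adj_ofTriangles.1 h
    obtain ⟨x, hx, rfl⟩ := mem_shortcutTriangles.1 (hsub ht)
    exact targetDist_lipschitz x hx u hu w hw
  · have : ∀ w ∈ ({8, 10, 11} : Finset (Fin 20)), targetDist w = 0 := by decide
    exact this w (by simpa using hw)

theorem vdist_twelve : vdist (ofTriangles T) {(12 : Fin 20)} tgt = 1 := by
  refine le_antisymm ?_ (le_vdist_shortcut hsub hsup 12)
  have := vdist_le_add_one_of_adj (C := ofTriangles T) (u := 12) (w := 8) (S := tgt)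
    (skeletonGraph_adj_ofTriangles.2 ⟨by decide, {8, 12, 14},
      mem_of_deletion_subset hsup (by decide +kernel), by decide, by decide⟩)
  rwa [vdist_eight, zero_add] at this

theorem vdist_zero : vdist (ofTriangles T) {(0 : Fin 20)} tgt = 2 := by
  refine le_antisymm ?_ (le_vdist_shortcut hsub hsup 0)
  have := vdist_le_add_one_of_adj (C := ofTriangles T) (u := 0) (w := 12) (S := tgt)
    (skeletonGraph_adj_ofTriangles.2 ⟨by decide, {0, 5, 12},
      mem_of_deletion_subset hsup (by decide +kernel), by decide, by decide⟩)
  rwa [vdist_twelve hsub hsup, one_add_one_eq_two] at this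

theorem vdist_shortcut_le {v : Fin 20} (hv : v ∈ ({0, 12, 8} : Finset (Fin 20))) (u : Fin 20)
    (h : targetDist v ≤ targetDist u) :
    vdist (ofTriangles T) {v} tgt ≤ vdist (ofTriangles T) {u} tgt := by
  refine le_trans ?_ ((Nat.cast_le.2 h).trans (le_vdist_shortcut hsub hsup u))
  simp only [Finset.mem_insert, Finset.mem_singleton] at hv
  rcases hv with rfl | rfl | rfl
  · exact (vdist_zero hsub hsup).le
  · exact (vdist_twelve hsub hsup).le
  · exact (vdist_eight).le

theorem mem_nextTarget_zero {u : Fin 20} : u ∈ nextTarget (ofTriangles T) tgt 0 ↔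
    (0 ≠ u ∧ ∃ t ∈ T, 0 ∈ t ∧ u ∈ t) ∧ vdist (ofTriangles T) {u} tgt = 1 := by
  rw [mem_nextTarget_of_notMem (n := 1) (vdist_zero hsub hsup), mem_vertexSet_link_ofTriangles]
  rfl

theorem mem_nextTarget_twelve {u : Fin 20} : u ∈ nextTarget (ofTriangles T) tgt 12 ↔
    (12 ≠ u ∧ ∃ t ∈ T, 12 ∈ t ∧ u ∈ t) ∧ vdist (ofTriangles T) {u} tgt = 0 := by
  rw [mem_nextTarget_of_notMem (n := 0) (by simpa using vdist_twelve hsub hsup),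
    mem_vertexSet_link_ofTriangles]
  rfl

theorem le_linkDist_shortcut {v : Fin 20} (hv : v ∈ ({0, 12, 8} : Finset (Fin 20)))
    (u : Fin 20) : (linkTargetDist v u : ℕ∞) ≤ linkDist (ofTriangles T) tgt v u := by
  refine le_vdist_of_lipschitz ?_ (fun u w h => ?_) (fun w hw => ?_) u
  · simp only [Finset.mem_insert, Finset.mem_singleton] at hv
    rcases hv with rfl | rfl | rfl
    · exact not_isZeroDim_of_adj (u := 1) (w := 2) (skeletonGraph_link_adj_ofTriangles.2
        ⟨by decide, by decide, by decide, {0, 1, 2},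
        mem_of_deletion_subset hsup (by decide +kernel), by decide, by decide, by decide⟩)
    · exact not_isZeroDim_of_adj (u := 8) (w := 14) (skeletonGraph_link_adj_ofTriangles.2
        ⟨by decide, by decide, by decide, {8, 12, 14},
        mem_of_deletion_subset hsup (by decide +kernel), by decide, by decide, by decide⟩)
    · exact not_isZeroDim_of_adj (u := 12) (w := 14) (skeletonGraph_link_adj_ofTriangles.2
        ⟨by decide, by decide, by decide, {8, 12, 14},
        mem_of_deletion_subset hsup (by decide +kernel), by decide, by decide, by decide⟩)
  · obtain ⟨-, hvu, hvw, t, ht, hvt, hu, hw⟩ := skeletonGraph_link_adj_ofTriangles.1 h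
    obtain ⟨x, hx, rfl⟩ := mem_shortcutTriangles.1 (hsub ht)
    exact linkTargetDist_lipschitz v hv x hx hvt u hu w hw hvu hvw
  · simp only [Finset.mem_insert, Finset.mem_singleton] at hv
    have hle := le_vdist_shortcut hsub hsup w
    rcases hv with rfl | rfl | rfl
    · obtain ⟨⟨hne, t, ht, h0, hwt⟩, hd⟩ := (mem_nextTarget_zero hsub hsup).1 hw
      obtain ⟨x, hx, rfl⟩ := mem_shortcutTriangles.1 (hsub ht)
      rw [hd] at hle
      have hle : targetDist w ≤ 1 := by exact_mod_cast hle
      exact linkTargetDist_eq_zero 0 (by decide) x hx h0 w hwt hne (Nat.succ_le_succ hle)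
    · obtain ⟨⟨hne, t, ht, h0, hwt⟩, hd⟩ := (mem_nextTarget_twelve hsub hsup).1 hw
      obtain ⟨x, hx, rfl⟩ := mem_shortcutTriangles.1 (hsub ht)
      rw [hd] at hle
      have hle : targetDist w ≤ 0 := by exact_mod_cast hle
      exact linkTargetDist_eq_zero 12 (by decide) x hx h0 w hwt hne (Nat.succ_le_succ hle)
    · have := ((mem_nextTarget_eight).1 hw).1
      have h8 : ∀ w ∈ ({8, 10, 11} : Finset (Fin 20)), linkTargetDist 8 w = 0 := by decide
      exact h8 w (by simpa using this)

omit hsub in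
theorem linkDist_le_succ {v u w : Fin 20} {n : ℕ}
    (hw : linkDist (ofTriangles T) tgt v w ≤ n) (hne : u ≠ w ∧ v ≠ u ∧ v ≠ w)
    (h : ∃ x ∈ shortcutList, 19 ∉ entrySet x ∧ entrySet x = {v, u, w}) :
    linkDist (ofTriangles T) tgt v u ≤ (n + 1 : ℕ) := by
  refine (vdist_le_add_one_of_adj (skeletonGraph_link_adj_ofTriangles.2
    ⟨hne.1, hne.2.1, hne.2.2, {v, u, w}, mem_of_deletion_subset hsup h, by simp, by simp,
      by simp⟩)).trans ?_
  rw [Nat.cast_add, Nat.cast_one]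
  gcongr
  exact hw

/-- The chain `1, 17, 18, 12` in the link of `0` ends in the induced target and avoids vertex `19`.
-/
theorem linkDist_zero_le : linkDist (ofTriangles T) tgt 0 18 ≤ (1 : ℕ) ∧
    linkDist (ofTriangles T) tgt 0 17 ≤ (2 : ℕ) ∧
    linkDist (ofTriangles T) tgt 0 1 ≤ (3 : ℕ) := by
  have h12 : linkDist (ofTriangles T) tgt 0 12 ≤ (0 : ℕ) := by
    refine (linkDist_eq_zero_iff.2 ((mem_nextTarget_zero hsub hsup).2 ⟨⟨by decide, {0, 12, 18},
      mem_of_deletion_subset hsup (by decide +kernel), by decide, by decide⟩,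
      vdist_twelve hsub hsup⟩)).le
  have h18 := linkDist_le_succ hsup (u := 18) h12 (by decide) (by decide +kernel)
  have h17 := linkDist_le_succ hsup (u := 17) h18 (by decide) (by decide +kernel)
  have h1 := linkDist_le_succ hsup (u := 1) h17 (by decide) (by decide +kernel)
  exact ⟨h18, h17, h1⟩

theorem linkDist_twelve_le : linkDist (ofTriangles T) tgt 12 7 ≤ (1 : ℕ) ∧
    linkDist (ofTriangles T) tgt 12 13 ≤ (2 : ℕ) ∧
    linkDist (ofTriangles T) tgt 12 16 ≤ (3 : ℕ) ∧
    linkDist (ofTriangles T) tgt 12 18 ≤ (4 : ℕ) := by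
  have h8 : linkDist (ofTriangles T) tgt 12 8 ≤ (0 : ℕ) := by
    refine (linkDist_eq_zero_iff.2 ((mem_nextTarget_twelve hsub hsup).2 ⟨⟨by decide, {8, 12, 14},
      mem_of_deletion_subset hsup (by decide +kernel), by decide, by decide⟩,
      vdist_eight⟩)).le
  have h7 := linkDist_le_succ hsup (u := 7) h8 (by decide) (by decide +kernel)
  have h13 := linkDist_le_succ hsup (u := 13) h7 (by decide) (by decide +kernel)
  have h16 := linkDist_le_succ hsup (u := 16) h13 (by decide) (by decide +kernel)
  have h18 := linkDist_le_succ hsup (u := 18) h16 (by decide) (by decide +kernel)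
  exact ⟨h7, h13, h16, h18⟩

omit hsub in
theorem mem_nextTarget_eight_shortcut : 11 ∈ nextTarget (ofTriangles T) tgt 8 ∧
    10 ∈ nextTarget (ofTriangles T) tgt 8 := by
  refine ⟨(mem_nextTarget_eight).2 ⟨by simp, by decide, {8, 10, 11}, ?_, by decide,
    by decide⟩, (mem_nextTarget_eight).2 ⟨by simp, by decide, {8, 10, 11}, ?_,
    by decide, by decide⟩⟩ <;>
  exact mem_of_deletion_subset hsup (by decide +kernel)

omit hsub in
theorem linkDist_eight_le : linkDist (ofTriangles T) tgt 8 11 ≤ (0 : ℕ) ∧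
    linkDist (ofTriangles T) tgt 8 14 ≤ (1 : ℕ) ∧
    linkDist (ofTriangles T) tgt 8 12 ≤ (2 : ℕ) := by
  have h11 : linkDist (ofTriangles T) tgt 8 11 ≤ (0 : ℕ) :=
    (linkDist_eq_zero_iff.2 (mem_nextTarget_eight_shortcut hsup).1).le
  have h14 := linkDist_le_succ hsup (u := 14) h11 (by decide) (by decide +kernel)
  have h12 := linkDist_le_succ hsup (u := 12) h14 (by decide) (by decide +kernel)
  exact ⟨h11, h14, h12⟩

omit hsub in
theorem linkDist_last_lt :
    linkDist (link (ofTriangles T) 8) (nextTarget (ofTriangles T) tgt 8) 11 10 <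
    linkDist (link (ofTriangles T) 8) (nextTarget (ofTriangles T) tgt 8) 11 14 := by
  obtain ⟨h11, h10⟩ := mem_nextTarget_eight_shortcut hsup
  have e10 : linkDist (link (ofTriangles T) 8) (nextTarget (ofTriangles T) tgt 8) 11 10 = 0 := by
    rw [linkDist_eq_zero_iff, nextTarget_of_mem h11]
    refine ⟨h10, ?_⟩
    refine ⟨by simp, by decide, by simp, by decide, by simp, {8, 10, 11}, ?_, by decide⟩
    exact mem_of_deletion_subset hsup (by decide +kernel)
  rw [e10]
  refine lt_of_lt_of_le zero_lt_one (one_le_linkDist_iff.2 ?_)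
  rw [nextTarget_of_mem h11]
  rintro ⟨h14, -⟩
  have := ((mem_nextTarget_eight).1 h14).1
  simp at this

/-- A monotone conservative path through the shortcut. -/
theorem exists_path_shortcut : ∃ (N : ℕ) (Γ : Fin (N + 1) → List (Fin 20)),
    IsMonotoneConservativePath (ofTriangles T) tgt {0, 1, 2} {8, 10, 11} N Γ := by
  have hT : ∀ t ∈ T, t.card = 3 := fun t ht => shortcut_card t (hsub ht)
  have hord : ∀ a b c : Fin 20, (∃ x ∈ shortcutList, 19 ∉ entrySet x ∧ entrySet x = {a, b, c}) →
      IsOrderedFacet (ofTriangles T) [a, b, c] := fun a b c h =>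
    isOrderedFacet_triple hT (mem_of_deletion_subset hsup h)
  have h0 := @vdist_shortcut_le T hsub hsup 0 (by decide)
  have h12 := @vdist_shortcut_le T hsub hsup 12 (by decide)
  have h8 := @vdist_shortcut_le T hsub hsup 8 (by decide)
  have l0 := @le_linkDist_shortcut T hsub hsup 0 (by decide)
  have l12 := @le_linkDist_shortcut T hsub hsup 12 (by decide)
  have l8 := @le_linkDist_shortcut T hsub hsup 8 (by decide)
  obtain ⟨a18, a17, a1⟩ := linkDist_zero_le hsub hsup
  obtain ⟨b7, b13, b16, b18⟩ := linkDist_twelve_le hsub hsup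
  obtain ⟨c11, c14, c12⟩ := linkDist_eight_le hsup
  have key : ∀ {x y : ℕ∞} {m n : ℕ}, x ≤ m → (n : ℕ∞) ≤ y → m < n → x < y :=
    fun h1 h2 h3 => h1.trans_lt ((Nat.cast_lt.2 h3).trans_le h2)
  have key' : ∀ {x y : ℕ∞} {m n : ℕ}, x ≤ m → (n : ℕ∞) ≤ y → m ≤ n → x ≤ y :=
    fun h1 h2 h3 => h1.trans ((Nat.cast_le.2 h3).trans h2)
  -- The heads are `0`, `12`, `8`. About each head the path turns along the chains bounded above, on
  -- the side away from the strip, and the last step fills in the target facet.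
  refine ⟨10, ![[0, 1, 2], [0, 17, 1], [0, 18, 17], [12, 18, 0], [12, 16, 18], [12, 13, 16],
    [12, 7, 13], [8, 12, 7], [8, 14, 12], [8, 11, 14], [8, 11, 10]],
    isMonotoneConservativePath_of_steps hT rfl (by decide) ?_ ?_ ?_ ?_⟩
  · intro i
    fin_cases i <;> exact hord _ _ _ (by decide +kernel)
  · exact isAdmissible_triple.2 ⟨h0 1 (by decide), h0 2 (by decide), key' a1 (l0 2) (by decide)⟩
  · intro i
    fin_cases i
    · exact isMonoConsStep_rotate (by decide) (by decide) (by decide) (by decide)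
        (h0 17 (by decide)) (h0 1 (by decide)) (key a17 (l0 1) (by decide))
    · exact isMonoConsStep_rotate (by decide) (by decide) (by decide) (by decide)
        (h0 18 (by decide)) (h0 17 (by decide)) (key a18 (l0 17) (by decide))
    · exact isMonoConsStep_center (by decide) (by decide) (by decide) (List.Perm.swap _ _ _)
        (by rw [vdist_twelve hsub hsup, vdist_zero hsub hsup]; decide) (h0 18 (by decide))
        (key' b18 (l12 0) (by decide))
    · exact isMonoConsStep_rotate (by decide) (by decide) (by decide) (by decide)
        (h12 16 (by decide)) (h12 18 (by decide)) (key b16 (l12 18) (by decide))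
    · exact isMonoConsStep_rotate (by decide) (by decide) (by decide) (by decide)
        (h12 13 (by decide)) (h12 16 (by decide)) (key b13 (l12 16) (by decide))
    · exact isMonoConsStep_rotate (by decide) (by decide) (by decide) (by decide)
        (h12 7 (by decide)) (h12 13 (by decide)) (key b7 (l12 13) (by decide))
    · exact isMonoConsStep_center (by decide) (by decide) (by decide) (List.Perm.refl _)
        (by rw [vdist_twelve hsub hsup, vdist_eight]; decide) (h12 7 (by decide))
        (key' c12 (l8 7) (by decide))
    · exact isMonoConsStep_rotate (by decide) (by decide) (by decide) (by decide)
        (h8 14 (by decide)) (h8 12 (by decide)) (key c14 (l8 12) (by decide))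
    · exact isMonoConsStep_rotate (by decide) (by decide) (by decide) (by decide)
        (h8 11 (by decide)) (h8 14 (by decide)) (key c11 (l8 14) (by decide))
    · exact isMonoConsStep_last (by decide) (by decide) (by decide)
        (h8 10 (by decide)) (h8 11 (by decide)) (key' c11 (l8 10) (by decide))
        (linkDist_last_lt hsup)
  · decide +kernel

end Sandwich
end ShortcutPath

/-! ### How heads evolve along a conservative path -/

section Heads

variable {V : Type*} [DecidableEq V] {C : PreAbstractSimplicialComplex V} {S : Set V}

theorem isAdmissible_swap_or {v a b : V} (ha : vdist C {v} S ≤ vdist C {a} S)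
    (hb : vdist C {v} S ≤ vdist C {b} S) :
    IsAdmissible C S [v, a, b] ∨ IsAdmissible C S [v, b, a] := by
  rcases le_total (linkDist C S v a) (linkDist C S v b) with h | h
  · exact Or.inl (isAdmissible_triple.2 ⟨ha, hb, h⟩)
  · exact Or.inr (isAdmissible_triple.2 ⟨hb, ha, h⟩)

/-- In a conservative step the first vertex is kept in the facet, and it stays the first vertex
unless it is replaced by a new vertex which is closer to the target set. -/
theorem IsConservativeStep.head_cases {v a b v' a' b' : V} (hnd : [v, a, b].Nodup)
    (hL : IsAdmissible C S [v, a, b]) (h : IsConservativeStep C S [v, a, b] [v', a', b']) :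
    v ∈ [v', a', b'] ∧
      (v' = v ∨ v' ∉ [v, a, b] ∧ vdist C {v'} S < vdist C {v} S) := by
  obtain ⟨⟨x, hx, hdiff⟩, hM, hmax⟩ := h
  obtain rfl : b = x := by simpa using hx
  obtain ⟨hva, hvb, -⟩ := isAdmissible_triple.1 hL
  obtain ⟨hva', hvb', -⟩ := isAdmissible_triple.1 hM
  have hvM : v ∈ [v', a', b'] := by
    by_contra hv
    have : v ∈ [v, a, b].toFinset \ [v', a', b'].toFinset := by
      rw [Finset.mem_sdiff, List.mem_toFinset, List.mem_toFinset]
      exact ⟨by simp, hv⟩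
    rw [hdiff, Finset.mem_singleton] at this
    simp [this] at hnd
  refine ⟨hvM, ?_⟩
  by_cases hv' : v' = v
  · exact Or.inl hv'
  right
  -- Otherwise `v` is still closest in the new facet, so some admissible reordering starts with `v`
  -- and has positive index, contradicting the maximality of an order with index `0`.
  have hlt : vdist C {v'} S < vdist C {v} S := by
    by_contra hge
    rw [not_lt] at hge
    obtain ⟨y, z, hperm, hy, hz⟩ : ∃ y z, [v, y, z].Perm [v', a', b'] ∧
        vdist C {v'} S ≤ vdist C {y} S ∧ vdist C {v'} S ≤ vdist C {z} S := by
      simp only [List.mem_cons, List.not_mem_nil, or_false] at hvM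
      rcases hvM with rfl | rfl | rfl
      · exact absurd rfl hv'
      · exact ⟨v', b', List.Perm.swap _ _ _, le_rfl, hvb'⟩
      · exact ⟨v', a', (List.perm_append_comm (l₁ := [v]) (l₂ := [v', a'])), le_rfl, hva'⟩
    have h0 : stepIndex [v, a, b] [v', a', b'] = 0 := by simp [stepIndex, Ne.symm hv']
    rcases isAdmissible_swap_or (hge.trans hy) (hge.trans hz) with hadm | hadm
    · have := hmax _ hperm hadm
      rw [h0] at this
      simp [stepIndex] at this
    · have := hmax _ ((List.Perm.cons _ (List.Perm.swap _ _ _)).trans hperm) hadm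
      rw [h0] at this
      simp [stepIndex] at this
  -- A vertex strictly closer than `v` cannot have been in the old facet, where `v` was a closest
  -- one.
  refine ⟨fun hmem => ?_, hlt⟩
  simp only [List.mem_cons, List.not_mem_nil, or_false] at hmem
  rcases hmem with rfl | rfl | rfl
  exacts [hv' rfl, hlt.not_ge hva, hlt.not_ge hvb]

theorem exists_triple_of_isOrderedFacet {T : Finset (Finset V)} (hT : ∀ t ∈ T, t.card = 3)
    {L : List V} (h : IsOrderedFacet (ofTriangles T) L) : ∃ v a b, L = [v, a, b] := by
  have h1 := hT _ ((isFacet_ofTriangles hT).1 h.2)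
  rw [List.toFinset_card_of_nodup h.1] at h1
  exact List.length_eq_three.1 h1

/-- The first vertices of the facets of a monotone conservative path. -/
theorem IsMonotoneConservativePath.exists_heads {T : Finset (Finset V)}
    (hT : ∀ t ∈ T, t.card = 3) {F G : Finset V} {N : ℕ} {Γ : Fin (N + 1) → List V}
    (h : IsMonotoneConservativePath (ofTriangles T) S F G N Γ) :
    ∃ c : Fin (N + 1) → V, (∀ i, c i ∈ (Γ i).toFinset) ∧
      (∀ i, ∀ u ∈ (Γ i).toFinset, vdist (ofTriangles T) {c i} S ≤ vdist (ofTriangles T) {u} S) ∧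
      ∀ i : Fin N, c i.castSucc ∈ (Γ i.succ).toFinset ∧ (c i.succ = c i.castSucc ∨
        c i.succ ∉ (Γ i.castSucc).toFinset ∧ vdist (ofTriangles T) {c i.succ} S <
          vdist (ofTriangles T) {c i.castSucc} S) := by
  have hadm : ∀ i, IsAdmissible (ofTriangles T) S (Γ i) := by
    intro i
    refine Fin.cases h.conservative.1 (fun i => ?_) i
    exact (h.conservative.2 i).2.1
  choose c a b habc using fun i => exists_triple_of_isOrderedFacet hT (h.path.orderedFacet i)
  refine ⟨c, fun i => by simp [habc i], fun i u hu => ?_, fun i => ?_⟩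
  · have := hadm i
    rw [habc i, isAdmissible_triple] at this
    rw [habc i] at hu
    simp only [List.mem_toFinset, List.mem_cons, List.not_mem_nil, or_false] at hu
    rcases hu with rfl | rfl | rfl
    exacts [le_rfl, this.1, this.2.1]
  · have h1 := hadm i.castSucc
    have h2 := h.conservative.2 i
    have h3 := (h.path.orderedFacet i.castSucc).1
    rw [habc i.castSucc, habc i.succ] at h2
    rw [habc i.castSucc] at h1 h3
    have := h2.head_cases h3 h1
    rw [habc i.castSucc, habc i.succ]
    simpa only [List.mem_toFinset] using this

end Heads

/-! ### The unique shortest dual path is not conservative -/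

section ShortcutDual

variable {T : Finset (Finset (Fin 20))}

/-- The unique shortest path from `{0, 1, 2}` to `{8, 10, 11}` in the dual graph. -/
def shortcutStrip : Fin 10 → Finset (Fin 20) :=
  ![{0, 1, 2}, {0, 2, 3}, {0, 3, 4}, {0, 4, 5}, {4, 5, 6}, {4, 6, 7}, {6, 7, 8}, {6, 8, 9},
    {8, 9, 10}, {8, 10, 11}]

/-- The fourth entry of the list is a potential on the dual graph, bounding the remaining length of
any path to the target from below. -/
theorem dualDist_lipschitz : ∀ x ∈ shortcutList, ∀ y ∈ shortcutList,
    (entrySet x \ entrySet y).card = 1 → y.2.2.2 ≤ x.2.2.2 + 1 := by decide +kernel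

/-- From each facet of the strip only one neighbour leaves the target reachable within a total
length of `9`. -/
theorem strip_unique : ∀ i : Fin 9, ∀ y ∈ shortcutList, y.2.2.2 + i.val + 1 ≤ 9 →
    (shortcutStrip i.castSucc \ entrySet y).card = 1 → entrySet y = shortcutStrip i.succ := by
  decide +kernel

theorem exists_entry_of_path (hsub : T ⊆ shortcutTriangles) {N : ℕ} {Δ : Fin (N + 1) → Finset (Fin 20)}
    (hadj : ∀ i : Fin N, (dualGraph (ofTriangles T)).Adj (Δ i.castSucc) (Δ i.succ))
    (hG : Δ (Fin.last N) = {8, 10, 11}) (i : Fin (N + 1)) :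
    ∃ x ∈ shortcutList, entrySet x = Δ i ∧ x.2.2.2 + i.val ≤ N := by
  have hT : ∀ t ∈ T, t.card = 3 := fun t ht => shortcut_card t (hsub ht)
  induction i using Fin.reverseInduction with
  | last => exact ⟨(8, 11, 10, 0), by decide, by rw [hG]; decide, by simp⟩
  | cast i ih =>
    obtain ⟨x, hx, hxi, hle⟩ := ih
    obtain ⟨h1, -, -⟩ := (dualGraph_adj_ofTriangles hT).1 (hadj i)
    obtain ⟨-, -, h2⟩ := (dualGraph_adj_ofTriangles hT).1 (hadj i).symm
    obtain ⟨y, hy, hyi⟩ := mem_shortcutTriangles.1 (hsub h1)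
    refine ⟨y, hy, hyi, ?_⟩
    rw [← hxi, ← hyi] at h2
    have := dualDist_lipschitz x hx y hy h2
    simp only [Fin.val_succ, Fin.val_castSucc] at hle ⊢
    omega

/-- A path of length at most `9` in the dual graph from `{0, 1, 2}` to `{8, 10, 11}` is the
strip. -/
theorem eq_strip_of_path (hsub : T ⊆ shortcutTriangles) {N : ℕ} (hN : N ≤ 9)
    {Δ : Fin (N + 1) → Finset (Fin 20)}
    (hadj : ∀ i : Fin N, (dualGraph (ofTriangles T)).Adj (Δ i.castSucc) (Δ i.succ))
    (hF : Δ 0 = {0, 1, 2}) (hG : Δ (Fin.last N) = {8, 10, 11}) :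
    ∃ h : N = 9, ∀ i : Fin 10, Δ (i.cast (by rw [h])) = shortcutStrip i := by
  have hT : ∀ t ∈ T, t.card = 3 := fun t ht => shortcut_card t (hsub ht)
  have hent := exists_entry_of_path hsub hadj hG
  obtain rfl : N = 9 := by
    obtain ⟨x, hx, hxF, hle⟩ := hent 0
    have h9 : ∀ x ∈ shortcutList, entrySet x = {0, 1, 2} → x.2.2.2 = 9 := by decide +kernel
    rw [h9 x hx (hxF.trans hF)] at hle
    omega
  refine ⟨rfl, fun i => ?_⟩
  rw [Fin.cast_refl, id]
  induction i using Fin.induction with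
  | zero => exact hF
  | succ i ih =>
    obtain ⟨x, hx, hxi, hle⟩ := hent i.succ
    have h2 := ((dualGraph_adj_ofTriangles hT).1 (hadj i)).2.2
    rw [ih, ← hxi] at h2
    rw [← hxi]
    exact strip_unique i x hx (by simpa [add_assoc] using hle) h2

/-- Adjacency of vertices in the sphere with vertex `19` deleted. -/
def ShortcutAdj (u w : Fin 20) : Prop :=
  ∃ x ∈ shortcutList, 19 ∉ entrySet x ∧ u ∈ entrySet x ∧ w ∈ entrySet x

instance (u w : Fin 20) : Decidable (ShortcutAdj u w) :=
  inferInstanceAs (Decidable (∃ x ∈ shortcutList, _))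

/-- The head survives in the next facet, and a change of head must bring in the newly added vertex
with a strict decrease of `d`. The strip turns so often that `d` drops more than the short
connection through `12` permits. -/
theorem no_heads_in_strip_nat {d : Fin 20 → ℕ} (hd : ∀ u w, ShortcutAdj u w → d u ≤ d w + 1)
    {c : Fin 10 → Fin 20} (hmem : ∀ i, c i ∈ shortcutStrip i)
    (hmin : ∀ i, ∀ u ∈ shortcutStrip i, d (c i) ≤ d u)
    (hstep : ∀ i : Fin 9, c i.castSucc ∈ shortcutStrip i.succ ∧ (c i.succ = c i.castSucc ∨
      c i.succ ∉ shortcutStrip i.castSucc ∧ d (c i.succ) < d (c i.castSucc))) : False := by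
  -- The shortcut outside the strip: `0, 12, 8, 10` bounds `d 0` by `d 8 + 2` and by `d 10 + 3`.
  have e1 := hd 0 12 (by decide +kernel)
  have e2 := hd 12 8 (by decide +kernel)
  have e3 := hd 8 10 (by decide +kernel)
  -- Each head is one of the two vertices that its facet shares with the next.
  have h0 : c 0 = 0 ∨ c 0 = 2 := by
    have : ∀ x ∈ shortcutStrip 0, x ∈ shortcutStrip 1 → x = 0 ∨ x = 2 := by decide
    exact this _ (hmem 0) (hstep 0).1
  have h1 : c 1 = 0 ∨ c 1 = 3 := by
    have : ∀ x ∈ shortcutStrip 1, x ∈ shortcutStrip 2 → x = 0 ∨ x = 3 := by decide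
    exact this _ (hmem 1) (hstep 1).1
  have h2 : c 2 = 0 ∨ c 2 = 4 := by
    have : ∀ x ∈ shortcutStrip 2, x ∈ shortcutStrip 3 → x = 0 ∨ x = 4 := by decide
    exact this _ (hmem 2) (hstep 2).1
  have h3 : c 3 = 4 ∨ c 3 = 5 := by
    have : ∀ x ∈ shortcutStrip 3, x ∈ shortcutStrip 4 → x = 4 ∨ x = 5 := by decide
    exact this _ (hmem 3) (hstep 3).1
  have h4 : c 4 = 4 ∨ c 4 = 6 := by
    have : ∀ x ∈ shortcutStrip 4, x ∈ shortcutStrip 5 → x = 4 ∨ x = 6 := by decide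
    exact this _ (hmem 4) (hstep 4).1
  have h5 : c 5 = 6 ∨ c 5 = 7 := by
    have : ∀ x ∈ shortcutStrip 5, x ∈ shortcutStrip 6 → x = 6 ∨ x = 7 := by decide
    exact this _ (hmem 5) (hstep 5).1
  have h6 : c 6 = 6 ∨ c 6 = 8 := by
    have : ∀ x ∈ shortcutStrip 6, x ∈ shortcutStrip 7 → x = 6 ∨ x = 8 := by decide
    exact this _ (hmem 6) (hstep 6).1
  have h7 : c 7 = 8 ∨ c 7 = 9 := by
    have : ∀ x ∈ shortcutStrip 7, x ∈ shortcutStrip 8 → x = 8 ∨ x = 9 := by decide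
    exact this _ (hmem 7) (hstep 7).1
  have h8 : c 8 = 8 ∨ c 8 = 10 := by
    have : ∀ x ∈ shortcutStrip 8, x ∈ shortcutStrip 9 → x = 8 ∨ x = 10 := by decide
    exact this _ (hmem 8) (hstep 8).1
  have s0 : c 1 = c 0 ∨ c 1 ∉ shortcutStrip 0 ∧ d (c 1) < d (c 0) := (hstep 0).2
  have s1 : c 2 = c 1 ∨ c 2 ∉ shortcutStrip 1 ∧ d (c 2) < d (c 1) := (hstep 1).2
  have s2 : c 3 = c 2 ∨ c 3 ∉ shortcutStrip 2 ∧ d (c 3) < d (c 2) := (hstep 2).2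
  have s3 : c 4 = c 3 ∨ c 4 ∉ shortcutStrip 3 ∧ d (c 4) < d (c 3) := (hstep 3).2
  have s4 : c 5 = c 4 ∨ c 5 ∉ shortcutStrip 4 ∧ d (c 5) < d (c 4) := (hstep 4).2
  have s5 : c 6 = c 5 ∨ c 6 ∉ shortcutStrip 5 ∧ d (c 6) < d (c 5) := (hstep 5).2
  have s6 : c 7 = c 6 ∨ c 7 ∉ shortcutStrip 6 ∧ d (c 7) < d (c 6) := (hstep 6).2
  have s7 : c 8 = c 7 ∨ c 8 ∉ shortcutStrip 7 ∧ d (c 8) < d (c 7) := (hstep 7).2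
  have m0 := hmin 0 0 (by decide)
  have m1 := hmin 1 0 (by decide)
  have m2 := hmin 2 0 (by decide)
  have m3 := hmin 3 0 (by decide)
  have m6 := hmin 6 8 (by decide)
  have m7 := hmin 7 8 (by decide)
  have first : d 4 + 1 ≤ d 0 ∧ c 3 = 4 ∨ d 5 + 1 ≤ d 0 ∧ c 3 = 5 := by
    rcases h0 with h0 | h0 <;> rcases h1 with h1 | h1 <;>
      simp [h0, h1, shortcutStrip] at s0 m0 m1 <;>
      rcases h2 with h2 | h2 <;> simp [h1, h2, shortcutStrip] at s1 m2 <;>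
      rcases h3 with h3 | h3 <;> simp [h2, h3, shortcutStrip] at s2 ⊢ <;> omega
  have second : d 6 + 2 ≤ d 0 ∧ c 5 = 6 ∨ d 7 + 2 ≤ d 0 ∧ c 5 = 7 := by
    rcases first with ⟨hd4, h3⟩ | ⟨hd4, h3⟩ <;>
      rcases h4 with h4 | h4 <;> simp [h3, h4, shortcutStrip] at s3 <;>
      rcases h5 with h5 | h5 <;> simp [h4, h5, shortcutStrip] at s4 ⊢ <;> omega
  -- Two decreases have occurred. Moving directly to `8` is a third one; the detour from `6` through
  -- `9` to `10` makes four in all.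
  rcases second with ⟨hd6, h5⟩ | ⟨hd6, h5⟩ <;>
    rcases h6 with h6 | h6 <;> simp [h5, h6, shortcutStrip] at s5 m6 <;>
    rcases h7 with h7 | h7 <;> simp [h6, h7, shortcutStrip] at s6 m7 <;>
    rcases h8 with h8 | h8 <;> simp [h7, h8, shortcutStrip] at s7 <;> omega

/-- Along the strip the first vertices would have to come closer to the target set by three, while
the vertices `0` and `8` have a common neighbour. -/
theorem no_heads_in_strip {δ : Fin 20 → ℕ∞} (hδ : ∀ u w, ShortcutAdj u w → δ u ≤ δ w + 1)
    {c : Fin 10 → Fin 20} (hmem : ∀ i, c i ∈ shortcutStrip i)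
    (hmin : ∀ i, ∀ u ∈ shortcutStrip i, δ (c i) ≤ δ u)
    (hstep : ∀ i : Fin 9, c i.castSucc ∈ shortcutStrip i.succ ∧ (c i.succ = c i.castSucc ∨
      c i.succ ∉ shortcutStrip i.castSucc ∧ δ (c i.succ) < δ (c i.castSucc))) : False := by
  have hsymm : ∀ u w, ShortcutAdj u w → ShortcutAdj w u :=
    fun u w ⟨x, hx, h1, h2, h3⟩ => ⟨x, hx, h1, h3, h2⟩
  have htop : ∀ u w, ShortcutAdj u w → (δ u = ⊤ ↔ δ w = ⊤) := by
    have : ∀ u w, ShortcutAdj u w → δ u = ⊤ → δ w = ⊤ := by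
      intro u w h hu
      have := hδ u w h
      rw [hu, top_le_iff] at this
      simpa using this
    exact fun u w h => ⟨this u w h, this w u (hsymm u w h)⟩
  have hall : ∀ u, u ≠ 19 → (δ u = ⊤ ↔ δ 0 = ⊤) := by
    have hconn : ∀ u : Fin 20, u ≠ 19 → ∃ v w z, ShortcutAdj u v ∧ ShortcutAdj v w ∧
        ShortcutAdj w z ∧ ShortcutAdj z 0 := by decide +kernel
    intro u hu
    obtain ⟨v, w, z, h1, h2, h3, h4⟩ := hconn u hu
    rw [htop u v h1, htop v w h2, htop w z h3, htop z 0 h4]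
  have h19 : ∀ i, ∀ u ∈ shortcutStrip i, u ≠ 19 := by decide
  -- By connectedness either all distances are infinite or none is. If all are, no strict decrease
  -- is possible and the head stays constant, although the first and last facets are disjoint.
  by_cases h0 : δ 0 = ⊤
  · have hconst : ∀ i, c i = c 0 := by
      intro i
      induction i using Fin.induction with
      | zero => rfl
      | succ i ih =>
        rcases (hstep i).2 with h | ⟨-, h⟩
        · exact h.trans ih
        · rw [(hall _ (h19 _ _ (hmem i.succ))).2 h0] at h
          exact absurd h not_top_lt
    have hdisj : ∀ u ∈ shortcutStrip 9, u ∉ shortcutStrip 0 := by decide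
    exact hdisj (c 9) (hmem 9) (hconst 9 ▸ hmem 0)
  · have hfin : ∀ u, u ≠ 19 → ((δ u).toNat : ℕ∞) = δ u := fun u hu =>
      ENat.natCast_toNat fun h => h0 ((hall u hu).1 h)
    have hadj19 : ∀ u w : Fin 20, ShortcutAdj u w → u ≠ 19 ∧ w ≠ 19 := by
      rintro u w ⟨x, -, h1, h2, h3⟩
      exact ⟨fun h => h1 (h ▸ h2), fun h => h1 (h ▸ h3)⟩
    refine no_heads_in_strip_nat (d := fun u => (δ u).toNat) (fun u w h => ?_) hmem
      (fun i u hu => ?_) fun i => ⟨(hstep i).1, (hstep i).2.imp_right fun h => ⟨h.1, ?_⟩⟩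
    · have := hδ u w h
      rw [← hfin u (hadj19 u w h).1, ← hfin w (hadj19 u w h).2] at this
      exact_mod_cast this
    · have := hmin i u hu
      rw [← hfin _ (h19 i u hu), ← hfin _ (h19 i _ (hmem i))] at this
      exact_mod_cast this
    · have := h.2
      rw [← hfin _ (h19 _ _ (hmem i.succ)), ← hfin _ (h19 _ _ (hmem i.castSucc))] at this
      exact_mod_cast this

/-- There is a path of length `9` in the dual graph. -/
theorem dist_shortcut_le (hsub : T ⊆ shortcutTriangles)
    (hsup : shortcutTriangles.filter (19 ∉ ·) ⊆ T) :
    (dualGraph (ofTriangles T)).dist {0, 1, 2} {8, 10, 11} ≤ 9 := by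
  have hT : ∀ t ∈ T, t.card = 3 := fun t ht => shortcut_card t (hsub ht)
  have hmem : ∀ i, ∃ x ∈ shortcutList, 19 ∉ entrySet x ∧ entrySet x = shortcutStrip i := by
    decide +kernel
  have hmemT : ∀ i, shortcutStrip i ∈ T := fun i => by
    obtain ⟨x, hx, h1, h2⟩ := hmem i
    exact hsup (Finset.mem_filter.2 ⟨mem_shortcutTriangles.2 ⟨x, hx, h2⟩, h2 ▸ h1⟩)
  have hcard : ∀ i : Fin 9, (shortcutStrip i.castSucc \ shortcutStrip i.succ).card = 1 := by
    decide +kernel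
  have hwalk : ∀ i : Fin 10, ∃ p : (dualGraph (ofTriangles T)).Walk (shortcutStrip 0)
      (shortcutStrip i), p.length = i.val := by
    intro i
    induction i using Fin.induction with
    | zero => exact ⟨SimpleGraph.Walk.nil, rfl⟩
    | succ i ih =>
      obtain ⟨p, hp⟩ := ih
      exact ⟨p.concat ((dualGraph_adj_ofTriangles hT).2 ⟨hmemT _, hmemT _, hcard i⟩),
        by simp [hp]⟩
  obtain ⟨p, hp⟩ := hwalk (Fin.last 9)
  exact (SimpleGraph.dist_le p).trans hp.le

theorem hasNoShortestMonotoneConservativePath_shortcut (hsub : T ⊆ shortcutTriangles)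
    (hsup : shortcutTriangles.filter (19 ∉ ·) ⊆ T) :
    HasNoShortestMonotoneConservativePath (ofTriangles T) := by
  have hT : ∀ t ∈ T, t.card = 3 := fun t ht => shortcut_card t (hsub ht)
  refine ⟨{0, 1, 2}, {8, 10, 11},
    (isFacet_ofTriangles hT).2 (mem_of_deletion_subset hsup (by decide +kernel)),
    (isFacet_ofTriangles hT).2 (mem_of_deletion_subset hsup (by decide +kernel)),
    exists_path_shortcut hsub hsup, ?_⟩
  intro S _ _ N Γ hΓ
  by_contra hlt
  rw [not_lt] at hlt
  -- A path no longer than the dual distance has length at most `9`, so it is the strip.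
  obtain ⟨rfl, hstrip⟩ := eq_strip_of_path hsub (hlt.trans (dist_shortcut_le hsub hsup))
    (Δ := fun i => (Γ i).toFinset) hΓ.path.adj hΓ.start hΓ.finish
  have hstrip : ∀ i, (Γ i).toFinset = shortcutStrip i := hstrip
  obtain ⟨c, h1, h2, h3⟩ := hΓ.exists_heads hT
  simp only [hstrip] at h1 h2 h3
  refine no_heads_in_strip (δ := fun u => vdist (ofTriangles T) {u} S) ?_ h1 h2 h3
  rintro u w ⟨x, hx, h19, hu, hw⟩
  by_cases huw : u = w
  · rw [huw]; exact le_self_add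
  · exact vdist_le_add_one_of_adj (skeletonGraph_adj_ofTriangles.2 ⟨huw, entrySet x,
      hsup (Finset.mem_filter.2 ⟨mem_shortcutTriangles.2 ⟨x, hx, rfl⟩, h19⟩), hu, hw⟩)

end ShortcutDual

/-! ### The family of spheres for the length gap: combinatorics -/

section Family

/-- The sorted triangles of the bipyramid-like sphere: the cycle `0, …, 2n - 1` is coned by `2n` on
one side; on the other side `0, …, n` is coned by `2n + 1` and `n, …, 2n - 1, 0` by `2n + 2`. -/
def GapTriple (n a b c : ℕ) : Prop :=
  (b = a + 1 ∧ b < 2 * n ∧ c = 2 * n) ∨ (a = 0 ∧ b + 1 = 2 * n ∧ c = 2 * n) ∨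
  (b = a + 1 ∧ b ≤ n ∧ c = 2 * n + 1) ∨ (b = a + 1 ∧ n ≤ a ∧ b < 2 * n ∧ c = 2 * n + 2) ∨
  (a = 0 ∧ b + 1 = 2 * n ∧ c = 2 * n + 2) ∨ (a = 0 ∧ b = 2 * n + 1 ∧ c = 2 * n + 2) ∨
  (a = n ∧ b = 2 * n + 1 ∧ c = 2 * n + 2)

/-- Adjacency of vertices `u < v`. -/
def GapEdge (n u v : ℕ) : Prop :=
  (v < 2 * n ∧ (v = u + 1 ∨ u = 0 ∧ v + 1 = 2 * n)) ∨ v = 2 * n ∨ (v = 2 * n + 1 ∧ u ≤ n) ∨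
  (v = 2 * n + 2 ∧ (n ≤ u ∧ u < 2 * n ∨ u = 0 ∨ u = 2 * n + 1))

/-- Adjacency of vertices. -/
def GapAdj (n u v : ℕ) : Prop := u < v ∧ GapEdge n u v ∨ v < u ∧ GapEdge n v u

open Classical in
/-- The triangles of the sphere. -/
noncomputable def gapTriangles (n : ℕ) : Finset (Finset (Fin (2 * n + 3))) :=
  Finset.univ.filter fun t => ∃ a b c : Fin (2 * n + 3), GapTriple n a b c ∧ t = {a, b, c}

theorem mem_gapTriangles {n : ℕ} {t : Finset (Fin (2 * n + 3))} :
    t ∈ gapTriangles n ↔ ∃ a b c : Fin (2 * n + 3), GapTriple n a b c ∧ t = {a, b, c} := by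
  simp [gapTriangles]

variable {n : ℕ}

theorem GapTriple.lt {a b c : ℕ} (_hn : 3 ≤ n) (h : GapTriple n a b c) :
    a < b ∧ b < c ∧ c < 2 * n + 3 := by
  unfold GapTriple at h
  omega

theorem card_of_mem_gapTriangles (hn : 3 ≤ n) : ∀ t ∈ gapTriangles n, t.card = 3 := by
  intro t ht
  obtain ⟨a, b, c, h, rfl⟩ := mem_gapTriangles.1 ht
  obtain ⟨h1, h2, -⟩ := h.lt hn
  refine Finset.card_eq_three.2 ⟨a, b, c, ?_, ?_, ?_, rfl⟩ <;> rw [Ne, Fin.ext_iff] <;> omega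

theorem gapAdj_of_mem (hn : 3 ≤ n) {s : Finset (Fin (2 * n + 3))} (hs : s ∈ gapTriangles n)
    {u v : Fin (2 * n + 3)} (hu : u ∈ s) (hv : v ∈ s) (huv : u ≠ v) : GapAdj n u v := by
  obtain ⟨a, b, c, h, rfl⟩ := mem_gapTriangles.1 hs
  obtain ⟨h1, h2, -⟩ := h.lt hn
  have hab : GapAdj n a b := by
    unfold GapTriple at h; left; unfold GapEdge; omega
  have hac : GapAdj n a c := by
    unfold GapTriple at h; left; unfold GapEdge; omega
  have hbc : GapAdj n b c := by
    unfold GapTriple at h; left; unfold GapEdge; omega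
  simp only [Finset.mem_insert, Finset.mem_singleton] at hu hv
  rcases hu with rfl | rfl | rfl <;> rcases hv with rfl | rfl | rfl
  exacts [absurd rfl huv, hab, hac, hab.symm, absurd rfl huv, hbc, hac.symm, hbc.symm,
    absurd rfl huv]

/-- The cycle has length `2 * n ≥ 6` and no chords, so a clique of three must contain an apex; the
cases follow its largest vertex. -/
theorem gapTriple_of_edges (hn : 3 ≤ n) {a b c : ℕ} (hab : a < b) (hbc : b < c)
    (h1 : GapEdge n a b) (h2 : GapEdge n a c) (h3 : GapEdge n b c) : GapTriple n a b c := by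
  unfold GapEdge at h1 h2 h3
  have hc : c = 2 * n ∨ c = 2 * n + 1 ∨ c = 2 * n + 2 := by omega
  rcases hc with rfl | rfl | rfl
  · have : b = a + 1 ∧ b < 2 * n ∨ a = 0 ∧ b + 1 = 2 * n := by omega
    exact this.elim (fun h => Or.inl ⟨h.1, h.2, rfl⟩) fun h => Or.inr (Or.inl ⟨h.1, h.2, rfl⟩)
  · have : b = a + 1 ∧ b ≤ n := by omega
    exact Or.inr (Or.inr (Or.inl ⟨this.1, this.2, rfl⟩))
  · have h4 : n ≤ b ∧ b < 2 * n ∨ b = 2 * n + 1 := by omega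
    refine Or.inr (Or.inr (Or.inr ?_))
    rcases h4 with h4 | rfl
    · have : b = a + 1 ∧ n ≤ a ∨ a = 0 ∧ b + 1 = 2 * n := by omega
      exact this.elim (fun h => Or.inl ⟨h.1, h.2, h4.2, rfl⟩)
        fun h => Or.inr (Or.inl ⟨h.1, h.2, rfl⟩)
    · have : a = 0 ∨ a = n := by omega
      exact Or.inr (Or.inr (this.imp (fun h => ⟨h, rfl, rfl⟩) fun h => ⟨h, rfl, rfl⟩))

theorem GapAdj.edge {u v : ℕ} (h : GapAdj n u v) (huv : u < v) : GapEdge n u v := by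
  rcases h with h | h
  · exact h.2
  · omega

theorem GapAdj.symm' {u v : ℕ} (h : GapAdj n u v) : GapAdj n v u := Or.symm h

theorem insert_mem_gapTriangles (hn : 3 ≤ n) {a b c : Fin (2 * n + 3)} (h1 : GapAdj n a b)
    (h2 : GapAdj n a c) (h3 : GapAdj n b c) : {a, b, c} ∈ gapTriangles n := by
  have key : ∀ a b c : Fin (2 * n + 3), a.val < b.val → b.val < c.val → GapAdj n a b →
      GapAdj n a c → GapAdj n b c → {a, b, c} ∈ gapTriangles n := fun a b c hab hbc h1 h2 h3 =>
    mem_gapTriangles.2 ⟨a, b, c, gapTriple_of_edges hn hab hbc (h1.edge hab)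
      (h2.edge (hab.trans hbc)) (h3.edge hbc), rfl⟩
  have hlt : ∀ {u v : ℕ}, GapAdj n u v → u < v ∨ v < u := fun h => h.imp And.left And.left
  rcases hlt h1 with h | h <;> rcases hlt h2 with h' | h' <;> rcases hlt h3 with h'' | h''
  · exact key a b c h h'' h1 h2 h3
  · rw [Finset.pair_comm]
    exact key a c b h' h'' h2 h1 h3.symm'
  · omega
  · rw [Finset.pair_comm, Finset.insert_comm]
    exact key c a b h' h h2.symm' h3.symm' h1
  · rw [Finset.insert_comm]
    exact key b a c h h' h1.symm' h3 h2
  · omega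
  · rw [Finset.insert_comm, Finset.pair_comm]
    exact key b c a h'' h' h3 h1.symm' h2.symm'
  · rw [Finset.insert_comm, Finset.pair_comm, Finset.insert_comm]
    exact key c b a h'' h h3.symm' h2.symm' h1.symm'

theorem noEmptyCliques_gap (hn : 3 ≤ n) : NoEmptyCliques (gapTriangles n) where
  triple := by
    rintro a b c hab hac hbc ⟨t, ht, h1, h2⟩ ⟨s, hs, h3, h4⟩ ⟨r, hr, h5, h6⟩
    exact insert_mem_gapTriangles hn (gapAdj_of_mem hn ht h1 h2 hab)
      (gapAdj_of_mem hn hs h3 h4 hac) (gapAdj_of_mem hn hr h5 h6 hbc)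
  quadruple := by
    intro t ht v hv
    obtain ⟨a, b, c, h, rfl⟩ := mem_gapTriangles.1 ht
    by_contra hcon
    push Not at hcon
    have hadj : ∀ u ∈ ({a, b, c} : Finset (Fin (2 * n + 3))), GapAdj n u v := fun u hu => by
      obtain ⟨s, hs, h1, h2⟩ := hcon u hu
      exact gapAdj_of_mem hn hs h1 h2 fun huv => hv (huv ▸ hu)
    have h1 := hadj a (by simp)
    have h2 := hadj b (by simp)
    have h3 := hadj c (by simp)
    unfold GapAdj GapEdge at h1 h2 h3
    unfold GapTriple at h
    omega

/-- The three conjuncts cross the edges opposite to `c`, `b` and `a`. The case splits occur where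
the cycle closes up and where the apices `2 * n + 1` and `2 * n + 2` meet, at `0` and `n`. -/
theorem exists_gapTriple_across (hn : 3 ≤ n) {a b c : ℕ} (h : GapTriple n a b c) :
    (∃ p q r, GapTriple n p q r ∧ (c ≠ p ∧ c ≠ q ∧ c ≠ r) ∧ (a = p ∨ a = q ∨ a = r) ∧
      (b = p ∨ b = q ∨ b = r)) ∧
    (∃ p q r, GapTriple n p q r ∧ (b ≠ p ∧ b ≠ q ∧ b ≠ r) ∧ (a = p ∨ a = q ∨ a = r) ∧
      (c = p ∨ c = q ∨ c = r)) ∧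
    (∃ p q r, GapTriple n p q r ∧ (a ≠ p ∧ a ≠ q ∧ a ≠ r) ∧ (b = p ∨ b = q ∨ b = r) ∧
      (c = p ∨ c = q ∨ c = r)) := by
  rcases h with ⟨rfl, h, rfl⟩ | ⟨rfl, h, rfl⟩ | ⟨rfl, h, rfl⟩ | ⟨rfl, h, h', rfl⟩ |
    ⟨rfl, h, rfl⟩ | ⟨rfl, rfl, rfl⟩ | ⟨rfl, rfl, rfl⟩
  · refine ⟨?_, ?_, ?_⟩
    · by_cases hb : a + 1 ≤ n
      · exact ⟨a, a + 1, 2 * n + 1, by unfold GapTriple; omega, by omega, by omega, by omega⟩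
      · exact ⟨a, a + 1, 2 * n + 2, by unfold GapTriple; omega, by omega, by omega, by omega⟩
    · by_cases ha : a = 0
      · exact ⟨0, 2 * n - 1, 2 * n, by unfold GapTriple; omega, by omega, by omega, by omega⟩
      · exact ⟨a - 1, a, 2 * n, by unfold GapTriple; omega, by omega, by omega, by omega⟩
    · by_cases ha : a + 2 < 2 * n
      · exact ⟨a + 1, a + 2, 2 * n, by unfold GapTriple; omega, by omega, by omega, by omega⟩
      · exact ⟨0, 2 * n - 1, 2 * n, by unfold GapTriple; omega, by omega, by omega, by omega⟩
  · exact ⟨⟨0, 2 * n - 1, 2 * n + 2, by unfold GapTriple; omega, by omega, by omega, by omega⟩,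
      ⟨0, 1, 2 * n, by unfold GapTriple; omega, by omega, by omega, by omega⟩,
      ⟨2 * n - 2, 2 * n - 1, 2 * n, by unfold GapTriple; omega, by omega, by omega, by omega⟩⟩
  · refine ⟨⟨a, a + 1, 2 * n, by unfold GapTriple; omega, by omega, by omega, by omega⟩, ?_, ?_⟩
    · by_cases ha : a = 0
      · exact ⟨0, 2 * n + 1, 2 * n + 2, by unfold GapTriple; omega, by omega, by omega, by omega⟩
      · exact ⟨a - 1, a, 2 * n + 1, by unfold GapTriple; omega, by omega, by omega, by omega⟩
    · by_cases ha : a + 1 = n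
      · exact ⟨n, 2 * n + 1, 2 * n + 2, by unfold GapTriple; omega, by omega, by omega, by omega⟩
      · exact ⟨a + 1, a + 2, 2 * n + 1, by unfold GapTriple; omega, by omega, by omega, by omega⟩
  · refine ⟨⟨a, a + 1, 2 * n, by unfold GapTriple; omega, by omega, by omega, by omega⟩, ?_, ?_⟩
    · by_cases ha : a = n
      · exact ⟨n, 2 * n + 1, 2 * n + 2, by unfold GapTriple; omega, by omega, by omega, by omega⟩
      · exact ⟨a - 1, a, 2 * n + 2, by unfold GapTriple; omega, by omega, by omega, by omega⟩
    · by_cases ha : a + 2 = 2 * n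
      · exact ⟨0, 2 * n - 1, 2 * n + 2, by unfold GapTriple; omega, by omega, by omega, by omega⟩
      · exact ⟨a + 1, a + 2, 2 * n + 2, by unfold GapTriple; omega, by omega, by omega, by omega⟩
  · exact ⟨⟨0, 2 * n - 1, 2 * n, by unfold GapTriple; omega, by omega, by omega, by omega⟩,
      ⟨0, 2 * n + 1, 2 * n + 2, by unfold GapTriple; omega, by omega, by omega, by omega⟩,
      ⟨2 * n - 2, 2 * n - 1, 2 * n + 2, by unfold GapTriple; omega, by omega, by omega, by omega⟩⟩
  · exact ⟨⟨0, 1, 2 * n + 1, by unfold GapTriple; omega, by omega, by omega, by omega⟩,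
      ⟨0, 2 * n - 1, 2 * n + 2, by unfold GapTriple; omega, by omega, by omega, by omega⟩,
      ⟨n, 2 * n + 1, 2 * n + 2, by unfold GapTriple; omega, by omega, by omega, by omega⟩⟩
  · exact ⟨⟨a - 1, a, 2 * a + 1, by unfold GapTriple; omega, by omega, by omega, by omega⟩,
      ⟨a, a + 1, 2 * a + 2, by unfold GapTriple; omega, by omega, by omega, by omega⟩,
      ⟨0, 2 * a + 1, 2 * a + 2, by unfold GapTriple; omega, by omega, by omega, by omega⟩⟩

theorem gapTriangles_edge (hn : 3 ≤ n) : ∀ t ∈ gapTriangles n, ∀ v ∈ t, ∃ s ∈ gapTriangles n,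
    v ∉ s ∧ t.erase v ⊆ s := by
  intro t ht v hv
  obtain ⟨a, b, c, h, rfl⟩ := mem_gapTriangles.1 ht
  have key : ∀ u w : Fin (2 * n + 3), (∀ x ∈ ({a, b, c} : Finset (Fin (2 * n + 3))), x ≠ v →
      x = u ∨ x = w) → (∃ p q r, GapTriple n p q r ∧ (v.val ≠ p ∧ v.val ≠ q ∧ v.val ≠ r) ∧
      (u.val = p ∨ u.val = q ∨ u.val = r) ∧ (w.val = p ∨ w.val = q ∨ w.val = r)) →
      ∃ s ∈ gapTriangles n, v ∉ s ∧ ({a, b, c} : Finset (Fin (2 * n + 3))).erase v ⊆ s := by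
    rintro u w huw ⟨p, q, r, hpqr, hv, hu, hw⟩
    obtain ⟨h1, h2, h3⟩ := hpqr.lt hn
    refine ⟨{⟨p, by omega⟩, ⟨q, by omega⟩, ⟨r, h3⟩}, mem_gapTriangles.2 ⟨_, _, _, hpqr, rfl⟩,
      by simpa [Fin.ext_iff] using hv, fun x hx => ?_⟩
    obtain ⟨hxv, hx⟩ := Finset.mem_erase.1 hx
    rcases huw x hx hxv with rfl | rfl
    · simpa [Fin.ext_iff] using hu
    · simpa [Fin.ext_iff] using hw
  obtain ⟨hc, hb, ha⟩ := exists_gapTriple_across hn h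
  simp only [Finset.mem_insert, Finset.mem_singleton] at hv
  rcases hv with rfl | rfl | rfl
  · exact key b c (by simp) ha
  · exact key a c (by simp) hb
  · exact key a b (by simp) hc

theorem gapTriangles_covers (hn : 3 ≤ n) (v : Fin (2 * n + 3)) : ∃ t ∈ gapTriangles n, v ∈ t := by
  obtain ⟨p, q, r, h, hv⟩ : ∃ p q r, GapTriple n p q r ∧
      (v.val = p ∨ v.val = q ∨ v.val = r) := by
    have := v.2
    by_cases h1 : v.val + 1 < 2 * n
    · exact ⟨v, v + 1, 2 * n, by unfold GapTriple; omega, by omega⟩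
    by_cases h2 : v.val ≤ 2 * n
    · exact ⟨0, 2 * n - 1, 2 * n, by unfold GapTriple; omega, by omega⟩
    · exact ⟨0, 2 * n + 1, 2 * n + 2, by unfold GapTriple; omega, by omega⟩
  obtain ⟨h1, h2, h3⟩ := h.lt hn
  exact ⟨{⟨p, by omega⟩, ⟨q, by omega⟩, ⟨r, h3⟩}, mem_gapTriangles.2 ⟨_, _, _, h, rfl⟩,
    by simpa [Fin.ext_iff] using hv⟩

end Family

/-! ### The family of spheres for the length gap: convex realization -/

section FamilyCoordinates

/-- Coordinates of a polytope with facets `gapTriangles n`. -/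
def gapCoords (n j : ℕ) : Fin 3 → ℤ :=
  if j ≤ n then ![2 * j - n, 4 * j * (n - j), 0]
  else if j < 2 * n then ![3 * n - 2 * j, -(4 * (2 * n - j) * (j - n)), 0]
  else if j = 2 * n then ![0, 0, 1]
  else if j = 2 * n + 1 then ![0, 2 * n ^ 2, -3]
  else ![0, -(2 * n ^ 2), -3]

variable {n : ℕ}

/-- The gap between a parabola and its chord through neighbouring lattice points is a multiple of `m
* (m - 1)`; integrality makes it vanish only at the two ends of the chord. -/
theorem mul_sub_one_pos {m : ℤ} (h0 : m ≠ 0) (h1 : m ≠ 1) : 0 < m * (m - 1) := by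
  rcases lt_or_gt_of_ne h0 with h | h
  · nlinarith
  · have : 2 ≤ m := by omega
    nlinarith

theorem mul_sub_one_nonneg (m : ℤ) : 0 ≤ m * (m - 1) := by
  by_cases h0 : m = 0
  · simp [h0]
  by_cases h1 : m = 1
  · simp [h1]
  · exact (mul_sub_one_pos h0 h1).le

/-- A linear functional in the plane supporting the polygon `0, …, 2n - 1` at an edge. -/
theorem exists_supporting_edge (hn : 3 ≤ n) {i : ℕ} (hi : i < 2 * n) : ∃ u σ : ℤ,
    (σ = 1 ∧ i < n ∨ σ = -1 ∧ n ≤ i) ∧ ∀ j < 2 * n,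
      gapCoords n j 2 = 0 ∧
      (j = i ∨ j = i + 1 ∨ i + 1 = 2 * n ∧ j = 0 →
        (2 * u + 2) * gapCoords n j 0 + σ * gapCoords n j 1 = n ^ 2 - 1 + (u + 1) ^ 2) ∧
      (¬ (j = i ∨ j = i + 1 ∨ i + 1 = 2 * n ∧ j = 0) →
        (2 * u + 2) * gapCoords n j 0 + σ * gapCoords n j 1 < n ^ 2 - 1 + (u + 1) ^ 2) := by
  by_cases hin : i < n
  -- The polygon lies between the parabolas `y = n ^ 2 - x ^ 2` and `y = -(n ^ 2 - x ^ 2)`, with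
  -- vertices at abscissas in steps of `2`. Here `u` is the left abscissa of the edge and `σ` tells
  -- the parabola. The slack is `(x - u) * (x - u - 2)` on the same parabola, and on the other one
  -- there is an additional `2 * (n ^ 2 - x ^ 2)`.
  · refine ⟨2 * i - n, 1, Or.inl ⟨rfl, hin⟩, fun j hj => ?_⟩
    by_cases hjn : j ≤ n
    · have e : ((n : ℤ) ^ 2 - 1 + (2 * i - n + 1) ^ 2) -
          ((2 * (2 * i - n) + 2) * (2 * j - n) + 1 * (4 * j * (n - j))) =
          4 * (((j : ℤ) - i) * (j - i - 1)) := by ring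
      simp only [gapCoords, if_pos hjn, Matrix.cons_val]
      refine ⟨trivial, fun h => ?_, fun h => ?_⟩
      · have : (j : ℤ) - i = 0 ∨ (j : ℤ) - i - 1 = 0 := by omega
        rw [mul_eq_zero.2 this] at e
        linarith
      · have := mul_sub_one_pos (m := (j : ℤ) - i) (by omega) (by omega)
        linarith
    · have e : ((n : ℤ) ^ 2 - 1 + (2 * i - n + 1) ^ 2) -
          ((2 * (2 * i - n) + 2) * (3 * n - 2 * j) + 1 * (-(4 * (2 * n - j) * (j - n)))) =
          4 * ((2 * (n : ℤ) - j - i) * (2 * n - j - i - 1)) +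
          8 * ((2 * (n : ℤ) - j) * (j - n)) := by ring
      simp only [gapCoords, if_neg hjn, if_pos hj, Matrix.cons_val]
      refine ⟨trivial, fun h => by omega, fun _ => ?_⟩
      have h1 := mul_sub_one_nonneg (2 * (n : ℤ) - j - i)
      have h2 : 0 < (2 * (n : ℤ) - j) * (j - n) := mul_pos (by omega) (by omega)
      linarith
  -- On the lower parabola labels run from right to left, so the left end of the edge has label `i +
  -- 1`.
  · refine ⟨3 * n - 2 * i - 2, -1, Or.inr ⟨rfl, by omega⟩, fun j hj => ?_⟩
    by_cases hjn : j ≤ n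
    · have e : ((n : ℤ) ^ 2 - 1 + (3 * n - 2 * i - 2 + 1) ^ 2) -
          ((2 * (3 * n - 2 * i - 2) + 2) * (2 * j - n) + -1 * (4 * j * (n - j))) =
          4 * (((j : ℤ) - 2 * n + i + 1) * (j - 2 * n + i + 1 - 1)) +
          8 * (j * ((n : ℤ) - j)) := by ring
      simp only [gapCoords, if_pos hjn, Matrix.cons_val]
      refine ⟨trivial, fun h => ?_, fun h => ?_⟩
      · have h1 : (j : ℤ) - 2 * n + i + 1 = 0 ∨ (j : ℤ) - 2 * n + i + 1 - 1 = 0 := by omega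
        have h2 : (j : ℤ) = 0 ∨ (n : ℤ) - j = 0 := by omega
        rw [mul_eq_zero.2 h1, mul_eq_zero.2 h2] at e
        linarith
      · by_cases hj0 : j = 0 ∨ j = n
        · have h1 := mul_sub_one_pos (m := (j : ℤ) - 2 * n + i + 1) (by omega) (by omega)
          have h2 : (j : ℤ) = 0 ∨ (n : ℤ) - j = 0 := by omega
          rw [mul_eq_zero.2 h2] at e
          linarith
        · have h1 := mul_sub_one_nonneg ((j : ℤ) - 2 * n + i + 1)
          have h2 : 0 < (j : ℤ) * ((n : ℤ) - j) := mul_pos (by omega) (by omega)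
          linarith
    · have e : ((n : ℤ) ^ 2 - 1 + (3 * n - 2 * i - 2 + 1) ^ 2) -
          ((2 * (3 * n - 2 * i - 2) + 2) * (3 * n - 2 * j) + -1 * (-(4 * (2 * n - j) * (j - n)))) =
          4 * (((i : ℤ) + 1 - j) * (i + 1 - j - 1)) := by ring
      simp only [gapCoords, if_neg hjn, if_pos hj, Matrix.cons_val]
      refine ⟨trivial, fun h => ?_, fun h => ?_⟩
      · have : (i : ℤ) + 1 - j = 0 ∨ (i : ℤ) + 1 - j - 1 = 0 := by omega
        rw [mul_eq_zero.2 this] at e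
        linarith
      · have := mul_sub_one_pos (m := (i : ℤ) + 1 - j) (by omega) (by omega)
        linarith

theorem gapCoords_apex (hn : 3 ≤ n) : gapCoords n (2 * n) = ![0, 0, 1] ∧
    gapCoords n (2 * n + 1) = ![0, 2 * (n : ℤ) ^ 2, -3] ∧
    gapCoords n (2 * n + 2) = ![0, -(2 * (n : ℤ) ^ 2), -3] := by
  refine ⟨?_, ?_, ?_⟩ <;> unfold gapCoords
  · rw [if_neg (by omega), if_neg (by omega), if_pos rfl]
  · rw [if_neg (by omega), if_neg (by omega), if_neg (by omega), if_pos rfl]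
  · rw [if_neg (by omega), if_neg (by omega), if_neg (by omega), if_neg (by omega)]

theorem forall_lt_gap {P : ℕ → Prop} (h : ∀ j < 2 * n, P j) (h0 : P (2 * n)) (h1 : P (2 * n + 1))
    (h2 : P (2 * n + 2)) : ∀ j < 2 * n + 3, P j := by
  intro j hj
  by_cases hj' : j < 2 * n
  · exact h j hj'
  · obtain rfl | rfl | rfl : j = 2 * n ∨ j = 2 * n + 1 ∨ j = 2 * n + 2 := by omega
    exacts [h0, h1, h2]

/-- The facets over an edge of the polygon. -/
theorem exists_supporting_cone (hn : 3 ≤ n) {i : ℕ} (hi : i < 2 * n) {c : ℕ}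
    (hc : c = 2 * n ∨ c = 2 * n + 1 ∧ i < n ∨ c = 2 * n + 2 ∧ n ≤ i) :
    ∃ (m : Fin 3 → ℤ) (κ : ℤ), 0 < κ ∧ ∀ j < 2 * n + 3,
      ((j = i ∨ j = i + 1 ∧ j < 2 * n ∨ i + 1 = 2 * n ∧ j = 0) ∨ j = c →
        dot m (gapCoords n j) = κ) ∧
      (¬ ((j = i ∨ j = i + 1 ∧ j < 2 * n ∨ i + 1 = 2 * n ∧ j = 0) ∨ j = c) →
        dot m (gapCoords n j) < κ) := by
  obtain ⟨u, σ, hσ, hj⟩ := exists_supporting_edge hn hi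
  obtain ⟨g0, g1, g2⟩ := gapCoords_apex hn
  set κ : ℤ := n ^ 2 - 1 + (u + 1) ^ 2 with hκ
  have hn' : (9 : ℤ) ≤ n ^ 2 := by
    have : (3 : ℤ) ≤ n := by exact_mod_cast hn
    nlinarith
  have hκn : (n : ℤ) ^ 2 - 1 ≤ κ := by have := sq_nonneg (u + 1); linarith
  have hσ' : σ = 1 ∨ σ = -1 := hσ.imp And.left And.left
  rcases hc with rfl | hc
  -- The third coefficient is fixed by requiring equality at the apex `(0, 0, 1)`.
  · refine ⟨![2 * u + 2, σ, κ], κ, by linarith, forall_lt_gap (fun j hj' => ?_) ?_ ?_ ?_⟩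
    · obtain ⟨h1, h2, h3⟩ := hj j hj'
      simp only [dot, Matrix.cons_val, h1, mul_zero, add_zero]
      exact ⟨fun h => h2 (by omega), fun h => h3 (by omega)⟩
    · simp [dot, g0]
    · refine ⟨fun h => by omega, fun _ => ?_⟩
      rcases hσ' with rfl | rfl <;> simp [dot, g1] <;> linarith
    · refine ⟨fun h => by omega, fun _ => ?_⟩
      rcases hσ' with rfl | rfl <;> simp [dot, g2] <;> linarith
  -- The edge functional is scaled by `3`, so that equality at the apex `(0, 2 * σ * n ^ 2, -3)` has
  -- an integral solution. The upper apex lies strictly below because `2 * n ^ 2 < 4 * κ`.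
  · refine ⟨![3 * (2 * u + 2), 3 * σ, 2 * n ^ 2 - κ], 3 * κ, by linarith,
      forall_lt_gap (fun j hj' => ?_) ?_ ?_ ?_⟩
    · obtain ⟨h1, h2, h3⟩ := hj j hj'
      simp only [dot, Matrix.cons_val, h1, mul_zero, add_zero]
      exact ⟨fun h => by linarith [h2 (by omega)], fun h => by linarith [h3 (by omega)]⟩
    · refine ⟨fun h => by omega, fun _ => ?_⟩
      simp [dot, g0]
      linarith
    · rcases hσ with ⟨rfl, hin⟩ | ⟨rfl, hin⟩
      · refine ⟨fun _ => ?_, fun h => by omega⟩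
        simp [dot, g1]
        ring
      · refine ⟨fun h => by omega, fun _ => ?_⟩
        simp [dot, g1]
        linarith
    · rcases hσ with ⟨rfl, hin⟩ | ⟨rfl, hin⟩
      · refine ⟨fun h => by omega, fun _ => ?_⟩
        simp [dot, g2]
        linarith
      · refine ⟨fun _ => ?_, fun h => by omega⟩
        simp [dot, g2]
        ring

/-- The two facets containing both vertices `2n + 1` and `2n + 2`. -/
theorem exists_supporting_side (hn : 3 ≤ n) {a : ℕ} (ha : a = 0 ∨ a = n) :
    ∃ (m : Fin 3 → ℤ) (κ : ℤ), 0 < κ ∧ ∀ j < 2 * n + 3,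
      (j = a ∨ j = 2 * n + 1 ∨ j = 2 * n + 2 → dot m (gapCoords n j) = κ) ∧
      (¬ (j = a ∨ j = 2 * n + 1 ∨ j = 2 * n + 2) → dot m (gapCoords n j) < κ) := by
  obtain ⟨g0, g1, g2⟩ := gapCoords_apex hn
  have hX : ∀ j < 2 * n, gapCoords n j 2 = 0 ∧
      (gapCoords n j 0 = if j ≤ n then 2 * (j : ℤ) - n else 3 * n - 2 * j) := by
    intro j hj
    by_cases hjn : j ≤ n
    · simp [gapCoords, hjn]
    · simp [gapCoords, hjn, hj]
  obtain ⟨τ, hτ⟩ : ∃ τ : ℤ, τ = -3 ∧ a = 0 ∨ τ = 3 ∧ a = n := by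
    rcases ha with rfl | rfl
    exacts [⟨-3, Or.inl ⟨rfl, rfl⟩⟩, ⟨3, Or.inr ⟨rfl, rfl⟩⟩]
  -- Parallel to the edge joining the two lower apices; in the polygon the maximum is attained only
  -- at its extreme abscissa, `-n` or `n`.
  refine ⟨![τ, 0, -n], 3 * n, by omega, forall_lt_gap (fun j hj => ?_) ?_ ?_ ?_⟩
  · obtain ⟨h1, h2⟩ := hX j hj
    simp only [dot, Matrix.cons_val, h1, h2, mul_zero, add_zero, zero_mul]
    rcases hτ with ⟨rfl, rfl⟩ | ⟨rfl, rfl⟩ <;> split_ifs <;> constructor <;> intro h <;> omega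
  · refine ⟨fun h => by omega, fun _ => ?_⟩
    simp [dot, g0]
    omega
  · refine ⟨fun _ => ?_, fun h => by omega⟩
    simp [dot, g1]
    ring
  · refine ⟨fun _ => ?_, fun h => by omega⟩
    simp [dot, g2]
    ring

theorem exists_supporting_gapTriple (hn : 3 ≤ n) {a b c : ℕ} (h : GapTriple n a b c) :
    ∃ (m : Fin 3 → ℤ) (κ : ℤ), 0 < κ ∧ ∀ j < 2 * n + 3,
      (j = a ∨ j = b ∨ j = c → dot m (gapCoords n j) = κ) ∧
      (¬ (j = a ∨ j = b ∨ j = c) → dot m (gapCoords n j) < κ) := by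
  have key : ∀ i < 2 * n, (c = 2 * n ∨ c = 2 * n + 1 ∧ i < n ∨ c = 2 * n + 2 ∧ n ≤ i) →
      (∀ j < 2 * n + 3, (j = a ∨ j = b ∨ j = c) ↔
        ((j = i ∨ j = i + 1 ∧ j < 2 * n ∨ i + 1 = 2 * n ∧ j = 0) ∨ j = c)) →
      ∃ (m : Fin 3 → ℤ) (κ : ℤ), 0 < κ ∧ ∀ j < 2 * n + 3,
        (j = a ∨ j = b ∨ j = c → dot m (gapCoords n j) = κ) ∧
        (¬ (j = a ∨ j = b ∨ j = c) → dot m (gapCoords n j) < κ) := by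
    intro i hi hc hiff
    obtain ⟨m, κ, hκ, hj⟩ := exists_supporting_cone hn hi hc
    exact ⟨m, κ, hκ, fun j hj' => by rw [hiff j hj']; exact hj j hj'⟩
  rcases h with ⟨rfl, h, rfl⟩ | ⟨rfl, h, rfl⟩ | ⟨rfl, h, rfl⟩ | ⟨rfl, h, h', rfl⟩ |
    ⟨rfl, h, rfl⟩ | ⟨rfl, rfl, rfl⟩ | ⟨rfl, rfl, rfl⟩
  · exact key a (by omega) (by omega) (by omega)
  · exact key b (by omega) (by omega) (by omega)
  · exact key a (by omega) (by omega) (by omega)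
  · exact key a (by omega) (by omega) (by omega)
  · exact key b (by omega) (by omega) (by omega)
  · exact exists_supporting_side hn (Or.inl rfl)
  · exact exists_supporting_side hn (Or.inr rfl)

theorem isPolytopeCertificate_gap (hn : 3 ≤ n) : IsPolytopeCertificate (gapTriangles n)
    fun v => WithLp.toLp 2 fun i => (gapCoords n v i : ℝ) where
  nonempty := by
    obtain ⟨t, ht, -⟩ := gapTriangles_covers hn ⟨0, by omega⟩
    exact ⟨t, ht⟩
  card_eq := card_of_mem_gapTriangles hn
  supporting := by
    intro t ht
    obtain ⟨a, b, c, h, rfl⟩ := mem_gapTriangles.1 ht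
    obtain ⟨m, κ, hκ, hj⟩ := exists_supporting_gapTriple hn h
    refine exists_supporting_of_int (q := fun v : Fin (2 * n + 3) => gapCoords n v)
      ⟨m, κ, hκ, fun v => ?_⟩
    have := hj v v.2
    simpa only [Finset.mem_insert, Finset.mem_singleton, Fin.ext_iff] using this
  edge := gapTriangles_edge hn
  covers := gapTriangles_covers hn

end FamilyCoordinates

/-! ### A short and a long monotone conservative path -/

section LengthGap

/-- The vertex with label `i`. -/
def gapVertex (n i : ℕ) : Fin (2 * n + 3) := Fin.ofNat (2 * n + 3) i

/-- The family `T` lies between the sphere with vertex `2n - 1` deleted and the sphere. -/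
structure IsGapFamily (n : ℕ) (T : Finset (Finset (Fin (2 * n + 3)))) : Prop where
  three_le : 3 ≤ n
  subset : T ⊆ gapTriangles n
  superset : ∀ t ∈ gapTriangles n, gapVertex n (2 * n - 1) ∉ t → t ∈ T

/-- Labels of a triangle which avoids the vertex `2n - 1`. -/
def GapFace (n i j k : ℕ) : Prop :=
  (GapAdj n i j ∧ GapAdj n i k ∧ GapAdj n j k) ∧ (i < 2 * n + 3 ∧ j < 2 * n + 3 ∧ k < 2 * n + 3) ∧
    i ≠ 2 * n - 1 ∧ j ≠ 2 * n - 1 ∧ k ≠ 2 * n - 1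

/-- The target set. -/
def gapTarget (n : ℕ) : Finset (Fin (2 * n + 3)) :=
  {gapVertex n n, gapVertex n (2 * n + 1), gapVertex n (2 * n + 2)}

variable {n : ℕ} {T : Finset (Finset (Fin (2 * n + 3)))}

theorem val_gapVertex {i : ℕ} (hi : i < 2 * n + 3) : (gapVertex n i).val = i :=
  Nat.mod_eq_of_lt hi

theorem gapVertex_eq_iff {i j : ℕ} (hi : i < 2 * n + 3) (hj : j < 2 * n + 3) :
    gapVertex n i = gapVertex n j ↔ i = j := by
  rw [Fin.ext_iff, val_gapVertex hi, val_gapVertex hj]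

theorem gapVertex_mem_gapTarget {i : ℕ} (hi : i < 2 * n + 3) :
    gapVertex n i ∈ (gapTarget n : Set (Fin (2 * n + 3))) ↔
      i = n ∨ i = 2 * n + 1 ∨ i = 2 * n + 2 := by
  rw [gapTarget, Finset.mem_coe, Finset.mem_insert, Finset.mem_insert, Finset.mem_singleton,
    gapVertex_eq_iff hi (by omega), gapVertex_eq_iff hi (by omega), gapVertex_eq_iff hi (by omega)]

namespace IsGapFamily

theorem card_eq_three (h : IsGapFamily n T) : ∀ t ∈ T, t.card = 3 :=
  fun t ht => card_of_mem_gapTriangles h.three_le t (h.subset ht)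

theorem mem (h : IsGapFamily n T) {i j k : ℕ} (hf : GapFace n i j k) :
    {gapVertex n i, gapVertex n j, gapVertex n k} ∈ T := by
  obtain ⟨⟨h1, h2, h3⟩, ⟨hi, hj, hk⟩, h4, h5, h6⟩ := hf
  refine h.superset _ (insert_mem_gapTriangles h.three_le ?_ ?_ ?_) ?_
  · rwa [val_gapVertex hi, val_gapVertex hj]
  · rwa [val_gapVertex hi, val_gapVertex hk]
  · rwa [val_gapVertex hj, val_gapVertex hk]
  · rw [Finset.mem_insert, Finset.mem_insert, Finset.mem_singleton,
      gapVertex_eq_iff (by omega) hi, gapVertex_eq_iff (by omega) hj,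
      gapVertex_eq_iff (by omega) hk]
    omega

theorem adj (h : IsGapFamily n T) {i j k : ℕ} (hf : GapFace n i j k) :
    (skeletonGraph (ofTriangles T)).Adj (gapVertex n i) (gapVertex n j) := by
  refine skeletonGraph_adj_ofTriangles.2 ⟨?_, _, h.mem hf, by simp, by simp⟩
  rw [Ne, gapVertex_eq_iff hf.2.1.1 hf.2.1.2.1]
  rintro rfl
  exact hf.1.1.elim (fun h => h.1.false) fun h => h.1.false

theorem mem_link (h : IsGapFamily n T) {i j k : ℕ} (hf : GapFace n i j k) :
    gapVertex n j ∈ vertexSet (link (ofTriangles T) (gapVertex n i)) := by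
  obtain ⟨h1, h2⟩ := skeletonGraph_adj_ofTriangles.1 (h.adj hf)
  exact mem_vertexSet_link_ofTriangles.2 ⟨h1, h2⟩

theorem link_adj (h : IsGapFamily n T) {i j k : ℕ} (hf : GapFace n i j k) :
    (skeletonGraph (link (ofTriangles T) (gapVertex n i))).Adj (gapVertex n j)
      (gapVertex n k) := by
  have hmem := h.mem hf
  obtain ⟨⟨h1, h2, h3⟩, ⟨hi, hj, hk⟩, -⟩ := hf
  refine skeletonGraph_link_adj_ofTriangles.2 ⟨?_, ?_, ?_, _, hmem, by simp, by simp, by simp⟩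
  · rw [Ne, gapVertex_eq_iff hj hk]
    rintro rfl
    exact h3.elim (fun h => h.1.false) fun h => h.1.false
  · rw [Ne, gapVertex_eq_iff hi hj]
    rintro rfl
    exact h1.elim (fun h => h.1.false) fun h => h.1.false
  · rw [Ne, gapVertex_eq_iff hi hk]
    rintro rfl
    exact h2.elim (fun h => h.1.false) fun h => h.1.false

theorem vdist_eq_zero {i : ℕ} (hi : i = n ∨ i = 2 * n + 1 ∨ i = 2 * n + 2) :
    vdist (ofTriangles T) {gapVertex n i} (gapTarget n) = 0 :=
  vdist_singleton_eq_zero_iff.2 ((gapVertex_mem_gapTarget (by omega)).2 hi)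

theorem vdist_eq_one (h : IsGapFamily n T) {i : ℕ} (hi : i < n ∨ i = 2 * n) :
    vdist (ofTriangles T) {gapVertex n i} (gapTarget n) = 1 := by
  have hn := h.three_le
  refine le_antisymm ?_ (one_le_vdist_singleton_iff.2 ?_)
  · rcases hi with hi | rfl
    · have hadj := h.adj (i := i) (j := 2 * n + 1) (k := i + 1)
        (by unfold GapFace GapAdj GapEdge; omega)
      refine (vdist_le_add_one_of_adj hadj).trans_eq ?_
      rw [vdist_eq_zero (by omega), zero_add]
    · have hadj := h.adj (i := 2 * n) (j := n) (k := n - 1)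
        (by unfold GapFace GapAdj GapEdge; omega)
      refine (vdist_le_add_one_of_adj hadj).trans_eq ?_
      rw [vdist_eq_zero (by omega), zero_add]
  · rw [gapVertex_mem_gapTarget (by omega)]
    omega

theorem mem_nextTarget_of_mem (h : IsGapFamily n T) {i j k : ℕ} (hf : GapFace n i j k)
    (hi : i = n ∨ i = 2 * n + 1 ∨ i = 2 * n + 2) (hj : j = n ∨ j = 2 * n + 1 ∨ j = 2 * n + 2) :
    gapVertex n j ∈ nextTarget (ofTriangles T) (gapTarget n) (gapVertex n i) := by
  rw [nextTarget_of_mem ((gapVertex_mem_gapTarget hf.2.1.1).2 hi)]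
  exact ⟨(gapVertex_mem_gapTarget hf.2.1.2.1).2 hj, h.mem_link hf⟩

theorem mem_nextTarget_of_lt (h : IsGapFamily n T) {i j k : ℕ} (hf : GapFace n i j k)
    (hi : i < n ∨ i = 2 * n) (hj : j = n ∨ j = 2 * n + 1 ∨ j = 2 * n + 2) :
    gapVertex n j ∈ nextTarget (ofTriangles T) (gapTarget n) (gapVertex n i) :=
  (mem_nextTarget_of_notMem (n := 0) (by rw [h.vdist_eq_one hi]; rfl)).2
    ⟨h.mem_link hf, by rw [vdist_eq_zero hj]; rfl⟩

theorem one_le_linkDist (h : IsGapFamily n T) {i j : ℕ}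
    (hi : (i = n ∨ i = 2 * n + 1 ∨ i = 2 * n + 2) ∨ i < n ∨ i = 2 * n)
    (hj : j < n ∨ j = 2 * n) :
    1 ≤ linkDist (ofTriangles T) (gapTarget n) (gapVertex n i) (gapVertex n j) := by
  have := h.three_le
  rw [one_le_linkDist_iff]
  rcases hi with hi | hi
  · rw [nextTarget_of_mem ((gapVertex_mem_gapTarget (by omega)).2 hi)]
    intro hmem
    have := (gapVertex_mem_gapTarget (i := j) (by omega)).1 hmem.1
    omega
  · rw [mem_nextTarget_of_notMem (n := 0) (by rw [h.vdist_eq_one hi]; rfl), h.vdist_eq_one hj]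
    exact fun hmem => one_ne_zero hmem.2

theorem linkDist_le_one (h : IsGapFamily n T) {i j k : ℕ} (hf : GapFace n i j k)
    (hk : gapVertex n k ∈ nextTarget (ofTriangles T) (gapTarget n) (gapVertex n i)) :
    linkDist (ofTriangles T) (gapTarget n) (gapVertex n i) (gapVertex n j) ≤ 1 := by
  refine (vdist_le_add_one_of_adj (h.link_adj hf)).trans_eq ?_
  rw [vdist_singleton_eq_zero_iff.2 hk, zero_add]

/-- The link of `2n` is the cycle, or the cycle with `2n - 1` removed, and `n` is its only target
vertex. Thus rotating about `2n` takes the whole arc from `i` to `n`. -/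
theorem linkDist_apex (h : IsGapFamily n T) {i : ℕ} (hi : i ≤ n) :
    linkDist (ofTriangles T) (gapTarget n) (gapVertex n (2 * n)) (gapVertex n i) =
      (n - i : ℕ) := by
  have hn := h.three_le
  have hd := h.vdist_eq_one (i := 2 * n) (by omega)
  have hadj : ∀ i < n, (skeletonGraph (link (ofTriangles T) (gapVertex n (2 * n)))).Adj
      (gapVertex n i) (gapVertex n (i + 1)) := fun i hi =>
    h.link_adj (by unfold GapFace GapAdj GapEdge; omega)
  refine le_antisymm ?_ ?_
  · obtain ⟨m, rfl⟩ : ∃ m, i = n - m := ⟨n - i, by omega⟩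
    have hm : ∀ m ≤ n, linkDist (ofTriangles T) (gapTarget n) (gapVertex n (2 * n))
        (gapVertex n (n - m)) ≤ m := by
      intro m hm
      induction m with
      | zero =>
        refine (linkDist_eq_zero_iff.2 ?_).le
        exact h.mem_nextTarget_of_lt (k := n - 1) (by unfold GapFace GapAdj GapEdge; omega)
          (by omega) (by omega)
      | succ m ih =>
        refine (vdist_le_add_one_of_adj (hadj (n - (m + 1)) (by omega))).trans ?_
        rw [show n - (m + 1) + 1 = n - m by omega]
        push_cast
        gcongr
        exact ih (by omega)
    by_cases hmn : m ≤ n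
    · rw [show n - (n - m) = m by omega]
      exact hm m hmn
    · rw [show n - m = n - n by omega, show n - (n - n) = n by omega]
      exact hm n le_rfl
  · have := le_vdist_of_lipschitz (S := nextTarget (ofTriangles T) (gapTarget n)
      (gapVertex n (2 * n))) (not_isZeroDim_of_adj (hadj 0 (by omega)))
      -- The absolute difference of `v` and `n`, written with truncated subtraction. It is also
      -- Lipschitz across the closing edge `{0, 2n - 1}`, where its values are `n` and `n - 1`.
      (f := fun v => (n - v.val) + (v.val - n)) ?_ ?_ (gapVertex n i)
    · rw [val_gapVertex (by omega)] at this
      rwa [show n - i + (i - n) = n - i by omega] at this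
    · intro u w huw
      obtain ⟨h1, h2, h3, t, ht, hxt, hut, hwt⟩ := skeletonGraph_link_adj_ofTriangles.1 huw
      have e1 := gapAdj_of_mem hn (h.subset ht) hut hwt h1
      have e2 := gapAdj_of_mem hn (h.subset ht) hxt hut h2
      have e3 := gapAdj_of_mem hn (h.subset ht) hxt hwt h3
      rw [val_gapVertex (by omega)] at e2 e3
      unfold GapAdj GapEdge at e1 e2 e3
      have := u.2
      have := w.2
      have hu : u.val < 2 * n := by omega
      have hw : w.val < 2 * n := by omega
      clear e2 e3
      show (n - u.val) + (u.val - n) ≤ (n - w.val) + (w.val - n) + 1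
      omega
    · intro w hw
      rw [mem_nextTarget_of_notMem (n := 0) (by rw [hd]; rfl)] at hw
      obtain ⟨hw, hw0⟩ := hw
      obtain ⟨h2, t, ht, hxt, hwt⟩ := mem_vertexSet_link_ofTriangles.1 hw
      have e2 := gapAdj_of_mem hn (h.subset ht) hxt hwt h2
      rw [val_gapVertex (by omega)] at e2
      have hwS : w ∈ (gapTarget n : Set _) := vdist_singleton_eq_zero_iff.1 hw0
      have hwv : w = gapVertex n w.val := Fin.ext (val_gapVertex w.2).symm
      rw [hwv, gapVertex_mem_gapTarget w.2] at hwS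
      unfold GapAdj GapEdge at e2
      show (n - w.val) + (w.val - n) = 0
      omega

theorem gapVertex_ne {i j : ℕ} (hij : i < 2 * n + 3 ∧ j < 2 * n + 3 ∧ i ≠ j) :
    gapVertex n i ≠ gapVertex n j := by
  rw [Ne, gapVertex_eq_iff hij.1 hij.2.1]
  exact hij.2.2

/-- The last step, into the target facet. -/
theorem linkDist_link_lt (h : IsGapFamily n T) {i j k l : ℕ} (hf : GapFace n i j k)
    (hi : i = n ∨ i = 2 * n + 1 ∨ i = 2 * n + 2) (hj : j = n ∨ j = 2 * n + 1 ∨ j = 2 * n + 2)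
    (hk : k = n ∨ k = 2 * n + 1 ∨ k = 2 * n + 2) (hl : l < n) :
    linkDist (link (ofTriangles T) (gapVertex n i))
        (nextTarget (ofTriangles T) (gapTarget n) (gapVertex n i)) (gapVertex n j)
        (gapVertex n k) <
      linkDist (link (ofTriangles T) (gapVertex n i))
        (nextTarget (ofTriangles T) (gapTarget n) (gapVertex n i)) (gapVertex n j)
        (gapVertex n l) := by
  have hjt := h.mem_nextTarget_of_mem hf hi hj
  have hf' : GapFace n i k j := by
    obtain ⟨⟨h1, h2, h3⟩, ⟨h4, h5, h6⟩, h7, h8, h9⟩ := hf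
    exact ⟨⟨h2, h1, h3.symm'⟩, ⟨h4, h6, h5⟩, h7, h9, h8⟩
  have hkt := h.mem_nextTarget_of_mem hf' hi hk
  have h0 : linkDist (link (ofTriangles T) (gapVertex n i))
      (nextTarget (ofTriangles T) (gapTarget n) (gapVertex n i)) (gapVertex n j)
      (gapVertex n k) = 0 := by
    rw [linkDist_eq_zero_iff, nextTarget_of_mem hjt]
    refine ⟨hkt, ?_⟩
    obtain ⟨h1, h2⟩ := h.link_adj hf
    exact ⟨by simp, by simpa using h1, h2⟩
  rw [h0, ← Order.one_le_iff_pos, one_le_linkDist_iff, nextTarget_of_mem hjt]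
  intro hmem
  have h1 := hmem.1
  rw [nextTarget_of_mem ((gapVertex_mem_gapTarget hf.2.1.1).2 hi)] at h1
  have := (gapVertex_mem_gapTarget (i := l) (by omega)).1 h1.1
  omega

/-- The label `l j` marks a vertex of the facet at time `j` that no earlier facet contains, so no
facet recurs. -/
theorem injective_toFinset {N : ℕ} {Γ : Fin (N + 1) → List (Fin (2 * n + 3))}
    {l : ℕ → ℕ} (hl : ∀ i : Fin (N + 1), gapVertex n (l i) ∈ Γ i)
    (hlt : ∀ i j : Fin (N + 1), i < j → gapVertex n (l j) ∉ Γ i) :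
    Function.Injective fun i => (Γ i).toFinset := by
  have key : ∀ i j : Fin (N + 1), i < j → (Γ i).toFinset ≠ (Γ j).toFinset := fun i j hij he =>
    hlt i j hij (List.mem_toFinset.1 (he ▸ List.mem_toFinset.2 (hl j)))
  intro i j hij
  rcases lt_trichotomy i j with hlt | heq | hlt
  exacts [absurd hij (key i j hlt), heq, absurd hij.symm (key j i hlt)]

/-- With head `0` the first step already brings in `2n + 1`, a target vertex. Two further steps add
the other target vertices `2n + 2` and `n`. -/
theorem exists_short_path (h : IsGapFamily n T) : ∃ Γ : Fin (3 + 1) → List (Fin (2 * n + 3)),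
    IsMonotoneConservativePath (ofTriangles T) (gapTarget n)
      {gapVertex n (2 * n), gapVertex n 0, gapVertex n 1} (gapTarget n) 3 Γ := by
  have hn := h.three_le
  have hd : ∀ i, i < n ∨ i = 2 * n → _ := fun i hi => h.vdist_eq_one hi
  have hc : vdist (ofTriangles T) {gapVertex n (2 * n + 1)} (gapTarget n) = 0 :=
    vdist_eq_zero (by omega)
  have f1 : GapFace n 0 1 (2 * n + 1) := by unfold GapFace GapAdj GapEdge; omega
  have f2 : GapFace n (2 * n + 1) 0 (2 * n + 2) := by unfold GapFace GapAdj GapEdge; omega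
  have f3 : GapFace n (2 * n + 1) (2 * n + 2) n := by unfold GapFace GapAdj GapEdge; omega
  have f4 : GapFace n 0 (2 * n + 1) 1 := by unfold GapFace GapAdj GapEdge; omega
  have hc' := h.mem_nextTarget_of_mem f3 (by omega) (by omega)
  have hlt : linkDist (ofTriangles T) (gapTarget n) (gapVertex n (2 * n + 1))
      (gapVertex n (2 * n + 2)) < linkDist (ofTriangles T) (gapTarget n)
      (gapVertex n (2 * n + 1)) (gapVertex n 0) := by
    rw [linkDist_eq_zero_iff.2 hc', ← Order.one_le_iff_pos]
    exact h.one_le_linkDist (by omega) (by omega)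
  refine ⟨![[gapVertex n 0, gapVertex n 1, gapVertex n (2 * n)],
    [gapVertex n (2 * n + 1), gapVertex n 0, gapVertex n 1],
    [gapVertex n (2 * n + 1), gapVertex n (2 * n + 2), gapVertex n 0],
    [gapVertex n (2 * n + 1), gapVertex n (2 * n + 2), gapVertex n n]],
    isMonotoneConservativePath_of_steps h.card_eq_three ?_ ?_ ?_ ?_ ?_ ?_⟩
  · ext v
    simp
    tauto
  · ext v
    simp [gapTarget, Fin.last]
    tauto
  · intro i
    fin_cases i
    all_goals
      refine isOrderedFacet_triple h.card_eq_three (h.mem ?_)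
      unfold GapFace GapAdj GapEdge
      omega
  · refine isAdmissible_triple.2 ⟨?_, ?_, ?_⟩
    · rw [hd 0 (by omega), hd 1 (by omega)]
    · rw [hd 0 (by omega), hd (2 * n) (by omega)]
    · exact (h.linkDist_le_one f1 (h.mem_nextTarget_of_lt f4 (by omega) (by omega))).trans
        (h.one_le_linkDist (by omega) (by omega))
  · intro i
    fin_cases i
    · refine isMonoConsStep_center (gapVertex_ne (by omega)) (gapVertex_ne (by omega)) (gapVertex_ne (by omega))
        (List.Perm.refl _) ?_ ?_ ?_
      · rw [hd 0 (by omega), hc]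
        exact zero_lt_one
      · rw [hd 0 (by omega), hd 1 (by omega)]
      · exact (h.linkDist_le_one f2 hc').trans (h.one_le_linkDist (by omega) (by omega))
    · refine isMonoConsStep_rotate (gapVertex_ne (by omega)) (gapVertex_ne (by omega)) (gapVertex_ne (by omega))
        (gapVertex_ne (by omega)) ?_ ?_ hlt
      · rw [hc]; exact zero_le
      · rw [hc]; exact zero_le
    · refine isMonoConsStep_last (gapVertex_ne (by omega)) (gapVertex_ne (by omega)) (gapVertex_ne (by omega)) ?_ ?_ ?_
        (h.linkDist_link_lt f3 (by omega) (by omega) (by omega) (by omega))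
      · rw [hc]; exact zero_le
      · rw [hc]; exact zero_le
      · rw [linkDist_eq_zero_iff.2 hc']; exact zero_le
  · refine injective_toFinset
      (l := fun i => if i = 0 then 2 * n else if i = 1 then 2 * n + 1 else
        if i = 2 then 2 * n + 2 else n) ?_ ?_
    · intro i
      fin_cases i <;> simp
    · intro i j hij
      have e : ∀ i j, i < 2 * n + 3 → j < 2 * n + 3 → (gapVertex n i = gapVertex n j ↔ i = j) :=
        fun i j => gapVertex_eq_iff
      fin_cases i <;> fin_cases j <;> first | exact absurd hij (by decide) | skip
      all_goals
        norm_num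
        rw [e _ _ (by omega) (by omega), e _ _ (by omega) (by omega),
          e _ _ (by omega) (by omega)]
        omega

/-- The path around the vertex `2n`. -/
def longPath (n i : ℕ) : List (Fin (2 * n + 3)) :=
  if i + 1 < n then [gapVertex n (2 * n), gapVertex n (i + 1), gapVertex n i]
  else if i + 1 = n then [gapVertex n n, gapVertex n (n - 1), gapVertex n (2 * n)]
  else if i = n then [gapVertex n n, gapVertex n (2 * n + 1), gapVertex n (n - 1)]
  else [gapVertex n n, gapVertex n (2 * n + 1), gapVertex n (2 * n + 2)]

theorem isMonoConsStep_longPath (h : IsGapFamily n T) {i : ℕ} (hi : i < n + 1) :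
    IsMonoConsStep (ofTriangles T) (gapTarget n) (longPath n i) (longPath n (i + 1)) := by
  have hn := h.three_le
  have hd : ∀ i, i < n ∨ i = 2 * n → _ := fun i hi => h.vdist_eq_one hi
  have hw : vdist (ofTriangles T) {gapVertex n n} (gapTarget n) = 0 := vdist_eq_zero (by omega)
  have f1 : GapFace n n (n - 1) (2 * n + 1) := by unfold GapFace GapAdj GapEdge; omega
  have f2 : GapFace n n (2 * n + 1) (2 * n + 2) := by unfold GapFace GapAdj GapEdge; omega
  have hc := h.mem_nextTarget_of_mem f2 (by omega) (by omega)
  -- As long as `n` is not reached the path rotates about `2n`. Then `n` becomes the head, one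
  -- rotation brings in `2n + 1`, and the last step exchanges `n - 1` for `2n + 2`.
  by_cases h1 : i + 2 < n
  · rw [longPath, if_pos (by omega), longPath, if_pos (by omega)]
    refine isMonoConsStep_rotate (gapVertex_ne (by omega)) (gapVertex_ne (by omega)) (gapVertex_ne (by omega))
      (gapVertex_ne (by omega)) ?_ ?_ ?_
    · rw [hd (2 * n) (by omega), hd (i + 1 + 1) (by omega)]
    · rw [hd (2 * n) (by omega), hd (i + 1) (by omega)]
    · rw [h.linkDist_apex (by omega), h.linkDist_apex (by omega)]
      exact_mod_cast (by omega : n - (i + 1 + 1) < n - (i + 1))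
  by_cases h2 : i + 2 = n
  · obtain rfl : i = n - 2 := by omega
    rw [longPath, if_pos (by omega), longPath, if_neg (by omega), if_pos (by omega),
      show n - 2 + 1 = n - 1 by omega]
    refine isMonoConsStep_center (gapVertex_ne (by omega)) (gapVertex_ne (by omega)) (gapVertex_ne (by omega))
      (List.Perm.swap _ _ _) ?_ ?_ ?_
    · rw [hd (2 * n) (by omega), hw]
      exact zero_lt_one
    · rw [hd (2 * n) (by omega), hd (n - 1) (by omega)]
    · exact (h.linkDist_le_one f1 hc).trans (h.one_le_linkDist (by omega) (by omega))
  by_cases h3 : i + 1 = n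
  · obtain rfl : i = n - 1 := by omega
    rw [longPath, if_neg (by omega), if_pos (by omega), longPath, if_neg (by omega),
      if_neg (by omega), if_pos (by omega)]
    refine isMonoConsStep_rotate (gapVertex_ne (by omega)) (gapVertex_ne (by omega)) (gapVertex_ne (by omega))
      (gapVertex_ne (by omega)) ?_ ?_ ?_
    · rw [hw]; exact zero_le
    · rw [hw]; exact zero_le
    · rw [linkDist_eq_zero_iff.2 hc, ← Order.one_le_iff_pos]
      exact h.one_le_linkDist (by omega) (by omega)
  · obtain rfl : i = n := by omega
    rw [longPath, if_neg (by omega), if_neg (by omega), if_pos rfl, longPath, if_neg (by omega),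
      if_neg (by omega), if_neg (by omega)]
    refine isMonoConsStep_last (gapVertex_ne (by omega)) (gapVertex_ne (by omega)) (gapVertex_ne (by omega)) ?_ ?_ ?_
      (h.linkDist_link_lt f2 (by omega) (by omega) (by omega) (by omega))
    · rw [hw]; exact zero_le
    · rw [hw]; exact zero_le
    · rw [linkDist_eq_zero_iff.2 hc]; exact zero_le

theorem longPath_cases (n : ℕ) {i : ℕ} (hi : i < n + 2) : ∃ p q r, (i + 1 < n ∧ p = 2 * n ∧
    q = i + 1 ∧ r = i ∨ i + 1 = n ∧ p = n ∧ q = n - 1 ∧ r = 2 * n ∨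
    i = n ∧ p = n ∧ q = 2 * n + 1 ∧ r = n - 1 ∨
    i = n + 1 ∧ p = n ∧ q = 2 * n + 1 ∧ r = 2 * n + 2) ∧
    longPath n i = [gapVertex n p, gapVertex n q, gapVertex n r] := by
  by_cases h1 : i + 1 < n
  · exact ⟨2 * n, i + 1, i, by omega, by rw [longPath, if_pos h1]⟩
  by_cases h2 : i + 1 = n
  · exact ⟨n, n - 1, 2 * n, by omega, by rw [longPath, if_neg h1, if_pos h2]⟩
  by_cases h3 : i = n
  · exact ⟨n, 2 * n + 1, n - 1, by omega, by rw [longPath, if_neg h1, if_neg h2, if_pos h3]⟩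
  · exact ⟨n, 2 * n + 1, 2 * n + 2, by omega,
      by rw [longPath, if_neg h1, if_neg h2, if_neg h3]⟩

theorem isMonotoneConservativePath_longPath (h : IsGapFamily n T) :
    IsMonotoneConservativePath (ofTriangles T) (gapTarget n)
      {gapVertex n (2 * n), gapVertex n 0, gapVertex n 1} (gapTarget n) (n + 1)
      fun i => longPath n i := by
  have hn := h.three_le
  refine isMonotoneConservativePath_of_steps h.card_eq_three ?_ ?_ ?_ ?_ ?_ ?_
  · show (longPath n 0).toFinset = _
    rw [longPath, if_pos (by omega)]
    ext v
    simp
    tauto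
  · show (longPath n (n + 1)).toFinset = _
    rw [longPath, if_neg (by omega), if_neg (by omega), if_neg (by omega)]
    ext v
    simp [gapTarget]
  · rintro ⟨i, hi⟩
    obtain ⟨p, q, r, hpqr, he⟩ := longPath_cases n hi
    show IsOrderedFacet _ (longPath n i)
    rw [he]
    refine isOrderedFacet_triple h.card_eq_three (h.mem ?_)
    clear he
    rcases hpqr with ⟨h1, rfl, rfl, rfl⟩ | ⟨h1, rfl, rfl, rfl⟩ | ⟨h1, rfl, rfl, rfl⟩ |
      ⟨h1, rfl, rfl, rfl⟩ <;> unfold GapFace GapAdj GapEdge <;> omega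
  · show IsAdmissible _ _ (longPath n 0)
    rw [longPath, if_pos (by omega)]
    refine isAdmissible_triple.2 ⟨?_, ?_, ?_⟩
    · rw [h.vdist_eq_one (by omega), h.vdist_eq_one (by omega)]
    · rw [h.vdist_eq_one (by omega), h.vdist_eq_one (by omega)]
    · rw [h.linkDist_apex (by omega), h.linkDist_apex (by omega)]
      exact_mod_cast (by omega : n - (0 + 1) ≤ n - 0)
  · exact fun i => h.isMonoConsStep_longPath i.2
  · refine injective_toFinset (l := fun i => if i < n then i + 1 else i + n + 1) ?_ ?_
    · rintro ⟨i, hi⟩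
      obtain ⟨p, q, r, hpqr, he⟩ := longPath_cases n hi
      show gapVertex n (if i < n then i + 1 else i + n + 1) ∈ longPath n i
      rw [he]
      simp only [List.mem_cons, List.not_mem_nil, or_false]
      rw [gapVertex_eq_iff (by split_ifs <;> omega) (by omega),
        gapVertex_eq_iff (by split_ifs <;> omega) (by omega),
        gapVertex_eq_iff (by split_ifs <;> omega) (by omega)]
      split_ifs <;> omega
    · rintro ⟨i, hi⟩ ⟨j, hj⟩ hij
      have hij : i < j := hij
      obtain ⟨p, q, r, hpqr, he⟩ := longPath_cases n hi
      show gapVertex n (if j < n then j + 1 else j + n + 1) ∉ longPath n i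
      rw [he]
      simp only [List.mem_cons, List.not_mem_nil, or_false]
      rw [gapVertex_eq_iff (by split_ifs <;> omega) (by omega),
        gapVertex_eq_iff (by split_ifs <;> omega) (by omega),
        gapVertex_eq_iff (by split_ifs <;> omega) (by omega)]
      split_ifs <;> omega

theorem hasLengthGap (h : IsGapFamily n T) {k : ℕ} (hk : k + 2 ≤ n) :
    HasLengthGap (ofTriangles T) k := by
  obtain ⟨Γ, hΓ⟩ := h.exists_short_path
  refine ⟨_, gapTarget n, (isFacet_ofTriangles h.card_eq_three).2 ?_,
    (isFacet_ofTriangles h.card_eq_three).2 ?_, 3, n + 1, Γ, _, hΓ,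
    h.isMonotoneConservativePath_longPath, by omega⟩
  · have := h.three_le
    exact h.mem (by unfold GapFace GapAdj GapEdge; omega)
  · have := h.three_le
    exact h.mem (by unfold GapFace GapAdj GapEdge; omega)

end IsGapFamily

end LengthGap

theorem isGapFamily_gapTriangles {n : ℕ} (hn : 3 ≤ n) : IsGapFamily n (gapTriangles n) :=
  ⟨hn, subset_rfl, fun _ ht _ => ht⟩

theorem isGapFamily_deletion {n : ℕ} (hn : 3 ≤ n) :
    IsGapFamily n ((gapTriangles n).filter (gapVertex n (2 * n - 1) ∉ ·)) :=
  ⟨hn, Finset.filter_subset _ _, fun _ ht h => Finset.mem_filter.2 ⟨ht, h⟩⟩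

end MonoCons

theorem mainTheorem10 :
    (∀ k : ℕ, ∃ (V : Type) (_ : Fintype V) (_ : DecidableEq V)
      (C : PreAbstractSimplicialComplex V),
      MonoCons.IsFlag C ∧ MonoCons.IsSimplicialBall 2 C ∧ MonoCons.HasLengthGap C k) ∧
    (∀ k : ℕ, ∃ (V : Type) (_ : Fintype V) (_ : DecidableEq V)
      (C : PreAbstractSimplicialComplex V),
      MonoCons.IsFlag C ∧ MonoCons.IsSimplicialPolytopeBoundary 3 C ∧
        MonoCons.HasLengthGap C k) ∧
    (∃ (V : Type) (_ : Fintype V) (_ : DecidableEq V)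
      (C : PreAbstractSimplicialComplex V),
      MonoCons.IsFlag C ∧ MonoCons.IsSimplicialBall 2 C ∧
        MonoCons.HasNoShortestMonotoneConservativePath C) ∧
    (∃ (V : Type) (_ : Fintype V) (_ : DecidableEq V)
      (C : PreAbstractSimplicialComplex V),
      MonoCons.IsFlag C ∧ MonoCons.IsSimplicialPolytopeBoundary 3 C ∧
        MonoCons.HasNoShortestMonotoneConservativePath C) := by
  refine ⟨fun k => ?_, fun k => ?_, ?_, ?_⟩
  -- With `n = k + 3` the lengths are `3` and `k + 4`, and the requirement `3 ≤ n` holds even for `k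
  -- = 0`.
  · have hn : 3 ≤ k + 3 := by omega
    exact ⟨Fin (2 * (k + 3) + 3), inferInstance, inferInstance,
      MonoCons.ofTriangles ((MonoCons.gapTriangles (k + 3)).filter
        (MonoCons.gapVertex (k + 3) (2 * (k + 3) - 1) ∉ ·)),
      ((MonoCons.noEmptyCliques_gap hn).filter _).isFlag,
      (MonoCons.isPolytopeCertificate_gap hn).isSimplicialBall_deletion (by simp) _,
      (MonoCons.isGapFamily_deletion hn).hasLengthGap (by omega)⟩
  · have hn : 3 ≤ k + 3 := by omega
    exact ⟨Fin (2 * (k + 3) + 3), inferInstance, inferInstance,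
      MonoCons.ofTriangles (MonoCons.gapTriangles (k + 3)),
      (MonoCons.noEmptyCliques_gap hn).isFlag,
      (MonoCons.isPolytopeCertificate_gap hn).isSimplicialPolytopeBoundary,
      (MonoCons.isGapFamily_gapTriangles hn).hasLengthGap (by omega)⟩
  · exact ⟨Fin 20, inferInstance, inferInstance,
      MonoCons.ofTriangles (MonoCons.shortcutTriangles.filter (19 ∉ ·)),
      (MonoCons.noEmptyCliques_shortcut.filter _).isFlag,
      MonoCons.isPolytopeCertificate_shortcut.isSimplicialBall_deletion (by simp) _,
      MonoCons.hasNoShortestMonotoneConservativePath_shortcut (Finset.filter_subset _ _)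
        subset_rfl⟩
  · exact ⟨Fin 20, inferInstance, inferInstance, MonoCons.ofTriangles MonoCons.shortcutTriangles,
      MonoCons.noEmptyCliques_shortcut.isFlag,
      MonoCons.isPolytopeCertificate_shortcut.isSimplicialPolytopeBoundary,
      MonoCons.hasNoShortestMonotoneConservativePath_shortcut subset_rfl
        (Finset.filter_subset _ _)⟩
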